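/- Let $n\ge 1$ and let $\mathfrak g_n$ be either $\mathfrak{gl}(n)$ (all complex $n\times n$ matrices) or $\mathfrak{so}(n)$ (the complex skew-symmetric $n\times n$ matrices), with the form $\beta(x,y)=\operatorname{tr}(xy)$, and let $G_n=GL(n,\mathbb C)$, respectively $SO(n,\mathbb C)$. Put $r_i=\operatorname{rank}\mathfrak g_i$, i.e. $r_i=i$ for $\mathfrak{gl}(i)$ and $r_i=\lfloor i/2\rfloor$ for $\mathfrak{so}(i)$, and $d=\sum_{i=1}^{n-1}r_i$. For $x\in\mathfrak g_n$ let $x_i\in\mathfrak g_i$ be its top left $i\times i$ corner, and for $1\le i\le n$, $1\le j\le r_i$ let $f_{i,j}(x)=\operatorname{tr}(x_i^{\,j})$ if $\mathfrak g_n=\mathfrak{gl}(n)$; if $\mathfrak g_n=\mathfrak{so}(n)$ let $f_{i,j}(x)=\operatorname{tr}(x_i^{2j})$, except that $f_{i,l}(x)=\operatorname{Pf}(x_i)$ (the Pfaffian) when $i=2l$ and $j=l$. For a holomorphic function $f$ on $\mathfrak g_n$ let $\nabla f(x)\in\mathfrak g_n$ be defined by $\beta(\nabla f(x),z)=df_x(z)$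 for all $z\in\mathfrak g_n$; the Hamiltonian vector field of $f$ (for the Lie-Poisson structure) is $(\xi_f)_x=[x,\nabla f(x)]$. The vector field $\xi_{f_{i,j}}$ has the global flow $\theta_{i,j}(t,x)=\operatorname{Ad}(\exp(-t\nabla f_{i,j}(x)))\,x$, $t\in\mathbb C$. These flows commute, and the group $A=\mathbb C^d$ acts on $\mathfrak g_n$ by composing the flows of the $\xi_{f_{i,j}}$ with $1\le i\le n-1$, $1\le j\le r_i$. Let $V_x=\operatorname{span}\{(\xi_{f_{i,j}})_x : 1\le i\le n-1,\ 1\le j\le r_i\}$. An element $x\in\mathfrak g_n$ is regular if its centralizer in $\mathfrak g_n$ has dimension $r_n$, and strongly regular if the differentials $(df_{i,j})_x$, $1\le i\le n$, $1\le j\le r_i$, are linearly independent on $\mathfrak g_n$; let $\mathfrak g_n^{sreg}$ be the set of strongly regular elements. Let $\mathcal O_x=\operatorname{Ad}(G_n)x$ be the adjoint orbit of $x$, with tangent spaces $T_y\mathcal O_x=[y,\mathfrak g_n]$ and with the Kostant-Kirillov-Souriau form $\omega_y([a,y],[b,y])=\beta(y,[a,b])$, and let $\mathcal O_x^{sreg}=\mathcal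 O_x\cap\mathfrak g_n^{sreg}$. Proposition. Let $x\in\mathfrak g_n$ and suppose that $\mathcal O_x^{sreg}\neq\emptyset$. Then: (1) $x$ is regular. (2) $\mathcal O_x^{sreg}$ is Zariski open in $\mathcal O_x$; $\mathcal O_x$ is a complex submanifold of $\mathfrak g_n$ of dimension $2d$, and $(\mathcal O_x^{sreg},\omega)$ is a (complex) symplectic manifold of dimension $2d$. (3) $\mathcal O_x^{sreg}$ is the union of the $A$-orbits $A\cdot y$, $y\in\mathcal O_x^{sreg}$. Each of them is a complex submanifold of dimension $d=\tfrac12\dim\mathcal O_x$ with tangent spaces $V_z$ ($z\in A\cdot y$), and is a Lagrangian submanifold of $(\mathcal O_x^{sreg},\omega)$. (4) $y\mapsto V_y$ is a polarization of $(\mathcal O_x^{sreg},\omega)$, that is, an integrable holomorphic subbundle of the tangent bundle with $V_y=V_y^{\perp}$ for every $y$, and its leaves are exactly the $A$-orbits in $\mathcal O_x^{sreg}$: for each $y\in\mathcal O_x^{sreg}$, the leaf through $y$ (the set of points that can be joined to $y$ by a $C^1$ path in $\mathcal O_x^{sreg}$ everywhere tangent to $V$) is $A\cdot y$. -/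

import Mathlib

open scoped Matrix.Norms.Operator
open Set Matrix Module

attribute [local instance] LieRing.ofAssociativeRing

/-! ### Complex submanifolds, symplectic forms, polarizations and leaves in a complex vector space -/

namespace GZ

section Geometry

variable {E : Type*} [NormedAddCommGroup E] [NormedSpace ℂ E]

/-- `S` is an (embedded) complex submanifold of `E`, of dimension `k`, with tangent spaces `T p`:
near each of its points, `S` is the zero set of a holomorphic submersion `F`, and the tangent
spaces are the kernels of the differentials of `F`. -/
def IsComplexSubmanifold (S : Set E) (T : E → Submodule ℂ E) (k : ℕ) : Prop :=
  ∀ p ∈ S, finrank ℂ (T p) = k ∧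
    ∃ (U : Set E) (m : ℕ) (F : E → (Fin m → ℂ)),
      IsOpen U ∧ p ∈ U ∧ AnalyticOnNhd ℂ F U ∧
      (∀ q ∈ U, Function.Surjective (fderiv ℂ F q)) ∧
      S ∩ U = {q ∈ U | F q = 0} ∧
      ∀ q ∈ S ∩ U, T q = LinearMap.ker (fderiv ℂ F q).toLinearMap

/-- `ω` restricts to a closed holomorphic 2-form on the complex submanifold `M`: its pullback along
every holomorphic map `ψ` from an open subset of some `ℂ^m` into `M` is a closed holomorphic
2-form. (For holomorphic charts `ψ` of `M` this says that `ω` is bilinear and alternating on the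
tangent spaces of `M`, that it depends holomorphically on the point, and that `dω = 0`.)
Only the values of `ω p` on tangent vectors of `M` at `p` matter. -/
def IsClosedHolomorphicTwoForm (M : Set E) (ω : E → E → E → ℂ) : Prop :=
  ∀ (m : ℕ) (W : Set (Fin m → ℂ)) (ψ : (Fin m → ℂ) → E),
    IsOpen W → AnalyticOnNhd ℂ ψ W → MapsTo ψ W M →
    ∃ η : (Fin m → ℂ) → ((Fin m → ℂ) [⋀^Fin 2]→L[ℂ] ℂ),
      AnalyticOnNhd ℂ η W ∧
      (∀ w ∈ W, ∀ u v : Fin m → ℂ,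
        η w ![u, v] = ω (ψ w) (fderiv ℂ ψ w u) (fderiv ℂ ψ w v)) ∧
      ∀ w ∈ W, extDeriv η w = 0

/-- `(M, ω)` is a (complex) symplectic manifold of dimension `k`, where `M` is a complex
submanifold of `E` with tangent spaces `T p`. -/
structure IsSymplecticManifold (M : Set E) (T : E → Submodule ℂ E) (k : ℕ)
    (ω : E → E → E → ℂ) : Prop where
  isSubmanifold : IsComplexSubmanifold M T k
  isClosedForm : IsClosedHolomorphicTwoForm M ω
  nondegenerate : ∀ p ∈ M, ∀ u ∈ T p, (∀ v ∈ T p, ω p u v = 0) → u = 0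

/-- `P` is a Lagrangian subspace of the symplectic vector space `(T, ω)`: `P = P^⊥`. -/
def IsLagrangianSubspace (T : Submodule ℂ E) (ω : E → E → ℂ) (P : Submodule ℂ E) : Prop :=
  P ≤ T ∧ ∀ v ∈ T, v ∈ P ↔ ∀ u ∈ P, ω u v = 0

/-- `L` is a Lagrangian submanifold, of dimension `k` and with tangent spaces `P p`, of the
symplectic manifold `(M, ω)` with tangent spaces `T p`. -/
structure IsLagrangianSubmanifold (M : Set E) (T : E → Submodule ℂ E) (ω : E → E → E → ℂ)
    (L : Set E) (P : E → Submodule ℂ E) (k : ℕ) : Prop where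
  subset : L ⊆ M
  isSubmanifold : IsComplexSubmanifold L P k
  isLagrangian : ∀ p ∈ L, IsLagrangianSubspace (T p) (ω p) (P p)

/-- `P` is a polarization of the symplectic manifold `(M, ω)` with tangent spaces `T p`: an
integrable (holomorphic) subbundle of the tangent bundle of `M`, all of whose fibres are
Lagrangian. -/
structure IsPolarization (M : Set E) (T : E → Submodule ℂ E) (ω : E → E → E → ℂ)
    (P : E → Submodule ℂ E) : Prop where
  /-- Each fibre is Lagrangian, in particular contained in the tangent space of `M`. -/
  isLagrangian : ∀ p ∈ M, IsLagrangianSubspace (T p) (ω p) (P p)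
  /-- `P` is locally spanned by a frame of holomorphic vector fields. -/
  isSubbundle : ∀ p ∈ M, ∃ (U : Set E) (k : ℕ) (X : Fin k → E → E),
    IsOpen U ∧ p ∈ U ∧ (∀ i, AnalyticOnNhd ℂ (X i) U) ∧
    ∀ q ∈ M ∩ U, LinearIndependent ℂ (fun i => X i q) ∧
      Submodule.span ℂ (range fun i => X i q) = P q
  /-- Through each point of `M` there passes an integral manifold of `P`. -/
  isIntegrable : ∀ p ∈ M, ∃ (S : Set E) (k : ℕ), p ∈ S ∧ S ⊆ M ∧ IsComplexSubmanifold S P k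

/-- The leaf through `p` of an integrable distribution `P` on `M`: the set of the points that can be
joined to `p` by a continuously differentiable path in `M` that is everywhere tangent to `P`. -/
def leaf (M : Set E) (P : E → Submodule ℂ E) (p : E) : Set E :=
  {q | ∃ γ γ' : ℝ → E, γ 0 = p ∧ γ 1 = q ∧ ContinuousOn γ' (Icc 0 1) ∧
    ∀ t ∈ Icc (0 : ℝ) 1,
      γ t ∈ M ∧ HasDerivWithinAt γ (γ' t) (Icc 0 1) t ∧ γ' t ∈ P (γ t)}

end Geometry

/-! ### The Lie algebras `gl(n)` and `so(n)` and their adjoint orbits -/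

/-- The two families of complex Lie algebras under consideration. -/
inductive Family
  | gl
  | so

/-- `𝔤ₙ`: all complex `n × n` matrices, or the skew-symmetric ones. -/
def lieAlg (τ : Family) (n : ℕ) : LieSubalgebra ℂ (Matrix (Fin n) (Fin n) ℂ) :=
  match τ with
  | .gl => ⊤
  | .so => LieAlgebra.Orthogonal.so (Fin n) ℂ

/-- The rank of `𝔤ₙ`: `n` for `gl(n)`, and `l` for `so(2l)` and `so(2l+1)`. -/
def rank (τ : Family) (n : ℕ) : ℕ :=
  match τ with
  | .gl => n
  | .so => n / 2

/-- The connected matrix group with Lie algebra `𝔤ₙ`: `GL(n, ℂ)` or `SO(n, ℂ)`. Its image under `Ad`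
is the adjoint group of `𝔤ₙ`. -/
def group (τ : Family) (n : ℕ) : Set (Matrix (Fin n) (Fin n) ℂ) :=
  match τ with
  | .gl => {g | IsUnit g}
  | .so => {g | g * gᵀ = 1 ∧ g.det = 1}

variable {n : ℕ}

/-- The adjoint orbit `𝒪ₓ` of `x`. -/
def adjointOrbit (τ : Family) (x : Matrix (Fin n) (Fin n) ℂ) : Set (Matrix (Fin n) (Fin n) ℂ) :=
  {y | ∃ g ∈ group τ n, y = g * x * g⁻¹}

/-- The centralizer of `x` in `𝔤ₙ`. -/
noncomputable def centralizer (τ : Family) (x : Matrix (Fin n) (Fin n) ℂ) :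
    Submodule ℂ (Matrix (Fin n) (Fin n) ℂ) :=
  (lieAlg τ n).toSubmodule ⊓ LinearMap.ker (LieAlgebra.ad ℂ (Matrix (Fin n) (Fin n) ℂ) x)

/-- `x` is regular: the dimension of its centralizer is the rank of `𝔤ₙ`. -/
def IsRegular (τ : Family) (x : Matrix (Fin n) (Fin n) ℂ) : Prop :=
  finrank ℂ (centralizer τ x) = rank τ n

/-- The tangent space at `y` of the adjoint orbit of `y`, that is `[y, 𝔤ₙ]`. -/
noncomputable def orbitTangent (τ : Family) (y : Matrix (Fin n) (Fin n) ℂ) :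
    Submodule ℂ (Matrix (Fin n) (Fin n) ℂ) :=
  (lieAlg τ n).toSubmodule.map
    (LieAlgebra.ad ℂ (Matrix (Fin n) (Fin n) ℂ) y : End ℂ (Matrix (Fin n) (Fin n) ℂ))

/-- A subset of `X` is Zariski open in `X`: it is the locus in `X` where not all the polynomials of
some family vanish. -/
def IsZariskiOpenIn (S X : Set (Matrix (Fin n) (Fin n) ℂ)) : Prop :=
  ∃ I : Set (MvPolynomial (Fin n × Fin n) ℂ),
    S = {y ∈ X | ∃ p ∈ I, MvPolynomial.eval (fun k => y k.1 k.2) p ≠ 0}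

open Classical in
/-- The Kostant-Kirillov-Souriau form at `y`, given by `ω_y([a, y], [b, y]) = tr(y [a, b])` for
`a, b ∈ 𝔤ₙ`. -/
noncomputable def kks (τ : Family) (y u v : Matrix (Fin n) (Fin n) ℂ) : ℂ :=
  if h : ∃ c : Matrix (Fin n) (Fin n) ℂ × Matrix (Fin n) (Fin n) ℂ,
      (c.1 ∈ lieAlg τ n ∧ ⁅c.1, y⁆ = u) ∧ (c.2 ∈ lieAlg τ n ∧ ⁅c.2, y⁆ = v) then
    trace (y * ⁅h.choose.1, h.choose.2⁆)
  else 0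

theorem trace_mul_lie (y a b : Matrix (Fin n) (Fin n) ℂ) :
    trace (y * ⁅a, b⁆) = - trace (⁅a, y⁆ * b) := by
  simp only [Ring.lie_def, mul_sub, sub_mul, trace_sub]
  rw [← Matrix.mul_assoc, ← Matrix.mul_assoc, Matrix.trace_mul_cycle y b a]
  ring

theorem trace_mul_lie' (y a b : Matrix (Fin n) (Fin n) ℂ) :
    trace (y * ⁅a, b⁆) = trace (a * ⁅b, y⁆) := by
  simp only [Ring.lie_def, mul_sub, trace_sub]
  rw [← Matrix.mul_assoc, ← Matrix.mul_assoc, ← Matrix.mul_assoc, ← Matrix.mul_assoc,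
    Matrix.trace_mul_cycle y a b, Matrix.trace_mul_cycle y b a,
    Matrix.trace_mul_cycle b y a]

/-- The form `kks` is well defined. -/
theorem kks_apply (τ : Family) (y a b : Matrix (Fin n) (Fin n) ℂ)
    (ha : a ∈ lieAlg τ n) (hb : b ∈ lieAlg τ n) :
    kks τ y ⁅a, y⁆ ⁅b, y⁆ = trace (y * ⁅a, b⁆) := by
  have h : ∃ c : Matrix (Fin n) (Fin n) ℂ × Matrix (Fin n) (Fin n) ℂ,
      (c.1 ∈ lieAlg τ n ∧ ⁅c.1, y⁆ = ⁅a, y⁆) ∧ (c.2 ∈ lieAlg τ n ∧ ⁅c.2, y⁆ = ⁅b, y⁆) :=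
    ⟨(a, b), ⟨ha, rfl⟩, hb, rfl⟩
  rw [kks, dif_pos h, trace_mul_lie, h.choose_spec.1.2, ← trace_mul_lie, trace_mul_lie',
    h.choose_spec.2.2, ← trace_mul_lie']

/-! ### The Gelfand-Zeitlin functions -/

/-- The Pfaffian of an `m × m` matrix with `m = 2l` even:
`Pf(A) = (2^l l!)⁻¹ ∑_σ sgn(σ) ∏_{k < l} A_{σ(2k), σ(2k+1)}` (indices start at `0`). -/
noncomputable def pfaffian {m : ℕ} (A : Matrix (Fin m) (Fin m) ℂ) : ℂ :=
  ((2 : ℂ) ^ (m / 2) * (Nat.factorial (m / 2) : ℂ))⁻¹ *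
    ∑ σ : Equiv.Perm (Fin m), ((Equiv.Perm.sign σ : ℤ) : ℂ) *
      ∏ k : Fin (m / 2), A (σ ⟨2 * k, by omega⟩) (σ ⟨2 * k + 1, by omega⟩)

/-- The basic invariants `φ_1, …, φ_r` of `𝔤ₘ`, `r = rank 𝔤ₘ`; the index `j` stands for `j + 1`.
They are `tr(y^j)` for `gl(m)`; `tr(y^{2j})` for `so(2l+1)`; and `tr(y^{2j})`, `j < l`, together
with the Pfaffian, for `so(2l)`. -/
noncomputable def invariant (τ : Family) (m : ℕ) (j : Fin (rank τ m))
    (y : Matrix (Fin m) (Fin m) ℂ) : ℂ :=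
  match τ with
  | .gl => trace (y ^ ((j : ℕ) + 1))
  | .so => if Even m ∧ (j : ℕ) + 1 = m / 2 then pfaffian y else trace (y ^ (2 * ((j : ℕ) + 1)))

/-- The top left hand corner of `x`, of size `i + 1`. -/
def cutoff (x : Matrix (Fin n) (Fin n) ℂ) (i : Fin n) :
    Matrix (Fin ((i : ℕ) + 1)) (Fin ((i : ℕ) + 1)) ℂ :=
  x.submatrix (Fin.castLE i.isLt) (Fin.castLE i.isLt)

/-- The pairs `(i, j)` with `1 ≤ i ≤ m` and `1 ≤ j ≤ rᵢ = rank 𝔤ᵢ`; both indices are shifted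
by one. -/
abbrev Index (τ : Family) (m : ℕ) : Type := Σ i : Fin m, Fin (rank τ ((i : ℕ) + 1))

/-- The inclusion of the pairs with `i ≤ n - 1` into the pairs with `i ≤ n`. -/
def Index.incl {τ : Family} (s : Index τ (n - 1)) : Index τ n :=
  ⟨Fin.castLE (Nat.sub_le n 1) s.1, s.2⟩

/-- The function `f_{i,j}`: the `j`-th basic invariant of the `i × i` cutoff. -/
noncomputable def gzFun (τ : Family) (s : Index τ n) (x : Matrix (Fin n) (Fin n) ℂ) : ℂ :=
  invariant τ _ s.2 (cutoff x s.1)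

/-- The differentials at `x` of all the functions `f_{i,j}`, `1 ≤ i ≤ n`, as functions on `𝔤ₙ`. -/
noncomputable def gzDifferential (τ : Family) (x : Matrix (Fin n) (Fin n) ℂ) (s : Index τ n) :
    lieAlg τ n → ℂ :=
  fun z => lineDeriv ℂ (gzFun τ s) x (z : Matrix (Fin n) (Fin n) ℂ)

/-- The set of the strongly regular elements of `𝔤ₙ`: the differentials at `x` of all the functions
`f_{i,j}`, `1 ≤ i ≤ n`, `1 ≤ j ≤ rᵢ`, are linearly independent. -/
def sreg (τ : Family) (n : ℕ) : Set (Matrix (Fin n) (Fin n) ℂ) :=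
  {x | x ∈ lieAlg τ n ∧ LinearIndependent ℂ (gzDifferential τ x)}

/-- `𝒪ₓ^{sreg}`, the intersection of the adjoint orbit with the strongly regular elements. -/
def sregOrbit (τ : Family) (x : Matrix (Fin n) (Fin n) ℂ) : Set (Matrix (Fin n) (Fin n) ℂ) :=
  adjointOrbit τ x ∩ sreg τ n

/-! ### The Hamiltonian vector fields and the action of the group `A` -/

/-- `v ∈ 𝔤ₙ` is the gradient of `f` at `x` with respect to the trace form. -/
def IsGradient (τ : Family) (f : Matrix (Fin n) (Fin n) ℂ → ℂ)
    (x v : Matrix (Fin n) (Fin n) ℂ) : Prop :=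
  v ∈ lieAlg τ n ∧ ∀ z ∈ lieAlg τ n, trace (v * z) = lineDeriv ℂ f x z

open Classical in
/-- The gradient `∇f(x) ∈ 𝔤ₙ`. -/
noncomputable def gradient (τ : Family) (f : Matrix (Fin n) (Fin n) ℂ → ℂ)
    (x : Matrix (Fin n) (Fin n) ℂ) : Matrix (Fin n) (Fin n) ℂ :=
  if h : ∃ v, IsGradient τ f x v then h.choose else 0

/-- The trace form is nondegenerate on `𝔤ₙ`. -/
theorem eq_zero_of_trace (τ : Family) (v : Matrix (Fin n) (Fin n) ℂ) (hv : v ∈ lieAlg τ n)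
    (h : ∀ z ∈ lieAlg τ n, trace (v * z) = 0) : v = 0 := by
  cases τ with
  | gl => exact Matrix.ext_iff_trace_mul_right.2 fun z => by simpa using h z trivial
  | so =>
    replace hv : vᵀ = -v := (LieAlgebra.Orthogonal.mem_so (Fin n) ℂ v).1 hv
    refine Matrix.ext_iff_trace_mul_right.2 fun z => ?_
    have h1 : trace (v * (z - zᵀ)) = 0 :=
      h _ ((LieAlgebra.Orthogonal.mem_so (Fin n) ℂ _).2 (by simp))
    have h2 : trace (v * zᵀ) = - trace (v * z) := by
      rw [← Matrix.trace_transpose, Matrix.transpose_mul, Matrix.transpose_transpose, hv,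
        Matrix.mul_neg, Matrix.trace_neg, Matrix.trace_mul_comm]
    rw [Matrix.mul_sub, Matrix.trace_sub, h2] at h1
    have h3 : trace (v * z) = 0 := by linear_combination h1 / 2
    simpa using h3

/-- A differentiable function has a gradient, and it is unique. -/
theorem isGradient_iff (τ : Family) (f : Matrix (Fin n) (Fin n) ℂ → ℂ)
    (x v : Matrix (Fin n) (Fin n) ℂ) (hf : DifferentiableAt ℂ f x) :
    IsGradient τ f x v ↔ v = gradient τ f x := by
  have hex : ∃ v, IsGradient τ f x v := by
    set L := fderiv ℂ f x with hL
    have hG : ∀ z, trace (Matrix.of (fun k l => L (Matrix.single l k 1)) * z) = L z := by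
      intro z
      conv_rhs => rw [Matrix.matrix_eq_sum_single z]
      simp only [map_sum, Matrix.trace, Matrix.diag, Matrix.mul_apply, Matrix.of_apply]
      rw [Finset.sum_comm]
      refine Finset.sum_congr rfl fun k _ => Finset.sum_congr rfl fun l _ => ?_
      have : Matrix.single k l (z k l) = z k l • Matrix.single k l (1 : ℂ) := by simp
      rw [this, map_smul, smul_eq_mul, mul_comm]
    have hd : ∀ z, lineDeriv ℂ f x z = L z := fun z => hf.lineDeriv_eq_fderiv
    set G := Matrix.of (fun k l => L (Matrix.single l k 1)) with hGdef
    cases τ with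
    | gl => exact ⟨G, trivial, fun z _ => by rw [hd, hG]⟩
    | so =>
      refine ⟨(1 / 2 : ℂ) • (G - Gᵀ), (LieAlgebra.Orthogonal.mem_so (Fin n) ℂ _).2 (by
        rw [← smul_neg]; simp), fun z hz => ?_⟩
      replace hz : zᵀ = -z := (LieAlgebra.Orthogonal.mem_so (Fin n) ℂ z).1 hz
      have h2 : trace (Gᵀ * z) = - trace (G * z) := by
        rw [← Matrix.trace_transpose, Matrix.transpose_mul, Matrix.transpose_transpose, hz,
          Matrix.neg_mul, Matrix.trace_neg, Matrix.trace_mul_comm]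
      rw [Matrix.smul_mul, Matrix.trace_smul, Matrix.sub_mul, Matrix.trace_sub, h2, hG, hd,
        smul_eq_mul]
      ring
  have hg : IsGradient τ f x (gradient τ f x) := by
    rw [gradient, dif_pos hex]; exact hex.choose_spec
  refine ⟨fun hv => sub_eq_zero.1 (eq_zero_of_trace τ _ (sub_mem hv.1 hg.1) fun z hz => ?_),
    fun h => h ▸ hg⟩
  rw [Matrix.sub_mul, Matrix.trace_sub, hv.2 z hz, hg.2 z hz, sub_self]

/-- The Hamiltonian vector field `ξ_f` of `f`. -/
noncomputable def hamiltonianField (τ : Family) (f : Matrix (Fin n) (Fin n) ℂ → ℂ)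
    (x : Matrix (Fin n) (Fin n) ℂ) : Matrix (Fin n) (Fin n) ℂ :=
  ⁅x, gradient τ f x⁆

/-- The flow `Ad(exp(-t ∇f_{i,j}(x))) · x` of the Hamiltonian vector field of `f_{i,j}`. -/
noncomputable def gzFlow (τ : Family) (s : Index τ n) (t : ℂ) (x : Matrix (Fin n) (Fin n) ℂ) :
    Matrix (Fin n) (Fin n) ℂ :=
  NormedSpace.exp (-t • gradient τ (gzFun τ s) x) * x *
    NormedSpace.exp (t • gradient τ (gzFun τ s) x)

/-- `d = ∑_{i < n} rank 𝔤ᵢ`. -/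
def gzDim (τ : Family) (n : ℕ) : ℕ := ∑ i : Fin (n - 1), rank τ ((i : ℕ) + 1)

/-- The pairs `(i, j)` with `i ≤ m`, in lexicographic order. -/
def indexList (τ : Family) (m : ℕ) : List (Index τ m) :=
  (List.finRange m).flatMap fun (i : Fin m) =>
    (List.finRange (rank τ ((i : ℕ) + 1))).map fun j => (⟨i, j⟩ : Index τ m)

/-- The action of `A = ℂ^d` on `𝔤ₙ`: the element `(t_{i,j})`, `1 ≤ i ≤ n - 1`, acts by the
composition of the (commuting) flows of the `ξ_{f_{i,j}}` at the times `t_{i,j}`. -/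
noncomputable def aAct (τ : Family) (t : Index τ (n - 1) → ℂ) (x : Matrix (Fin n) (Fin n) ℂ) :
    Matrix (Fin n) (Fin n) ℂ :=
  (indexList τ (n - 1)).foldr (fun s y => gzFlow τ s.incl (t s) y) x

/-- The orbit `A · x`. -/
noncomputable def aOrbit (τ : Family) (x : Matrix (Fin n) (Fin n) ℂ) :
    Set (Matrix (Fin n) (Fin n) ℂ) :=
  range fun t : Index τ (n - 1) → ℂ => aAct τ t x

/-- The distribution `V`: `V_x` is spanned by the Hamiltonian vector fields of the `f_{i,j}`,
`1 ≤ i ≤ n - 1`. -/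
noncomputable def gzDistribution (τ : Family) (x : Matrix (Fin n) (Fin n) ℂ) :
    Submodule ℂ (Matrix (Fin n) (Fin n) ℂ) :=
  Submodule.span ℂ (range fun s : Index τ (n - 1) => hamiltonianField τ (gzFun τ s.incl) x)

end GZ

/-! Write `r` for the rank of `𝔤ₙ`, so that `dim 𝔤ₙ = 2d + r`. The argument combines a regularity
criterion, invariance of the `f_{i,j}` under the flows, a dimension count, and one general principle
about orbits in level sets.

Regularity: if the differentials of the `r` basic invariants of `𝔤ₙ` are independent at `y`, then
the centralizer of `y` has dimension `r`. The bound `≤ r` is `finrank_centralizer_le`: a commuting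
matrix is determined by its value on a vector `v` with the annihilator of `y`, and in the skew case
that value is orthogonal to every `y^(2i) v`. To see that `v` generates a large enough subspace one
uses the parity of the minimal polynomial and, for `so(2l)`, the identity `x ∇Pf(x) = Pf(x)/2`. The
bound `≥ r` holds because `[y, 𝔤ₙ]` lies in the common kernel of these `r` differentials. Hence that
kernel is `[y, 𝔤ₙ]`, and the gradients span the centralizer (`orbitTangent_eq_annih`,
`span_topGrad`). All this is conjugation invariant, so it passes from a strongly regular point to
its whole adjoint orbit.

Invariance: `∇f_{i,j}(x)` is supported in the `i`-th corner and commutes with `x_i`. So its flow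
fixes the corners of size at most `i` and conjugates the larger ones. The flows therefore commute
and preserve every `f_{k,l}` (`gzFlow_comm`, `gzFun_gzFlow`).

Dimension count at a strongly regular `y`: a relation among the `ξ_{f_{i,j}}` with `i < n` would put
a combination of the lower gradients into the centralizer, the span of the top ones; so `dim V_y =
d`. By invariance `V_y` lies in the common kernel of all the differentials, which has dimension `(2d
+ r) - (d + r) = d`. Thus `V_y` is that kernel (`gzDistribution_eq_annih`), and since `ω(ξ_f, v) =
-df(v)` on tangent vectors, `V_y` is Lagrangian.

Orbits: if `f` is invariant under an action and its differential kills only orbit directions, the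
orbit fills the level set of `f` locally (`eventually_mem_orbit`); if `f` is also submersive, the
orbit is a submanifold (`isComplexSubmanifold_orbit`). This applies to the adjoint orbit with the
top invariants and to the `A`-orbits with all `f_{i,j}`. A path tangent to `V` keeps all `f_{i,j}`
constant, so by connectedness it stays in one `A`-orbit (`leaf_subset`).

Closedness of `ω`: since the adjoint orbits involved have constant dimension, tangent vectors are
commutators with holomorphically varying generators, and `dω = 0` reduces to the symmetry of second
derivatives and the Jacobi identity (`kks_cocycle`). -/

set_option linter.unusedSectionVars false

/-! ### Skew-symmetric matrices and their centralizers -/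

namespace GZ

section Skew

open Polynomial

variable {ι : Type*} [Fintype ι] [DecidableEq ι]

/-- There is a vector whose annihilator in `ℂ[X]` is that of the whole space. -/
theorem exists_cyclic_vector (A : Matrix ι ι ℂ) :
    ∃ v : ι → ℂ, ∀ p : ℂ[X], aeval A p *ᵥ v = 0 → aeval A p = 0 := by
  obtain ⟨x, hx⟩ := exists_ker_toSpanSingleton_eq_annihilator ℂ[X] (AEval' (toLin' A))
  obtain ⟨x, rfl⟩ := (AEval'.of _).surjective x
  refine ⟨x, fun p hp => ?_⟩
  have hae : ∀ u, aeval (toLin' A) p u = aeval A p *ᵥ u := by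
    intro u
    have h1 : aeval (toLin' A) p = toLin' (aeval A p) :=
      aeval_algHom_apply (toLinAlgEquiv' : Matrix ι ι ℂ ≃ₐ[ℂ] _).toAlgHom A p
    rw [h1, toLin'_apply]
  have h : p ∈ annihilator ℂ[X] (AEval' (toLin' A)) := by
    rw [← hx, LinearMap.mem_ker, LinearMap.toSpanSingleton_apply, ← AEval.of_aeval_smul]
    rw [End.smul_def, hae, hp, map_zero]
  rw [mem_annihilator] at h
  refine Matrix.toLin'.injective (LinearMap.ext fun u => ?_)
  have := h (AEval'.of _ u)
  rw [← AEval.of_aeval_smul, End.smul_def, hae] at this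
  simpa using this

/-- A relation is a polynomial of degree below that of the minimal polynomial which kills `v`, and
hence kills `A`. -/
theorem linearIndependent_cyclic {A : Matrix ι ι ℂ} {v : ι → ℂ}
    (hv : ∀ p : ℂ[X], aeval A p *ᵥ v = 0 → aeval A p = 0) :
    LinearIndependent ℂ fun i : Fin (minpoly ℂ A).natDegree => (A ^ (i : ℕ)) *ᵥ v := by
  rw [Fintype.linearIndependent_iff]
  intro c hc i
  set p : ℂ[X] := ∑ i : Fin (minpoly ℂ A).natDegree, monomial (i : ℕ) (c i) with hp
  have h1 : aeval A p = 0 := hv p (by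
    rw [hp, map_sum, Matrix.sum_mulVec, ← hc]
    refine Finset.sum_congr rfl fun j _ => ?_
    rw [aeval_monomial, ← Algebra.smul_def, Matrix.smul_mulVec])
  have h2 : p.degree < (minpoly ℂ A).degree := by
    rw [degree_eq_natDegree (minpoly.ne_zero (Matrix.isIntegral A))]
    refine (degree_sum_le _ _).trans_lt ((Finset.sup_lt_iff ?_).2 fun j _ => ?_)
    · exact WithBot.bot_lt_coe _
    · exact (degree_monomial_le _ _).trans_lt (by exact_mod_cast j.2)
  have h3 : p = 0 := by
    by_contra h
    exact absurd (minpoly.degree_le_of_ne_zero ℂ A h h1) (not_le.2 h2)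
  have h4 : p.coeff i = c i := by
    rw [hp, finsetSum_coeff, Finset.sum_eq_single i]
    · simp
    · intro j _ hj
      rw [coeff_monomial, if_neg (fun h => hj (Fin.ext h))]
    · simp
  rw [← h4, h3, coeff_zero]

theorem skew_dotProduct {A : Matrix ι ι ℂ} (hA : Aᵀ = -A) (u w : ι → ℂ) :
    (A *ᵥ u) ⬝ᵥ w = -(u ⬝ᵥ (A *ᵥ w)) := by
  rw [dotProduct_mulVec, ← mulVec_transpose, hA, neg_mulVec, neg_dotProduct, neg_neg]

theorem skew_pow_dotProduct {A : Matrix ι ι ℂ} (hA : Aᵀ = -A) (k : ℕ) (u w : ι → ℂ) :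
    ((A ^ k) *ᵥ u) ⬝ᵥ w = (-1) ^ k * (u ⬝ᵥ ((A ^ k) *ᵥ w)) := by
  induction k generalizing w with
  | zero => simp
  | succ k ih =>
    rw [pow_succ', ← mulVec_mulVec, skew_dotProduct hA, ih, mulVec_mulVec, ← pow_succ, pow_succ' A]
    ring

theorem skew_dotProduct_self {A : Matrix ι ι ℂ} (hA : Aᵀ = -A) (u : ι → ℂ) :
    u ⬝ᵥ (A *ᵥ u) = 0 := by
  have h := skew_dotProduct hA u u
  rw [dotProduct_comm] at h
  exact self_eq_neg.1 h

/-- A skew-symmetric matrix of rank at most one vanishes. -/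
theorem skew_eq_zero_of_rank_le_one {A : Matrix ι ι ℂ} (hA : Aᵀ = -A) (a : ι → ℂ)
    (h : ∀ u, ∃ c : ℂ, A *ᵥ u = c • a) : A = 0 := by
  choose c hc using h
  have h1 : ∀ i j, A i j = c (Pi.single j 1) * a i := fun i j => by
    have := congrFun (hc (Pi.single j 1)) i
    simpa using this
  have h2 : ∀ i j, A j i = -A i j := fun i j => by
    have := congrFun (congrFun hA i) j
    simpa using this
  ext i j
  have h3 : A i j * A i j = 0 := by
    have h4 : A i i = 0 := self_eq_neg.1 (h2 i i)
    -- The 2×2 minors of a matrix of rank at most one vanish; the diagonal is zero, so this minor is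
    -- the square of `A i j`.
    have h5 : A i j * A j i = A i i * A j j := by rw [h1, h1 j i, h1 i i, h1 j j]; ring
    rw [h2 i j, h4, zero_mul] at h5
    linear_combination -h5
  simpa using h3

/-- Rank-nullity for the matrix with rows `w i`. Its kernel is the orthogonal complement of the `w
i` for the bilinear dot product, and it is used in that role. -/
theorem finrank_ker_of_linearIndependent {m : ℕ} {w : Fin m → ι → ℂ}
    (hw : LinearIndependent ℂ w) :
    finrank ℂ (LinearMap.ker (Matrix.of w).mulVecLin) + m = Fintype.card ι := by
  have h := (Matrix.of w).mulVecLin.finrank_range_add_finrank_ker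
  have h2 : (Matrix.of w).rank = Fintype.card (Fin m) := LinearIndependent.rank_matrix hw
  rw [Matrix.rank, Fintype.card_fin] at h2
  rw [h2, finrank_fintype_fun_eq_card] at h
  omega

/-- If `A` is skew-symmetric and has a cyclic subspace of codimension at most one, the commutant of
`A` in the skew-symmetric matrices is small. -/
theorem finrank_skew_commutant_le {A : Matrix ι ι ℂ} (hA : Aᵀ = -A) {v : ι → ℂ} {k r : ℕ}
    (hli : LinearIndependent ℂ fun i : Fin k => (A ^ (i : ℕ)) *ᵥ v)
    (hk : Fintype.card ι ≤ k + 1) (hr : Fintype.card ι ≤ r + (k + 1) / 2)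
    (S : Submodule ℂ (Matrix ι ι ℂ)) (hS : ∀ z ∈ S, zᵀ = -z ∧ z * A = A * z) :
    finrank ℂ S ≤ r := by
  have hcomm : ∀ z ∈ S, ∀ i : ℕ, z * A ^ i = A ^ i * z := fun z hz i =>
    (Commute.pow_right (show Commute z A from (hS z hz).2) i).eq
  -- Evaluation at `v` is injective on `S`: if `z v = 0` then `z` kills every `A^i v`, so by
  -- skewness its image is orthogonal to them. That leaves at most a line, and a skew matrix of rank
  -- at most one is zero.
  let L : S →ₗ[ℂ] (ι → ℂ) := (Matrix.mulVecBilin ℂ ℂ).flip v ∘ₗ S.subtype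
  have hL : ∀ z : S, L z = z.1 *ᵥ v := fun z => rfl
  have hinj : Function.Injective L := by
    rw [← LinearMap.ker_eq_bot, LinearMap.ker_eq_bot']
    rintro ⟨z, hz⟩ hzv
    rw [hL] at hzv
    simp only at hzv
    have h1 := finrank_ker_of_linearIndependent hli
    have h2 : finrank ℂ (LinearMap.ker
        (Matrix.of fun i : Fin k => (A ^ (i : ℕ)) *ᵥ v).mulVecLin) ≤ 1 := by omega
    obtain ⟨a, ha⟩ := finrank_le_one_iff.1 h2
    refine Subtype.ext (skew_eq_zero_of_rank_le_one (hS z hz).1 a.1 fun u => ?_)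
    have h3 : z *ᵥ u ∈ LinearMap.ker
        (Matrix.of fun i : Fin k => (A ^ (i : ℕ)) *ᵥ v).mulVecLin := by
      rw [LinearMap.mem_ker]
      ext i
      change ((A ^ (i : ℕ)) *ᵥ v) ⬝ᵥ (z *ᵥ u) = 0
      have := skew_dotProduct (hS z hz).1 ((A ^ (i : ℕ)) *ᵥ v) u
      rw [mulVec_mulVec, hcomm z hz, ← mulVec_mulVec, hzv, mulVec_zero, zero_dotProduct] at this
      exact neg_eq_zero.1 this.symm
    obtain ⟨c, hc⟩ := ha ⟨_, h3⟩
    exact ⟨c, (congrArg Subtype.val hc).symm⟩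
  -- The number of even exponents below `k`. For these, `A^(2i) v ⬝ z v = ± A^i v ⬝ z (A^i v) = 0`,
  -- so the image of `L` has codimension at least `m`.
  set m := (k + 1) / 2 with hm
  have hli2 : LinearIndependent ℂ fun i : Fin m => (A ^ (2 * (i : ℕ))) *ᵥ v :=
    hli.comp (fun i : Fin m => (⟨2 * i, by omega⟩ : Fin k)) fun i j hij => by
      simp only [Fin.mk.injEq] at hij
      exact Fin.ext (by omega)
  have h1 := finrank_ker_of_linearIndependent hli2
  have h2 : LinearMap.range L ≤ LinearMap.ker
      (Matrix.of fun i : Fin m => (A ^ (2 * (i : ℕ))) *ᵥ v).mulVecLin := by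
    rintro _ ⟨⟨z, hz⟩, rfl⟩
    rw [LinearMap.mem_ker, hL]
    ext i
    change ((A ^ (2 * (i : ℕ))) *ᵥ v) ⬝ᵥ (z *ᵥ v) = 0
    have h3 : A ^ (2 * (i : ℕ)) = A ^ (i : ℕ) * A ^ (i : ℕ) := by rw [two_mul, pow_add]
    rw [h3, ← mulVec_mulVec, skew_pow_dotProduct hA, mulVec_mulVec, ← hcomm z hz,
      ← mulVec_mulVec, skew_dotProduct_self (hS z hz).1, mul_zero]
  have h3 := LinearMap.finrank_range_of_inj hinj
  have h4 := Submodule.finrank_mono h2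
  omega

theorem transpose_aeval (A : Matrix ι ι ℂ) (p : ℂ[X]) : (aeval A p)ᵀ = aeval Aᵀ p := by
  induction p using Polynomial.induction_on' with
  | add p q hp hq => rw [map_add, map_add, transpose_add, hp, hq]
  | monomial k c =>
    rw [aeval_monomial, aeval_monomial, ← Algebra.smul_def, ← Algebra.smul_def, transpose_smul,
      transpose_pow]

theorem coeff_comp_neg_X (p : ℂ[X]) (i : ℕ) : (p.comp (-X)).coeff i = (-1) ^ i * p.coeff i := by
  have h : (-X : ℂ[X]) = C (-1) * X := by simp
  rw [h, comp_C_mul_X_coeff, mul_comm]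

theorem skew_aeval_of_odd {A : Matrix ι ι ℂ} (hA : Aᵀ = -A) {p : ℂ[X]}
    (hp : ∀ i, Even i → p.coeff i = 0) : (aeval A p)ᵀ = -aeval A p := by
  have h : p.comp (-X) = -p := by
    ext i
    rw [coeff_comp_neg_X, coeff_neg]
    rcases Nat.even_or_odd i with hi | hi
    · rw [hp i hi]; simp
    · rw [hi.neg_one_pow]; simp
  rw [transpose_aeval, hA, ← map_neg, ← h, aeval_comp]
  simp

/-- `A` and `Aᵀ = -A` are killed by the same polynomials, so the minimal polynomial `m` satisfies
`m(-X) = ± m(X)`: the difference `q` has smaller degree and still kills `A`. -/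
theorem minpoly_coeff_of_skew {A : Matrix ι ι ℂ} (hA : Aᵀ = -A) {i : ℕ}
    (hi : Odd (i + (minpoly ℂ A).natDegree)) : (minpoly ℂ A).coeff i = 0 := by
  set m := minpoly ℂ A with hm
  have hm0 : m ≠ 0 := minpoly.ne_zero (Matrix.isIntegral A)
  set q := m - C ((-1 : ℂ) ^ m.natDegree) * m.comp (-X) with hq
  have hqc : ∀ j, q.coeff j = m.coeff j - (-1) ^ m.natDegree * ((-1) ^ j * m.coeff j) := by
    intro j
    rw [hq, coeff_sub, coeff_C_mul, coeff_comp_neg_X]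
  have h1 : aeval A q = 0 := by
    rw [hq, map_sub, minpoly.aeval, map_mul, aeval_comp]
    simp only [map_neg, aeval_X]
    rw [← hA, ← transpose_aeval, minpoly.aeval]
    simp
  have h2 : q.degree < m.degree := by
    rw [degree_eq_natDegree hm0, degree_lt_iff_coeff_zero]
    intro j hj
    rw [hqc]
    rcases hj.eq_or_lt with rfl | hj
    · rw [← mul_assoc, ← pow_add, ← two_mul, pow_mul]; simp
    · rw [coeff_eq_zero_of_natDegree_lt hj]; simp
  have h3 : q = 0 := by
    by_contra h
    exact absurd (minpoly.degree_le_of_ne_zero ℂ A h h1) (not_le.2 h2)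
  have h4 := hqc i
  rw [h3, coeff_zero, ← mul_assoc, ← pow_add, add_comm, hi.neg_one_pow] at h4
  linear_combination -h4 / 2

theorem aeval_eq_sum_odd {A : Matrix ι ι ℂ} {q : ℂ[X]} {p : ℕ}
    (hq : ∀ i, Even i → q.coeff i = 0) (hdeg : q.natDegree ≤ 2 * p) :
    aeval A q = ∑ j : Fin p, q.coeff (2 * j + 1) • A ^ (2 * (j : ℕ) + 1) := by
  have h1 : ∀ f : ℕ → Matrix ι ι ℂ, ∑ i ∈ Finset.range (2 * p + 1), f i =
      f (2 * p) + ∑ j ∈ Finset.range p, (f (2 * j) + f (2 * j + 1)) := by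
    intro f
    rw [Finset.sum_range_succ, add_comm]
    congr 1
    clear hdeg
    induction p with
    | zero => simp
    | succ p ih =>
      rw [mul_add, mul_one, Finset.sum_range_succ, Finset.sum_range_succ, ih,
        Finset.sum_range_succ, add_assoc]
  rw [aeval_eq_sum_range' (Nat.lt_succ_of_le hdeg), h1, hq _ (even_two_mul p), zero_smul, zero_add,
    ← Fin.sum_univ_eq_sum_range (fun j => q.coeff (2 * j) • A ^ (2 * j) +
      q.coeff (2 * j + 1) • A ^ (2 * j + 1))]
  refine Finset.sum_congr rfl fun j _ => ?_
  rw [hq _ (even_two_mul _), zero_smul, zero_add]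

theorem eq_zero_of_aeval_odd {A : Matrix ι ι ℂ} {q : ℂ[X]} {p : ℕ}
    (hli : LinearIndependent ℂ fun j : Fin p => A ^ (2 * (j : ℕ) + 1))
    (hq : ∀ i, Even i → q.coeff i = 0) (hdeg : q.natDegree ≤ 2 * p) (h : aeval A q = 0) :
    q = 0 := by
  rw [aeval_eq_sum_odd hq hdeg] at h
  have h2 := Fintype.linearIndependent_iff.1 hli _ h
  ext i
  rw [coeff_zero]
  rcases Nat.even_or_odd i with hi | ⟨j, rfl⟩
  · exact hq i hi
  · by_cases hj : j < p
    · exact h2 ⟨j, hj⟩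
    · exact coeff_eq_zero_of_natDegree_lt (by omega)

/-- Otherwise the minimal polynomial, or `X` times it when its degree is even, is an odd polynomial
of degree below `2p` that kills `A`, which is a relation among the odd powers. -/
theorem le_natDegree_minpoly {A : Matrix ι ι ℂ} (hA : Aᵀ = -A) {p : ℕ}
    (hli : LinearIndependent ℂ fun j : Fin p => A ^ (2 * (j : ℕ) + 1)) :
    2 * p ≤ (minpoly ℂ A).natDegree := by
  set m := minpoly ℂ A with hm
  have hm0 : m ≠ 0 := minpoly.ne_zero (Matrix.isIntegral A)
  by_contra hlt
  rcases Nat.even_or_odd m.natDegree with hk | hk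
  · have h : X * m = 0 := by
      refine eq_zero_of_aeval_odd hli (fun i hi => ?_) ?_ ?_
      · rcases i with _ | i
        · simp
        · rw [coeff_X_mul]
          exact minpoly_coeff_of_skew hA ((Nat.even_add_one.1 hi |> Nat.not_even_iff_odd.1).add_even hk)
      · rw [natDegree_X_mul hm0]; omega
      · rw [map_mul, minpoly.aeval, mul_zero]
    exact hm0 (by simpa using h)
  · refine hm0 (eq_zero_of_aeval_odd hli (fun i hi => ?_) (by omega) (minpoly.aeval ℂ A))
    exact minpoly_coeff_of_skew hA (hi.add_odd hk)

theorem natDegree_minpoly_le (A : Matrix ι ι ℂ) : (minpoly ℂ A).natDegree ≤ Fintype.card ι := by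
  rw [← Matrix.charpoly_natDegree_eq_dim A]
  exact natDegree_le_of_dvd (Matrix.minpoly_dvd_charpoly A) (Matrix.charpoly_monic A).ne_zero

/-- In odd dimension, a skew-symmetric matrix has no cyclic subspace of codimension one. -/
theorem natDegree_minpoly_ne_of_odd {A : Matrix ι ι ℂ} (hA : Aᵀ = -A)
    (hn : Odd (Fintype.card ι)) : (minpoly ℂ A).natDegree + 1 ≠ Fintype.card ι := by
  intro hk
  set m := minpoly ℂ A with hm
  have hm0 : m ≠ 0 := minpoly.ne_zero (Matrix.isIntegral A)
  have hkev : Even m.natDegree := by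
    rw [← hk] at hn
    exact Nat.not_odd_iff_even.1 (fun h => by simpa using (Nat.odd_add_one.1 hn h))
  have hdet : A.det = 0 := by
    have h := Matrix.det_transpose A
    rw [hA, Matrix.det_neg, hn.neg_one_pow] at h
    exact self_eq_neg.1 (by linear_combination -h)
  obtain ⟨u, hu0, hu⟩ := Matrix.exists_mulVec_eq_zero_iff.2 hdet
  have hc0 : m.coeff 0 = 0 := by
    have h1 : aeval A m *ᵥ u = 0 := by rw [minpoly.aeval, zero_mulVec]
    rw [← divX_mul_X_add m, map_add, map_mul, aeval_X, aeval_C, Matrix.add_mulVec,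
      ← mulVec_mulVec, hu, mulVec_zero, zero_add, Algebra.algebraMap_eq_smul_one,
      Matrix.smul_mulVec, one_mulVec] at h1
    exact (smul_eq_zero.1 h1).resolve_right hu0
  -- As `A` is singular, `X` divides `m`. The quotient `q` is an odd polynomial, so `s = q(A)` is
  -- skew; it is nonzero by minimality, and `A s = 0` gives `p(A) s = p(0) s`. The contradiction
  -- will be that `s` has rank at most one.
  have hfac : m = X * m.divX := by
    conv_lhs => rw [← divX_mul_X_add m, hc0, map_zero, add_zero, mul_comm]
  set q := m.divX with hq
  have hq0 : q ≠ 0 := fun h => hm0 (by rw [hfac, h, mul_zero])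
  set s := aeval A q with hs
  have hs0 : s ≠ 0 := fun h => by
    have h1 := natDegree_le_natDegree (minpoly.degree_le_of_ne_zero ℂ A hq0 h)
    rw [← hm, hfac, natDegree_X_mul hq0] at h1
    omega
  have hqodd : ∀ i, Even i → q.coeff i = 0 := fun i hi => by
    rw [hq, coeff_divX]
    exact minpoly_coeff_of_skew hA ((hi.add_one).add_even hkev)
  have hsskew : sᵀ = -s := skew_aeval_of_odd hA hqodd
  have hAs : A * s = 0 := by
    have h : aeval A m = 0 := minpoly.aeval ℂ A
    rwa [hfac, map_mul, aeval_X] at h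
  have hps : ∀ p : ℂ[X], aeval A p * s = p.coeff 0 • s := fun p => by
    conv_lhs => rw [← divX_mul_X_add p]
    rw [map_add, map_mul, aeval_X, aeval_C, add_mul, mul_assoc, hAs, mul_zero, zero_add,
      Algebra.algebraMap_eq_smul_one, smul_mul_assoc, one_mul]
  obtain ⟨v, hv⟩ := exists_cyclic_vector A
  have hli := linearIndependent_cyclic hv
  let W : Submodule ℂ (ι → ℂ) :=
    LinearMap.range ((Matrix.mulVecBilin ℂ ℂ).flip v ∘ₗ (aeval A : ℂ[X] →ₐ[ℂ] _).toLinearMap)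
  have hW : ∀ y, y ∈ W ↔ ∃ p : ℂ[X], aeval A p *ᵥ v = y := fun y => Iff.rfl
  have hsW : ∀ y ∈ W, ∃ c : ℂ, s *ᵥ y = c • (s *ᵥ v) := fun y hy => by
    obtain ⟨p, rfl⟩ := (hW y).1 hy
    refine ⟨p.coeff 0, ?_⟩
    rw [mulVec_mulVec, ← Matrix.smul_mulVec, ← hps, hs, ← map_mul, ← map_mul, mul_comm]
  have hWdim : Fintype.card ι ≤ finrank ℂ W + 1 := by
    rw [← hk]
    have h1 : finrank ℂ (Submodule.span ℂ
        (range fun i : Fin m.natDegree => (A ^ (i : ℕ)) *ᵥ v)) = m.natDegree := by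
      rw [finrank_span_eq_card hli, Fintype.card_fin]
    rw [← h1]
    refine Nat.succ_le_succ (Submodule.finrank_mono (Submodule.span_le.2 ?_))
    rintro _ ⟨i, rfl⟩
    exact (hW _).2 ⟨X ^ (i : ℕ), by simp⟩
  refine hs0 (skew_eq_zero_of_rank_le_one hsskew (s *ᵥ v) fun x => ?_)
  by_contra hx
  have hss : s * s = 0 := by rw [hps, hqodd 0 (by simp), zero_smul]
  -- If `s x = p(A) v`, then `X p` kills `v`, so `q ∣ p` and `s x` is a multiple of `s v`. Hence `s
  -- x` spans a complement of the hyperplane `W`; writing `x = y + c s x` with `y ∈ W` and using `s²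
  -- = 0` again makes `s x = s y` a multiple of `s v`.
  have hbW : s *ᵥ x ∉ W := fun hb => by
    obtain ⟨p, hp⟩ := (hW _).1 hb
    have h1 : aeval A (X * p) *ᵥ v = 0 := by
      rw [map_mul, aeval_X, ← mulVec_mulVec, hp, mulVec_mulVec, hAs, zero_mulVec]
    have h2 : m ∣ X * p := minpoly.dvd ℂ A (hv _ h1)
    rw [hfac] at h2
    obtain ⟨g, rfl⟩ := (mul_dvd_mul_iff_left X_ne_zero).1 h2
    refine hx ⟨g.coeff 0, ?_⟩
    rw [← hp, mul_comm, map_mul, ← hs, hps, Matrix.smul_mulVec]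
  have htop : W ⊔ Submodule.span ℂ {s *ᵥ x} = ⊤ := by
    refine Submodule.eq_top_of_finrank_eq (le_antisymm (Submodule.finrank_le _) ?_)
    have h1 : W < W ⊔ Submodule.span ℂ {s *ᵥ x} := by
      refine lt_of_le_of_ne le_sup_left fun h => hbW ?_
      rw [h]
      exact Submodule.mem_sup_right (Submodule.mem_span_singleton_self _)
    have h2 := Submodule.finrank_lt_finrank_of_lt h1
    rw [finrank_fintype_fun_eq_card]
    omega
  have hxt : x ∈ W ⊔ Submodule.span ℂ {s *ᵥ x} := htop ▸ Submodule.mem_top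
  obtain ⟨y, hy, z, hz, hyz⟩ := Submodule.mem_sup.1 hxt
  obtain ⟨c, rfl⟩ := Submodule.mem_span_singleton.1 hz
  obtain ⟨d, hd⟩ := hsW y hy
  refine hx ⟨d, ?_⟩
  rw [← hyz, Matrix.mulVec_add, hd, Matrix.mulVec_smul, mulVec_mulVec, hss, zero_mulVec, smul_zero,
    add_zero]

/-- The regularity criterion for `so(2l + 1)`. -/
theorem finrank_skew_commutant_le_of_odd {A : Matrix ι ι ℂ} (hA : Aᵀ = -A) {l : ℕ}
    (hn : Fintype.card ι = 2 * l + 1)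
    (hli : LinearIndependent ℂ fun j : Fin l => A ^ (2 * (j : ℕ) + 1))
    (S : Submodule ℂ (Matrix ι ι ℂ)) (hS : ∀ z ∈ S, zᵀ = -z ∧ z * A = A * z) :
    finrank ℂ S ≤ l := by
  obtain ⟨v, hv⟩ := exists_cyclic_vector A
  have h1 := le_natDegree_minpoly hA hli
  have h2 := natDegree_minpoly_ne_of_odd hA (by rw [hn]; exact odd_two_mul_add_one l)
  have h3 := natDegree_minpoly_le A
  -- The degree of the minimal polynomial is at least `2l`, at most `2l + 1`, and not `2l`; so `v`
  -- is cyclic.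
  exact finrank_skew_commutant_le hA (linearIndependent_cyclic hv) (by omega) (by omega) S hS

/-- Two skew-symmetric matrices with image in the same plane are proportional. -/
theorem exists_smul_eq_of_skew {A P s : Matrix ι ι ℂ} (hP : Pᵀ = -P) (hs : sᵀ = -s)
    (hAP : A * P = 0) (hAs : A * s = 0) (hP0 : P ≠ 0)
    (hker : finrank ℂ (LinearMap.ker A.mulVecLin) ≤ 2) : ∃ c : ℂ, s = c • P := by
  have hne : ∃ i j, P i j ≠ 0 := by
    by_contra! h
    exact hP0 (Matrix.ext h)
  obtain ⟨i, j, hij⟩ := hne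
  have hsk : ∀ {B : Matrix ι ι ℂ}, Bᵀ = -B → ∀ a b, B b a = -B a b := fun {B} hB a b =>
    congrFun (congrFun hB a) b
  have hdiag : ∀ {B : Matrix ι ι ℂ}, Bᵀ = -B → ∀ a, B a a = 0 := fun {B} hB a =>
    self_eq_neg.1 (hsk hB a a)
  -- The constant is chosen so that the difference `t` vanishes at `(i, j)`.
  refine ⟨s i j / P i j, sub_eq_zero.1 ?_⟩
  set t := s - (s i j / P i j) • P with ht
  have htsk : tᵀ = -t := by rw [ht, transpose_sub, transpose_smul, hs, hP]; module
  have hAt : A * t = 0 := by rw [ht, mul_sub, hAs, mul_smul_comm, hAP, smul_zero, sub_zero]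
  have htij : t i j = 0 := by simp [ht, hij]
  set a := P *ᵥ Pi.single i 1 with ha
  set b := P *ᵥ Pi.single j 1 with hb
  have ha' : ∀ k, a k = P k i := fun k => by simp [ha]
  have hb' : ∀ k, b k = P k j := fun k => by simp [hb]
  have hmem : ∀ {B : Matrix ι ι ℂ}, A * B = 0 → ∀ u, B *ᵥ u ∈ LinearMap.ker A.mulVecLin :=
    fun {B} hB u => by
      rw [LinearMap.mem_ker, mulVecLin_apply, mulVec_mulVec, hB, zero_mulVec]
  have hli : LinearIndependent ℂ ![a, b] := by
    rw [LinearIndependent.pair_iff]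
    intro c d hcd
    have h1 := congrFun hcd i
    have h2 := congrFun hcd j
    simp only [Pi.add_apply, Pi.smul_apply, smul_eq_mul, ha', hb', Pi.zero_apply, hdiag hP,
      mul_zero, zero_add, add_zero] at h1 h2
    rw [hsk hP i j] at h2
    exact ⟨by simpa [hij] using h2, by simpa [hij] using h1⟩
  have hspan : Submodule.span ℂ (range ![a, b]) = LinearMap.ker A.mulVecLin := by
    refine Submodule.eq_of_le_of_finrank_le (Submodule.span_le.2 ?_) ?_
    · rintro _ ⟨k, rfl⟩
      fin_cases k
      · exact hmem hAP _
      · exact hmem hAP _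
    · rw [finrank_span_eq_card hli, Fintype.card_fin]
      exact hker
  -- Columns `i` and `j` of `P` are a basis of the kernel, so a kernel vector is determined by its
  -- coordinates `i` and `j`. Applied to columns `i` and `j` of `t`, this kills them; by skewness
  -- rows `i` and `j` vanish too, and then so does every column.
  have hzero : ∀ u ∈ LinearMap.ker A.mulVecLin, u i = 0 → u j = 0 → u = 0 := by
    intro u hu hui huj
    rw [← hspan, Matrix.range_cons, Matrix.range_cons, Matrix.range_empty, union_empty,
      singleton_union, Submodule.mem_span_pair] at hu
    obtain ⟨c, d, rfl⟩ := hu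
    simp only [Pi.add_apply, Pi.smul_apply, smul_eq_mul, ha', hb', hdiag hP, mul_zero, zero_add,
      add_zero, hsk hP i j] at hui huj
    have h1 : c = 0 := by simpa [hij] using huj
    have h2 : d = 0 := by simpa [hij] using hui
    rw [h1, h2, zero_smul, zero_smul, add_zero]
  have hti : t *ᵥ Pi.single i 1 = 0 := hzero _ (hmem hAt _) (by simp [hdiag htsk])
    (by simp [hsk htsk i j, htij])
  have htj : t *ᵥ Pi.single j 1 = 0 := hzero _ (hmem hAt _) (by simp [htij])
    (by simp [hdiag htsk])
  ext k l
  have h3 : t *ᵥ Pi.single l 1 = 0 := by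
    refine hzero _ (hmem hAt _) ?_ ?_
    · have := congrFun hti l
      simp only [mulVec_single, MulOpposite.op_one, one_smul, Pi.zero_apply, col_apply] at this ⊢
      rw [hsk htsk l i, this, neg_zero]
    · have := congrFun htj l
      simp only [mulVec_single, MulOpposite.op_one, one_smul, Pi.zero_apply, col_apply] at this ⊢
      rw [hsk htsk l j, this, neg_zero]
  have := congrFun h3 k
  simpa using this

/-- The regularity criterion for `so(2l)`, `l = p + 1`. -/
theorem finrank_skew_commutant_le_of_even {A P : Matrix ι ι ℂ} (hA : Aᵀ = -A) (hP : Pᵀ = -P)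
    {c : ℂ} (hAP : A * P = c • 1) (hPA : P * A = c • 1) {p : ℕ}
    (hn : Fintype.card ι = 2 * p + 2)
    (hli : LinearIndependent ℂ fun j : Fin p => A ^ (2 * (j : ℕ) + 1))
    (hPs : P ∉ Submodule.span ℂ (range fun j : Fin p => A ^ (2 * (j : ℕ) + 1)))
    (hker : c = 0 → finrank ℂ (LinearMap.ker A.mulVecLin) ≤ 2)
    (S : Submodule ℂ (Matrix ι ι ℂ)) (hS : ∀ z ∈ S, zᵀ = -z ∧ z * A = A * z) :
    finrank ℂ S ≤ p + 1 := by
  obtain ⟨v, hv⟩ := exists_cyclic_vector A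
  have h1 := le_natDegree_minpoly hA hli
  -- The degree is at least `2p`, and degree `2p + 1` already suffices for the commutant bound. In
  -- degree `2p`, `m = X q + m(0)` with `q` odd, and `s = q(A)` will turn out to be proportional to
  -- `P`, placing `P` in the span of the odd powers.
  suffices h2 : (minpoly ℂ A).natDegree ≠ 2 * p from
    finrank_skew_commutant_le hA (linearIndependent_cyclic hv) (by omega) (by omega) S hS
  intro hk
  set m := minpoly ℂ A with hm
  have hm0 : m ≠ 0 := minpoly.ne_zero (Matrix.isIntegral A)
  have hP0 : P ≠ 0 := fun h => hPs (h ▸ Submodule.zero_mem _)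
  set q := m.divX with hq
  have hqodd : ∀ i, Even i → q.coeff i = 0 := fun i hi => by
    rw [hq, coeff_divX]
    exact minpoly_coeff_of_skew hA ((hi.add_one).add_even (by rw [← hm, hk]; exact even_two_mul p))
  set s := aeval A q with hs
  have hsskew : sᵀ = -s := skew_aeval_of_odd hA hqodd
  have hsspan : s ∈ Submodule.span ℂ (range fun j : Fin p => A ^ (2 * (j : ℕ) + 1)) := by
    rw [hs, aeval_eq_sum_odd hqodd (p := p) ((natDegree_divX_le).trans hk.le)]
    exact Submodule.sum_mem _ fun j _ => Submodule.smul_mem _ _ (Submodule.subset_span ⟨j, rfl⟩)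
  have hAs : A * s + m.coeff 0 • 1 = 0 := by
    have h : aeval A m = 0 := minpoly.aeval ℂ A
    rwa [← divX_mul_X_add m, map_add, mul_comm, map_mul, aeval_X, aeval_C,
      Algebra.algebraMap_eq_smul_one] at h
  have hs0 : m.coeff 0 = 0 → s ≠ 0 := fun hc h => by
    have hfac : m = X * q := by
      conv_lhs => rw [← divX_mul_X_add m, hc, map_zero, add_zero, mul_comm]
    have hq0 : q ≠ 0 := fun h => hm0 (by rw [hfac, h, mul_zero])
    have h1 := natDegree_le_natDegree (minpoly.degree_le_of_ne_zero ℂ A hq0 h)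
    rw [← hm, hfac, natDegree_X_mul hq0] at h1
    omega
  -- For `c = 0`, both `P` and `s` are skew with image in the kernel of `A`, which is at most a
  -- plane. For `c ≠ 0`, both are multiples of the inverse of `A`.
  by_cases hc : c = 0
  · rw [hc, zero_smul] at hAP
    have hm0' : m.coeff 0 = 0 := by
      have h2 : (A * s + m.coeff 0 • 1)ᵀ * P = 0 := by rw [hAs, transpose_zero, zero_mul]
      rw [transpose_add, transpose_mul, hA, hsskew, neg_mul_neg, transpose_smul, transpose_one,
        add_mul, mul_assoc, hAP, mul_zero, zero_add, smul_mul_assoc, one_mul] at h2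
      exact (smul_eq_zero.1 h2).resolve_right hP0
    rw [hm0', zero_smul, add_zero] at hAs
    obtain ⟨d, hd⟩ := exists_smul_eq_of_skew hP hsskew hAP hAs hP0 (hker hc)
    have hd0 : d ≠ 0 := fun h => hs0 hm0' (by rw [hd, h, zero_smul])
    refine hPs ?_
    have : P = d⁻¹ • s := by rw [hd, smul_smul, inv_mul_cancel₀ hd0, one_smul]
    rw [this]
    exact Submodule.smul_mem _ _ hsspan
  · have h2 : c • s + m.coeff 0 • P = 0 := by
      have : P * (A * s + m.coeff 0 • 1) = 0 := by rw [hAs, mul_zero]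
      rwa [mul_add, ← mul_assoc, hPA, smul_mul_assoc, one_mul, mul_smul_comm, mul_one] at this
    have h3 : m.coeff 0 ≠ 0 := fun h => by
      rw [h, zero_smul, add_zero] at h2
      exact hs0 h ((smul_eq_zero.1 h2).resolve_left hc)
    refine hPs ?_
    have : P = (-(m.coeff 0)⁻¹ * c) • s := by
      have h4 : P = (m.coeff 0)⁻¹ • (m.coeff 0 • P) := by
        rw [smul_smul, inv_mul_cancel₀ h3, one_smul]
      rw [h4, eq_neg_of_add_eq_zero_right h2]
      module
    rw [this]
    exact Submodule.smul_mem _ _ hsspan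

/-- The regularity criterion for `gl(n)`. -/
theorem finrank_commutant_le {A : Matrix ι ι ℂ} {r : ℕ} (hn : Fintype.card ι ≤ r)
    (hli : LinearIndependent ℂ fun j : Fin r => A ^ (j : ℕ))
    (S : Submodule ℂ (Matrix ι ι ℂ)) (hS : ∀ z ∈ S, z * A = A * z) : finrank ℂ S ≤ r := by
  obtain ⟨v, hv⟩ := exists_cyclic_vector A
  have h1 : r ≤ (minpoly ℂ A).natDegree := by
    by_contra! hlt
    have h := minpoly.aeval ℂ A
    rw [aeval_eq_sum_range' hlt, ← Fin.sum_univ_eq_sum_range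
      (fun j => (minpoly ℂ A).coeff j • A ^ j)] at h
    have h2 := Fintype.linearIndependent_iff.1 hli _ h ⟨_, hlt⟩
    exact (leadingCoeff_ne_zero.2 (minpoly.ne_zero (Matrix.isIntegral A))) h2
  have hli2 : LinearIndependent ℂ fun i : Fin r => (A ^ (i : ℕ)) *ᵥ v :=
    (linearIndependent_cyclic hv).comp (Fin.castLE h1) (Fin.castLE_injective h1)
  have hspan : Submodule.span ℂ (range fun i : Fin r => (A ^ (i : ℕ)) *ᵥ v) = ⊤ := by
    refine Submodule.eq_top_of_finrank_eq (le_antisymm (Submodule.finrank_le _) ?_)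
    rw [finrank_span_eq_card hli2, finrank_fintype_fun_eq_card, Fintype.card_fin]
    exact hn
  -- Here `v` generates the whole space, so a commuting matrix that kills `v` is zero.
  let L : S →ₗ[ℂ] (ι → ℂ) := (Matrix.mulVecBilin ℂ ℂ).flip v ∘ₗ S.subtype
  have hL : ∀ z : S, L z = z.1 *ᵥ v := fun z => rfl
  have hinj : Function.Injective L := by
    rw [← LinearMap.ker_eq_bot, LinearMap.ker_eq_bot']
    rintro ⟨z, hz⟩ hzv
    rw [hL] at hzv
    simp only at hzv
    refine Subtype.ext ?_
    have h3 : z.mulVecLin = 0 := by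
      refine LinearMap.ext_on_range hspan fun i => ?_
      rw [mulVecLin_apply, mulVec_mulVec,
        (Commute.pow_right (show Commute z A from hS z hz) i).eq, ← mulVec_mulVec, hzv, mulVec_zero]
      rfl
    exact Matrix.ext_of_mulVec_single fun i => (LinearMap.congr_fun h3 (Pi.single i 1)).trans
      (zero_mulVec _).symm
  have h4 := LinearMap.finrank_le_finrank_of_injective hinj
  rw [finrank_fintype_fun_eq_card] at h4
  omega

end Skew

/-! ### Level sets, local transitivity and closed two-forms -/

section Analysis

open Filter Topology

variable {E P W : Type*} [NormedAddCommGroup E] [NormedSpace ℂ E] [FiniteDimensional ℂ E]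
  [NormedAddCommGroup P] [NormedSpace ℂ P] [FiniteDimensional ℂ P]
  [NormedAddCommGroup W] [NormedSpace ℂ W] [FiniteDimensional ℂ W]

/-- If the directions of a (local) action preserving `Φ` exhaust the kernel of the differential of
`Φ` at `p`, then the action is transitive on the level set of `Φ` near `p`. -/
theorem eventually_mem_orbit_of_level_eq {act : P × E → E} {act' : P × E →L[ℂ] E} {Φ : E → W}
    {Φ' : E →L[ℂ] W} {p : E} (hact : HasStrictFDerivAt act act' (0, p))
    (hact0 : ∀ y, act (0, y) = y) (hinv : ∀ t y, Φ (act (t, y)) = Φ y)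
    (hΦ : HasFDerivAt Φ Φ' p) (hker : ∀ v, Φ' v = 0 → ∃ t, act' (t, 0) = v) :
    ∀ᶠ q in 𝓝 p, Φ q = Φ p → ∃ t, act (t, p) = q := by
  have := FiniteDimensional.complete ℂ E
  have := FiniteDimensional.complete ℂ P
  have hid : ∀ v, act' (0, v) = v := fun v => by
    have h1 : HasFDerivAt (fun y => act (0, y)) (act' ∘L ContinuousLinearMap.inr ℂ P E) p :=
      hact.hasFDerivAt.comp p (hasFDerivAt_prodMk_right 0 p)
    have h2 : HasFDerivAt (fun y => act (0, y)) (ContinuousLinearMap.id ℂ E) p := by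
      simp only [hact0]
      exact hasFDerivAt_id p
    exact congrArg (fun L : E →L[ℂ] E => L v) (h1.unique h2)
  -- On a complement `C` of the kernel, `(t, c) ↦ act (t, p + c)` has surjective derivative at the
  -- origin: `t` covers the kernel and `c` covers `C`. So every point near `p` is `act (t, p + c)`
  -- with `(t, c)` small.
  obtain ⟨C, hC⟩ := Submodule.exists_isCompl (LinearMap.ker Φ'.toLinearMap)
  have : CompleteSpace C := FiniteDimensional.complete ℂ C
  let J : P × C →L[ℂ] P × E := (ContinuousLinearMap.id ℂ P).prodMap C.subtypeL
  have hJ : HasStrictFDerivAt (fun x : P × C => ((0, p) : P × E) + J x) J 0 :=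
    J.hasStrictFDerivAt.const_add _
  have hΨ : HasStrictFDerivAt (fun x : P × C => act ((0, p) + J x)) (act' ∘L J) 0 := by
    refine HasStrictFDerivAt.comp (0 : P × C) (g := act) ?_ hJ
    rw [map_zero, add_zero]
    exact hact
  have hsurj : (act' ∘L J).range = ⊤ := by
    refine LinearMap.range_eq_top.2 fun v => ?_
    have hv : v ∈ LinearMap.ker Φ'.toLinearMap ⊔ C := by
      rw [hC.sup_eq_top]; exact Submodule.mem_top
    obtain ⟨a, ha, c, hc, rfl⟩ := Submodule.mem_sup.1 hv
    obtain ⟨t, rfl⟩ := hker a ha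
    refine ⟨(t, ⟨c, hc⟩), ?_⟩
    change act' (t, c) = _
    have h3 : ((t, c) : P × E) = (t, 0) + (0, c) := by simp
    rw [h3, map_add, hid]
  have hmap := hΨ.map_nhds_eq_of_surj hsurj
  -- `Φ'` is injective on `C`, so `Φ` separates `p` from the nearby points `p + c`. No surjectivity
  -- of `Φ'` is needed.
  have hloc : ∀ᶠ c : C in 𝓝 0, Φ (p + c) = Φ p → c = 0 := by
    have h1 : HasFDerivAt (fun c : C => Φ (p + C.subtypeL c)) (Φ' ∘L C.subtypeL) 0 := by
      refine HasFDerivAt.comp (0 : C) (g := Φ) ?_ (C.subtypeL.hasFDerivAt.const_add p)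
      rw [map_zero, add_zero]
      exact hΦ
    have h2 : LinearMap.ker (Φ' ∘L C.subtypeL).toLinearMap = ⊥ := by
      rw [LinearMap.ker_eq_bot']
      intro c hc
      exact Subtype.ext (Submodule.disjoint_def.1 hC.disjoint c.1 hc c.2)
    obtain ⟨K, -, hK⟩ := LinearMap.exists_antilipschitzWith _ h2
    have h3 := h1.eventually_ne (c := Φ p) ⟨K, hK⟩
    rw [eventually_nhdsWithin_iff] at h3
    filter_upwards [h3] with c hc heq
    by_contra hne
    exact hc hne heq
  have hev : ∀ᶠ x : P × C in 𝓝 0, Φ (p + x.2) = Φ p → x.2 = 0 :=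
    (continuous_snd.tendsto (0 : P × C)).eventually hloc
  have h0 : act ((0, p) + J 0) = p := by rw [map_zero, add_zero, hact0]
  rw [h0] at hmap
  rw [← hmap, eventually_map]
  filter_upwards [hev] with x hx heq
  have h1 : ((0, p) : P × E) + J x = (x.1, p + x.2) :=
    Prod.ext (zero_add _) rfl
  rw [h1, hinv] at heq
  rw [h1, hx heq]
  exact ⟨x.1, by simp⟩

/-- A set that is locally a level set of a holomorphic submersion is a complex submanifold. -/
theorem isComplexSubmanifold_of_level {S : Set E} {T : E → Submodule ℂ E} {k : ℕ} (Φ : E → W)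
    (hΦ : AnalyticOnNhd ℂ Φ univ) (hdim : ∀ p ∈ S, finrank ℂ (T p) = k)
    (hsurj : ∀ p ∈ S, Function.Surjective (fderiv ℂ Φ p))
    (hS : ∀ p ∈ S, ∀ᶠ q in 𝓝 p, q ∈ S ↔ Φ q = Φ p)
    (hT : ∀ p ∈ S, T p = LinearMap.ker (fderiv ℂ Φ p).toLinearMap) :
    IsComplexSubmanifold S T k := by
  have := FiniteDimensional.complete ℂ W
  intro p hp
  refine ⟨hdim p hp, ?_⟩
  -- Surjectivity is an open condition: composed with a fixed right inverse at `p`, the nearby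
  -- differentials are invertible.
  obtain ⟨R, hR⟩ := (fderiv ℂ Φ p).exists_rightInverse_of_surjective
    (LinearMap.range_eq_top.2 (hsurj p hp))
  have hcont : Continuous fun q => fderiv ℂ Φ q ∘L R := by
    have : Continuous (fderiv ℂ Φ) :=
      continuousOn_univ.1 hΦ.fderiv.continuousOn
    exact this.clm_comp continuous_const
  have hev : ∀ᶠ q in 𝓝 p, Function.Surjective (fderiv ℂ Φ q) := by
    have h1 : ∀ᶠ q in 𝓝 p, IsUnit (fderiv ℂ Φ q ∘L R) := by
      refine hcont.tendsto p (Units.isOpen.mem_nhds ?_)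
      change IsUnit (fderiv ℂ Φ p ∘L R)
      rw [hR]
      exact isUnit_one
    filter_upwards [h1] with q hq w
    obtain ⟨u, hu⟩ := hq
    refine ⟨R (u⁻¹.1 w), ?_⟩
    have h2 : (u.1 * u⁻¹.1) w = w := by rw [Units.mul_inv]; rfl
    rw [hu] at h2
    exact h2
  obtain ⟨U, hUsub, hU, hpU⟩ := mem_nhds_iff.1 (hev.and (hS p hp))
  let e : W ≃L[ℂ] (Fin (finrank ℂ W) → ℂ) := ContinuousLinearEquiv.ofFinrankEq (by simp)
  have hF : ∀ q, fderiv ℂ (fun q => e (Φ q - Φ p)) q = e.toContinuousLinearMap ∘L fderiv ℂ Φ q := by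
    intro q
    exact (e.toContinuousLinearMap.hasFDerivAt.comp q
      ((hΦ q (mem_univ q)).differentiableAt.hasFDerivAt.sub_const _)).fderiv
  refine ⟨U, finrank ℂ W, fun q => e (Φ q - Φ p), hU, hpU, ?_, ?_, ?_, ?_⟩
  · exact fun q _ => e.toContinuousLinearMap.analyticAt _ |>.comp
      ((hΦ q (mem_univ q)).sub analyticAt_const)
  · intro q hq
    rw [hF]
    exact e.surjective.comp (hUsub hq).1
  · ext q
    constructor
    · rintro ⟨h1, h2⟩
      exact ⟨h2, by simp [((hUsub h2).2.1 h1)]⟩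
    · rintro ⟨h1, h2⟩
      refine ⟨(hUsub h1).2.2 ?_, h1⟩
      exact sub_eq_zero.1 (e.map_eq_zero_iff.1 h2)
  · rintro q ⟨hq, -⟩
    rw [hT q hq, hF]
    ext v
    simp

/-- A relatively open subset of a complex submanifold is a complex submanifold. -/
theorem IsComplexSubmanifold.inter_open {S : Set E} {T : E → Submodule ℂ E} {k : ℕ}
    (h : IsComplexSubmanifold S T k) {O : Set E} (hO : IsOpen O) :
    IsComplexSubmanifold (S ∩ O) T k := by
  rintro p ⟨hp, hpO⟩
  obtain ⟨hdim, U, m, F, hU, hpU, hF, hsurj, hS, hT⟩ := h p hp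
  refine ⟨hdim, U ∩ O, m, F, hU.inter hO, ⟨hpU, hpO⟩, hF.mono inter_subset_left,
    fun q hq => hsurj q hq.1, ?_, fun q hq => hT q ⟨hq.1.1, hq.2.1⟩⟩
  ext q
  have h1 : q ∈ S ∩ U ↔ q ∈ {q ∈ U | F q = 0} := by rw [hS]
  simp only [mem_inter_iff, mem_ofPred_eq] at h1 ⊢
  tauto

/-- Derivatives of maps into a complex submanifold are tangent to it. -/
theorem IsComplexSubmanifold.hasFDerivAt_mem {D : Type*} [NormedAddCommGroup D] [NormedSpace ℂ D]
    {S : Set E} {T : E → Submodule ℂ E} {k : ℕ} (h : IsComplexSubmanifold S T k) {ψ : D → E}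
    {ψ' : D →L[ℂ] E} {w : D} (hψ : HasFDerivAt ψ ψ' w) (hS : ∀ᶠ z in 𝓝 w, ψ z ∈ S) (u : D) :
    ψ' u ∈ T (ψ w) := by
  have hw : ψ w ∈ S := hS.self_of_nhds
  obtain ⟨-, U, m, F, hU, hpU, hF, -, hSU, hT⟩ := h _ hw
  rw [hT _ ⟨hw, hpU⟩]
  have h1 : HasFDerivAt (fun z => F (ψ z)) (fderiv ℂ F (ψ w) ∘L ψ') w :=
    (hF _ hpU).differentiableAt.hasFDerivAt.comp w hψ
  have h2 : (fun z => F (ψ z)) =ᶠ[𝓝 w] fun _ => 0 := by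
    filter_upwards [hS, hψ.continuousAt.eventually (hU.mem_nhds hpU)] with z hz hzU
    have : ψ z ∈ S ∩ U := ⟨hz, hzU⟩
    rw [hSU] at this
    exact this.2
  have h3 := (h1.congr_of_eventuallyEq h2.symm).unique (hasFDerivAt_const (0 : Fin m → ℂ) w)
  exact congrArg (fun L : D →L[ℂ] (Fin m → ℂ) => L u) h3

/-- The elementary alternating form `dxᵢ ∧ dxⱼ`. -/
noncomputable def wedgeForm {m : ℕ} (i j : Fin m) : (Fin m → ℂ) [⋀^Fin 2]→L[ℂ] ℂ where
  toFun v := v 0 i * v 1 j - v 0 j * v 1 i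
  map_update_add' := by
    intro _ v k x y
    fin_cases k <;> simp [Function.update] <;> ring
  map_update_smul' := by
    intro _ v k c x
    fin_cases k <;> simp [Function.update] <;> ring
  cont := by fun_prop
  map_eq_zero_of_eq' := by
    intro v k l hkl hne
    fin_cases k <;> fin_cases l <;> simp_all <;> ring

theorem wedgeForm_apply {m : ℕ} (i j : Fin m) (v : Fin 2 → Fin m → ℂ) :
    wedgeForm i j v = v 0 i * v 1 j - v 0 j * v 1 i := rfl

/-- A family of alternating bilinear forms on `ℂ^m` that depends holomorphically on the point and
satisfies the cocycle identity is a closed holomorphic two-form. -/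
theorem exists_closed_form {m : ℕ} {O : Set (Fin m → ℂ)} (hO : IsOpen O)
    (β : (Fin m → ℂ) → (Fin m → ℂ) → (Fin m → ℂ) → ℂ)
    (hadd : ∀ w ∈ O, ∀ u u' v, β w (u + u') v = β w u v + β w u' v)
    (hsmul : ∀ w ∈ O, ∀ (c : ℂ) u v, β w (c • u) v = c * β w u v)
    (halt : ∀ w ∈ O, ∀ u v, β w u v = -β w v u)
    (hβ : ∀ w ∈ O, ∀ u v, AnalyticAt ℂ (fun w => β w u v) w)
    (hclosed : ∀ w ∈ O, ∀ x u v, fderiv ℂ (fun w => β w u v) w x +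
      fderiv ℂ (fun w => β w v x) w u + fderiv ℂ (fun w => β w x u) w v = 0) :
    ∃ η : (Fin m → ℂ) → ((Fin m → ℂ) [⋀^Fin 2]→L[ℂ] ℂ),
      AnalyticOnNhd ℂ η O ∧ (∀ w ∈ O, ∀ u v : Fin m → ℂ, η w ![u, v] = β w u v) ∧
      ∀ w ∈ O, extDeriv η w = 0 := by
  -- Each unordered pair of indices occurs twice in the double sum, hence the factor `1/2`.
  set η : (Fin m → ℂ) → ((Fin m → ℂ) [⋀^Fin 2]→L[ℂ] ℂ) := fun w =>
    ∑ i, ∑ j, (β w (Pi.single i 1) (Pi.single j 1) / 2) • wedgeForm i j with hη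
  have hsum : ∀ w ∈ O, ∀ u v, β w u v = ∑ i, u i * β w (Pi.single i 1) v := by
    intro w hw u v
    let L : (Fin m → ℂ) →ₗ[ℂ] ℂ :=
      { toFun := fun u => β w u v
        map_add' := fun a b => hadd w hw a b v
        map_smul' := fun c a => hsmul w hw c a v }
    have h1 : ∀ i : Fin m, (fun j => if i = j then (1 : ℂ) else 0) = Pi.single i 1 := fun i => by
      ext j
      simp [Pi.single_apply, eq_comm]
    have h2 := LinearMap.pi_apply_eq_sum_univ L u
    simp only [h1] at h2
    exact h2
  have hval : ∀ w ∈ O, ∀ u v, η w ![u, v] = β w u v := by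
    intro w hw u v
    have h1 : β w u v = ∑ i, ∑ j, u i * v j * β w (Pi.single i 1) (Pi.single j 1) := by
      rw [hsum w hw u v]
      refine Finset.sum_congr rfl fun i _ => ?_
      rw [halt w hw, hsum w hw v, ← Finset.sum_neg_distrib, Finset.mul_sum]
      refine Finset.sum_congr rfl fun j _ => ?_
      rw [halt w hw (Pi.single j 1)]
      ring
    have h2 : β w u v = -∑ i, ∑ j, u j * v i * β w (Pi.single i 1) (Pi.single j 1) := by
      rw [h1, Finset.sum_comm, ← Finset.sum_neg_distrib]
      refine Finset.sum_congr rfl fun i _ => ?_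
      rw [← Finset.sum_neg_distrib]
      refine Finset.sum_congr rfl fun j _ => ?_
      rw [halt w hw (Pi.single j 1)]
      ring
    have h3 : η w ![u, v] = (∑ i, ∑ j, u i * v j * β w (Pi.single i 1) (Pi.single j 1) -
        ∑ i, ∑ j, u j * v i * β w (Pi.single i 1) (Pi.single j 1)) / 2 := by
      rw [← Finset.sum_sub_distrib, Finset.sum_div]
      simp only [hη, ContinuousAlternatingMap.sum_apply, ContinuousAlternatingMap.smul_apply,
        wedgeForm_apply, ← Finset.sum_sub_distrib, Finset.sum_div]
      refine Finset.sum_congr rfl fun i _ => Finset.sum_congr rfl fun j _ => ?_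
      simp only [Matrix.cons_val_zero, Matrix.cons_val_one, smul_eq_mul]
      ring
    rw [h3, ← h1]
    linear_combination -h2 / 2
  have hana : AnalyticOnNhd ℂ η O := by
    intro w hw
    refine Finset.analyticAt_fun_sum _ fun i _ => Finset.analyticAt_fun_sum _ fun j _ => ?_
    exact ((hβ w hw _ _).div_const).smul analyticAt_const
  refine ⟨η, hana, hval, fun w hw => ?_⟩
  have hder : ∀ u v x, fderiv ℂ (fun w => η w ![u, v]) w x = fderiv ℂ (fun w => β w u v) w x := by
    intro u v x
    congr 1
    refine Filter.EventuallyEq.fderiv_eq ?_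
    filter_upwards [hO.mem_nhds hw] with z hz using hval z hz u v
  ext v
  rw [extDeriv_apply (hana w hw).differentiableAt, Fin.sum_univ_three]
  have e0 : (Fin.removeNth (0 : Fin 3) v) = ![v 1, v 2] := by
    ext k; fin_cases k <;> rfl
  have e1 : (Fin.removeNth (1 : Fin 3) v) = ![v 0, v 2] := by
    ext k; fin_cases k <;> rfl
  have e2 : (Fin.removeNth (2 : Fin 3) v) = ![v 0, v 1] := by
    ext k; fin_cases k <;> rfl
  rw [e0, e1, e2, hder, hder, hder]
  -- The middle term of the exterior derivative has a minus sign; alternation turns it into the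
  -- cyclic form of `hclosed`.
  have hneg : fderiv ℂ (fun w => β w (v 2) (v 0)) w (v 1) =
      -fderiv ℂ (fun w => β w (v 0) (v 2)) w (v 1) := by
    have : (fun w => β w (v 2) (v 0)) =ᶠ[𝓝 w] fun w => -β w (v 0) (v 2) := by
      filter_upwards [hO.mem_nhds hw] with z hz using halt z hz _ _
    rw [this.fderiv_eq, fderiv_fun_neg]
    rfl
  have := hclosed w hw (v 0) (v 1) (v 2)
  rw [hneg] at this
  simp only [Fin.val_zero, Fin.val_one, Fin.val_two, pow_zero, pow_one, one_smul, neg_smul]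
  norm_num
  change _ = (0 : ℂ)
  linear_combination this

end Analysis

/-! ### The Kostant-Kirillov-Souriau form is closed -/

section ClosedForm

open Filter Topology

variable {A : Type*} [NormedRing A] [NormedAlgebra ℂ A] [FiniteDimensional ℂ A]

/-- Near `p₀`, tangent vectors of orbits of the same dimension can be written as commutators in a
way that depends holomorphically on the base point. -/
theorem exists_analyticAt_lie_eq (g : Submodule ℂ A) (p₀ : A) :
    ∃ B : A → (A →L[ℂ] A), AnalyticAt ℂ B p₀ ∧ (∀ p v, B p v ∈ g) ∧
      ∀ᶠ p in 𝓝 p₀, finrank ℂ (g.map (LieAlgebra.ad ℂ A p : End ℂ A)) =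
          finrank ℂ (g.map (LieAlgebra.ad ℂ A p₀ : End ℂ A)) →
        ∀ v ∈ g.map (LieAlgebra.ad ℂ A p : End ℂ A), ⁅B p v, p⁆ = v := by
  let f : A → (A →ₗ[ℂ] A) := fun p => LieAlgebra.ad ℂ A p
  have hf : ∀ p c, f p c = ⁅p, c⁆ := fun p c => rfl
  -- On a complement of the centralizer of `p₀`, `ad p₀` is injective and has a left inverse `R`.
  -- The square matrix `N p = R ∘ ad p ∘ I` is the identity at `p₀`, hence invertible nearby, and
  -- solving with it gives the generator `-I (N p)⁻¹ R v`.
  obtain ⟨C₀, hC₀⟩ := Submodule.exists_isCompl (LinearMap.ker (f p₀ ∘ₗ g.subtype))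
  obtain ⟨r, I, hIg, hI, hr⟩ : ∃ (r : ℕ) (I : (Fin r → ℂ) →ₗ[ℂ] A), (∀ c, I c ∈ g) ∧
      LinearMap.ker (f p₀ ∘ₗ I) = ⊥ ∧ r = finrank ℂ (g.map (f p₀)) := by
    refine ⟨finrank ℂ C₀, g.subtype ∘ₗ C₀.subtype ∘ₗ (finBasis ℂ C₀).equivFun.symm.toLinearMap,
      fun c => SetLike.coe_mem _, ?_, ?_⟩
    · rw [LinearMap.ker_eq_bot']
      intro c hc
      have h1 := Submodule.disjoint_def.1 hC₀.disjoint _ hc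
        (SetLike.coe_mem ((finBasis ℂ C₀).equivFun.symm c))
      exact (finBasis ℂ C₀).equivFun.symm.map_eq_zero_iff.1 (Subtype.ext h1)
    · have h1 := (f p₀ ∘ₗ g.subtype).finrank_range_add_finrank_ker
      have h2 := Submodule.finrank_add_eq_of_isCompl hC₀
      rw [LinearMap.range_comp, Submodule.range_subtype] at h1
      omega
  obtain ⟨R, hR⟩ := (f p₀ ∘ₗ I).exists_leftInverse_of_injective hI
  let N : A →ₗ[ℂ] ((Fin r → ℂ) →L[ℂ] (Fin r → ℂ)) :=
    { toFun := fun p => LinearMap.toContinuousLinearMap (R ∘ₗ f p ∘ₗ I)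
      map_add' := fun p q => by
        ext1 c
        change R (f (p + q) (I c)) = R (f p (I c)) + R (f q (I c))
        rw [← map_add, hf, hf, hf, add_lie]
      map_smul' := fun a p => by
        ext1 c
        change R (f (a • p) (I c)) = a • R (f p (I c))
        rw [← map_smul, hf, hf, smul_lie] }
  have hN : ∀ p c, N p c = R (f p (I c)) := fun p c => rfl
  have hN0 : N p₀ = 1 := by
    ext1 c
    exact LinearMap.congr_fun hR c
  have hNan : AnalyticAt ℂ N p₀ := (LinearMap.toContinuousLinearMap N).analyticAt p₀
  let Rc : A →L[ℂ] (Fin r → ℂ) := LinearMap.toContinuousLinearMap R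
  let J : (Fin r → ℂ) →L[ℂ] A := -LinearMap.toContinuousLinearMap I
  have hJ : ∀ c, J c = -I c := fun c => rfl
  refine ⟨fun p => J ∘L (Ring.inverse (N p) ∘L Rc), ?_, ?_, ?_⟩
  · have h1 : AnalyticAt ℂ (fun p => Ring.inverse (N p)) p₀ := by
      refine AnalyticAt.comp (g := Ring.inverse) ?_ hNan
      rw [hN0]
      exact analyticAt_inverse (𝕜 := ℂ) (1 : ((Fin r → ℂ) →L[ℂ] (Fin r → ℂ))ˣ)
    have h2 : AnalyticAt ℂ (fun p => Ring.inverse (N p) ∘L Rc) p₀ :=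
      (((ContinuousLinearMap.compL ℂ A (Fin r → ℂ) (Fin r → ℂ)).flip Rc).analyticAt _).comp h1
    exact ((ContinuousLinearMap.compL ℂ A (Fin r → ℂ) A J).analyticAt _).comp h2
  · exact fun p v => neg_mem (hIg _)
  · have hunit : ∀ᶠ p in 𝓝 p₀, IsUnit (N p) := by
      refine hNan.continuousAt (Units.isOpen.mem_nhds ?_)
      change IsUnit (N p₀)
      rw [hN0]
      exact isUnit_one
    filter_upwards [hunit] with p hp hdim v hv
    have hinv : ∀ c, Ring.inverse (N p) (N p c) = c := fun c => by
      have := Ring.inverse_mul_cancel _ hp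
      exact congrArg (fun L : (Fin r → ℂ) →L[ℂ] (Fin r → ℂ) => L c) this
    have hinjp : Function.Injective (f p ∘ₗ I) := fun c d hcd => by
      rw [← hinv c, ← hinv d, hN, hN]
      exact congrArg (fun z => Ring.inverse (N p) (R z)) hcd
    -- Constancy of the rank enters here: an injective image of dimension `r` inside `[p, g]` must
    -- be all of it.
    have hrangep : LinearMap.range (f p ∘ₗ I) = g.map (LieAlgebra.ad ℂ A p : End ℂ A) := by
      refine Submodule.eq_of_le_of_finrank_eq ?_ ?_
      · rintro _ ⟨c, rfl⟩
        exact ⟨I c, hIg c, rfl⟩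
      · rw [LinearMap.finrank_range_of_inj hinjp, hdim, finrank_fin_fun, hr]
    rw [← hrangep] at hv
    obtain ⟨c, rfl⟩ := hv
    have h3 : (J ∘L (Ring.inverse (N p) ∘L Rc)) ((f p ∘ₗ I) c) = -I c :=
      congrArg (fun z => -I z) (hinv c)
    rw [h3, neg_lie, lie_skew]
    rfl

theorem map_mul_lie {tr : A →ₗ[ℂ] ℂ} (htr : ∀ a b, tr (a * b) = tr (b * a)) (p a b : A) :
    tr (p * ⁅a, b⁆) = -tr (⁅a, p⁆ * b) := by
  simp only [Ring.lie_def, mul_sub, sub_mul, map_sub]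
  rw [← mul_assoc, ← mul_assoc, htr (p * b) a, ← mul_assoc]
  ring

theorem map_lie_mul_lie_cyclic {tr : A →ₗ[ℂ] ℂ} (htr : ∀ a b, tr (a * b) = tr (b * a)) (p X U V : A) :
    tr (⁅X, p⁆ * ⁅U, V⁆) + tr (⁅U, p⁆ * ⁅V, X⁆) + tr (⁅V, p⁆ * ⁅X, U⁆) = 0 := by
  have h : ∀ a b : A, tr (⁅a, p⁆ * b) = -tr (p * ⁅a, b⁆) :=
    fun a b => by rw [map_mul_lie htr, neg_neg]
  rw [h, h, h, ← neg_add, ← neg_add, ← map_add, ← map_add, ← mul_add, ← mul_add, lie_jacobi,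
    mul_zero, map_zero, neg_zero]

/-- The algebraic identity behind `dω = 0`: here `xu` is the derivative in the direction `x` of the
generator `U` of the vector field `u`, and so on. -/
theorem kks_cocycle {tr : A →ₗ[ℂ] ℂ} (htr : ∀ a b, tr (a * b) = tr (b * a)) {p X U V xu ux uv vu vx xv : A}
    (h1 : ⁅xu, p⁆ + ⁅U, ⁅X, p⁆⁆ = ⁅ux, p⁆ + ⁅X, ⁅U, p⁆⁆)
    (h2 : ⁅uv, p⁆ + ⁅V, ⁅U, p⁆⁆ = ⁅vu, p⁆ + ⁅U, ⁅V, p⁆⁆)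
    (h3 : ⁅vx, p⁆ + ⁅X, ⁅V, p⁆⁆ = ⁅xv, p⁆ + ⁅V, ⁅X, p⁆⁆) :
    tr (⁅X, p⁆ * ⁅U, V⁆ + p * (⁅xu, V⁆ + ⁅U, xv⁆)) +
    tr (⁅U, p⁆ * ⁅V, X⁆ + p * (⁅uv, X⁆ + ⁅V, ux⁆)) +
    tr (⁅V, p⁆ * ⁅X, U⁆ + p * (⁅vx, U⁆ + ⁅X, vu⁆)) = 0 := by
  -- The hypotheses compare the two orders of differentiation, so `ab - ba` and `⁅a, b⁆` have the
  -- same bracket with `p`. By invariance of the trace form, they are interchangeable inside `tr (p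
  -- * ⁅·, c⁆)`.
  have key : ∀ {a b c ab ba : A},
      ⁅ab, p⁆ + ⁅b, ⁅a, p⁆⁆ = ⁅ba, p⁆ + ⁅a, ⁅b, p⁆⁆ →
      tr (p * ⁅ab, c⁆) + tr (p * ⁅c, ba⁆) = tr (p * ⁅⁅a, b⁆, c⁆) := by
    intro a b c ab ba h
    have h4 : ⁅ab, p⁆ - ⁅ba, p⁆ = ⁅⁅a, b⁆, p⁆ := by
      rw [lie_lie, sub_eq_sub_iff_add_eq_add, h, add_comm]
    rw [← lie_skew c ba, mul_neg, map_neg, map_mul_lie htr, map_mul_lie htr, map_mul_lie htr, ← h4,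
      sub_mul, map_sub]
    ring
  have k1 := key (c := V) h1
  have k2 := key (c := X) h2
  have k3 := key (c := U) h3
  have hj : tr (p * ⁅⁅X, U⁆, V⁆) + tr (p * ⁅⁅U, V⁆, X⁆) + tr (p * ⁅⁅V, X⁆, U⁆) = 0 := by
    have := lie_jacobi V X U
    rw [← map_add, ← map_add, ← mul_add, ← mul_add, ← lie_skew ⁅X, U⁆ V, ← lie_skew ⁅U, V⁆ X,
      ← lie_skew ⁅V, X⁆ U, ← neg_add, ← neg_add, this, neg_zero, mul_zero, map_zero]
  have hc := map_lie_mul_lie_cyclic htr p X U V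
  simp only [map_add, mul_add]
  linear_combination k1 + k2 + k3 + hj + hc

/-- If the partial derivatives of `ψ` are commutators `[X_u, ψ]` with holomorphic `X_u`, then
`tr(ψ [X_u, X_v])` is a closed holomorphic two-form. -/
theorem exists_closed_form_of_generators {m : ℕ} {O : Set (Fin m → ℂ)} (hO : IsOpen O)
    {ψ : (Fin m → ℂ) → A} (hψ : AnalyticOnNhd ℂ ψ O) {tr : A →L[ℂ] ℂ}
    (htr : ∀ a b, tr (a * b) = tr (b * a)) (β : (Fin m → ℂ) → (Fin m → ℂ) → (Fin m → ℂ) → ℂ)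
    (hgen : ∀ w₀ ∈ O, ∃ X : (Fin m → ℂ) → ((Fin m → ℂ) →L[ℂ] A), AnalyticAt ℂ X w₀ ∧
      ∀ᶠ w in 𝓝 w₀, (∀ u, ⁅X w u, ψ w⁆ = fderiv ℂ ψ w u) ∧
        ∀ u v, β w u v = tr (ψ w * ⁅X w u, X w v⁆)) :
    ∃ η : (Fin m → ℂ) → ((Fin m → ℂ) [⋀^Fin 2]→L[ℂ] ℂ),
      AnalyticOnNhd ℂ η O ∧ (∀ w ∈ O, ∀ u v : Fin m → ℂ, η w ![u, v] = β w u v) ∧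
      ∀ w ∈ O, extDeriv η w = 0 := by
  refine exists_closed_form hO β ?_ ?_ ?_ ?_ ?_
  · intro w hw u u' v
    obtain ⟨X, -, hev⟩ := hgen w hw
    simp only [hev.self_of_nhds.2, map_add, add_lie, mul_add]
  · intro w hw c u v
    obtain ⟨X, -, hev⟩ := hgen w hw
    simp only [hev.self_of_nhds.2, map_smul, smul_lie, mul_smul_comm, smul_eq_mul]
  · intro w hw u v
    obtain ⟨X, -, hev⟩ := hgen w hw
    rw [hev.self_of_nhds.2, hev.self_of_nhds.2, ← lie_skew, mul_neg, map_neg]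
  all_goals
    intro w hw
    obtain ⟨X, hXan, hev⟩ := hgen w hw
    have hβ : ∀ u v, (fun w => β w u v) =ᶠ[𝓝 w]
        fun w => tr (ψ w * (X w u * X w v - X w v * X w u)) := fun u v => by
      filter_upwards [hev] with z hz
      rw [hz.2, Ring.lie_def]
    have hXu : ∀ u, AnalyticAt ℂ (fun w => X w u) w := fun u =>
      ((ContinuousLinearMap.apply ℂ A u).analyticAt _).comp hXan
  · intro u v
    refine AnalyticAt.congr ?_ (hβ u v).symm
    exact (tr.analyticAt _).comp
      ((hψ w hw).mul (((hXu u).mul (hXu v)).sub ((hXu v).mul (hXu u))))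
  · intro x u v
    have hXd : ∀ u, HasFDerivAt (fun w => X w u) (fderiv ℂ (fun w => X w u) w) w := fun u =>
      (hXu u).differentiableAt.hasFDerivAt
    have hψd := (hψ w hw).differentiableAt.hasFDerivAt
    have hder : ∀ x u v, fderiv ℂ (fun w => β w u v) w x =
        tr (⁅X w x, ψ w⁆ * ⁅X w u, X w v⁆ + ψ w *
          (⁅fderiv ℂ (fun w => X w u) w x, X w v⁆ + ⁅X w u, fderiv ℂ (fun w => X w v) w x⁆)) := by
      intro x u v
      have h1 := tr.hasFDerivAt.comp w
        (hψd.mul' (((hXd u).mul' (hXd v)).sub ((hXd v).mul' (hXd u))))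
      rw [(hβ u v).fderiv_eq]
      refine (congrArg (fun L : (Fin m → ℂ) →L[ℂ] ℂ => L x) h1.fderiv).trans ?_
      rw [hev.self_of_nhds.1 x, ContinuousLinearMap.comp_apply]
      congr 1
      simp only [Ring.lie_def, _root_.add_apply, _root_.smul_apply, _root_.sub_apply, smul_eq_mul,
        MulOpposite.smul_eq_mul_unop, MulOpposite.unop_op, Pi.sub_apply, Pi.mul_apply]
      noncomm_ring
    -- Differentiate `[X_u, ψ] = ∂_u ψ` in the direction `x`. The symmetry of the right-hand side
    -- gives the hypotheses of `kks_cocycle`.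
    have hsnd : ∀ x u, ⁅fderiv ℂ (fun w => X w u) w x, ψ w⁆ + ⁅X w u, ⁅X w x, ψ w⁆⁆ =
        fderiv ℂ (fderiv ℂ ψ) w x u := by
      intro x u
      have h1 := ((hXd u).mul' hψd).sub (hψd.mul' (hXd u))
      have h2 : ((fun w => X w u) * ψ - ψ * fun w => X w u) =ᶠ[𝓝 w] fun w => fderiv ℂ ψ w u := by
        filter_upwards [hev] with z hz
        rw [← hz.1, Ring.lie_def]
        rfl
      have h3 : HasFDerivAt (fun w => fderiv ℂ ψ w u)
          ((ContinuousLinearMap.apply ℂ A u) ∘L fderiv ℂ (fderiv ℂ ψ) w) w :=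
        (ContinuousLinearMap.apply ℂ A u).hasFDerivAt.comp w
          (hψ w hw).fderiv.differentiableAt.hasFDerivAt
      have h4 := h1.unique (h3.congr_of_eventuallyEq h2)
      have h5 := congrArg (fun L : (Fin m → ℂ) →L[ℂ] A => L x) h4
      refine Eq.trans ?_ h5
      rw [hev.self_of_nhds.1 x]
      simp only [Ring.lie_def, _root_.add_apply, _root_.smul_apply, _root_.sub_apply, smul_eq_mul,
        MulOpposite.smul_eq_mul_unop, MulOpposite.unop_op]
      noncomm_ring
    have hsymm : IsSymmSndFDerivAt ℂ ψ w :=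
      (hψ w hw).contDiffAt.isSymmSndFDerivAt_of_omega
    rw [hder, hder, hder]
    refine kks_cocycle (tr := tr.toLinearMap) htr ?_ ?_ ?_
    all_goals
      rw [hsnd, hsnd]
      exact hsymm.eq _ _

/-- Local holomorphic generators exist along a holomorphic map that is tangent to the orbits of a
fixed dimension. -/
theorem exists_analyticAt_generators (g : Submodule ℂ A) {m k : ℕ} {O : Set (Fin m → ℂ)}
    (hO : IsOpen O) {ψ : (Fin m → ℂ) → A} (hψ : AnalyticOnNhd ℂ ψ O)
    (hdim : ∀ w ∈ O, finrank ℂ (g.map (LieAlgebra.ad ℂ A (ψ w) : End ℂ A)) = k)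
    (htan : ∀ w ∈ O, ∀ u, fderiv ℂ ψ w u ∈ g.map (LieAlgebra.ad ℂ A (ψ w) : End ℂ A)) :
    ∀ w₀ ∈ O, ∃ X : (Fin m → ℂ) → ((Fin m → ℂ) →L[ℂ] A), AnalyticAt ℂ X w₀ ∧
      ∀ᶠ w in 𝓝 w₀, (∀ u, ⁅X w u, ψ w⁆ = fderiv ℂ ψ w u) ∧ ∀ u, X w u ∈ g := by
  intro w₀ hw₀
  obtain ⟨B, hB, hBmem, hBev⟩ := exists_analyticAt_lie_eq g (ψ w₀)
  refine ⟨fun w => (B (ψ w)) ∘L (fderiv ℂ ψ w), ?_, ?_⟩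
  · have h1 : AnalyticAt ℂ (fun w => B (ψ w)) w₀ := hB.comp (hψ w₀ hw₀)
    have h2 : AnalyticAt ℂ (fun w => fderiv ℂ ψ w) w₀ := (hψ w₀ hw₀).fderiv
    exact ((ContinuousLinearMap.compL ℂ (Fin m → ℂ) A A).analyticAt_bilinear
      (B (ψ w₀), fderiv ℂ ψ w₀)).comp (f := fun w => (B (ψ w), fderiv ℂ ψ w)) (h1.prod h2)
  · filter_upwards [(hψ w₀ hw₀).continuousAt.eventually hBev, hO.mem_nhds hw₀] with w hw hwO
    refine ⟨fun u => hw ?_ _ (htan w hwO u), fun u => hBmem _ _⟩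
    rw [hdim w hwO, hdim w₀ hw₀]

/-- The Kostant-Kirillov-Souriau form is a closed holomorphic two-form on every complex submanifold
whose tangent spaces are those of the adjoint orbits. -/
theorem isClosedHolomorphicTwoForm_kks {n : ℕ} (τ : Family) {S : Set (Matrix (Fin n) (Fin n) ℂ)}
    {k : ℕ} (hS : IsComplexSubmanifold S (orbitTangent τ) k) :
    IsClosedHolomorphicTwoForm S (kks τ) := by
  intro m O ψ hO hψ hmaps
  have hgen := exists_analyticAt_generators (lieAlg τ n).toSubmodule hO hψ
    (fun w hw => (hS _ (hmaps hw)).1) (fun w hw u =>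
      hS.hasFDerivAt_mem (hψ w hw).differentiableAt.hasFDerivAt
        (by filter_upwards [hO.mem_nhds hw] with z hz using hmaps hz) u)
  refine exists_closed_form_of_generators hO hψ
    (tr := LinearMap.toContinuousLinearMap (Matrix.traceLinearMap (Fin n) ℂ ℂ))
    (fun a b => Matrix.trace_mul_comm a b)
    (fun w u v => kks τ (ψ w) (fderiv ℂ ψ w u) (fderiv ℂ ψ w v)) fun w₀ hw₀ => ?_
  obtain ⟨X, hX, hev⟩ := hgen w₀ hw₀
  refine ⟨X, hX, ?_⟩
  filter_upwards [hev] with w hw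
  refine ⟨hw.1, fun u v => ?_⟩
  exact (congrArg₂ (kks τ (ψ w)) (hw.1 u).symm (hw.1 v).symm).trans
    (kks_apply τ _ _ _ (hw.2 u) (hw.2 v))

end ClosedForm

/-! ### Polynomial functions of a matrix and their gradients -/

section PolyFun

variable {n : ℕ}

/-- `f` is a polynomial function of the entries. -/
def IsPolyFun (f : Matrix (Fin n) (Fin n) ℂ → ℂ) : Prop :=
  ∃ p : MvPolynomial (Fin n × Fin n) ℂ, ∀ y, f y = MvPolynomial.eval (fun k => y k.1 k.2) p

theorem IsPolyFun.const (a : ℂ) : IsPolyFun fun _ : Matrix (Fin n) (Fin n) ℂ => a :=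
  ⟨MvPolynomial.C a, fun y => by simp⟩

theorem IsPolyFun.entry (i j : Fin n) : IsPolyFun fun y : Matrix (Fin n) (Fin n) ℂ => y i j :=
  ⟨MvPolynomial.X (i, j), fun y => by simp⟩

variable {f g : Matrix (Fin n) (Fin n) ℂ → ℂ}

theorem IsPolyFun.add (hf : IsPolyFun f) (hg : IsPolyFun g) : IsPolyFun fun y => f y + g y := by
  obtain ⟨p, hp⟩ := hf
  obtain ⟨q, hq⟩ := hg
  exact ⟨p + q, fun y => by rw [map_add, ← hp, ← hq]⟩

theorem IsPolyFun.mul (hf : IsPolyFun f) (hg : IsPolyFun g) : IsPolyFun fun y => f y * g y := by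
  obtain ⟨p, hp⟩ := hf
  obtain ⟨q, hq⟩ := hg
  exact ⟨p * q, fun y => by rw [map_mul, ← hp, ← hq]⟩

theorem IsPolyFun.sum {ι : Type*} (s : Finset ι) {F : ι → Matrix (Fin n) (Fin n) ℂ → ℂ}
    (hF : ∀ i, IsPolyFun (F i)) : IsPolyFun fun y => ∑ i ∈ s, F i y := by
  choose p hp using hF
  exact ⟨∑ i ∈ s, p i, fun y => by rw [map_sum]; exact Finset.sum_congr rfl fun i _ => hp i y⟩

theorem IsPolyFun.prod {ι : Type*} (s : Finset ι) {F : ι → Matrix (Fin n) (Fin n) ℂ → ℂ}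
    (hF : ∀ i, IsPolyFun (F i)) : IsPolyFun fun y => ∏ i ∈ s, F i y := by
  choose p hp using hF
  exact ⟨∏ i ∈ s, p i, fun y => by rw [map_prod]; exact Finset.prod_congr rfl fun i _ => hp i y⟩

theorem IsPolyFun.det {ι : Type*} [Fintype ι] [DecidableEq ι]
    {F : ι → ι → Matrix (Fin n) (Fin n) ℂ → ℂ} (hF : ∀ i j, IsPolyFun (F i j)) :
    IsPolyFun fun y => (Matrix.of fun i j => F i j y).det := by
  simp only [det_apply']
  exact .sum _ fun σ => .mul (.const _) (.prod _ fun i => hF _ _)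

theorem IsPolyFun.pow_entry {m : ℕ} {F : Matrix (Fin n) (Fin n) ℂ → Matrix (Fin m) (Fin m) ℂ}
    (hF : ∀ i j, IsPolyFun fun y => F y i j) (k : ℕ) (i j : Fin m) :
    IsPolyFun fun y => (F y ^ k) i j := by
  induction k generalizing i j with
  | zero => simpa only [pow_zero] using .const _
  | succ k ih =>
    simp only [pow_succ, Matrix.mul_apply]
    exact .sum _ fun l => .mul (ih i l) (hF l j)

theorem isPolyFun_gzFun (τ : Family) (s : Index τ n) : IsPolyFun (gzFun τ s) := by
  have hcut : ∀ i j, IsPolyFun fun y : Matrix (Fin n) (Fin n) ℂ => cutoff y s.1 i j :=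
    fun i j => .entry _ _
  have htr : ∀ k : ℕ, IsPolyFun fun y => trace (cutoff y s.1 ^ k) := fun k => by
    simp only [trace, diag_apply]
    exact .sum _ fun i => .pow_entry hcut k i i
  obtain ⟨i, j⟩ := s
  cases τ with
  | gl => exact htr _
  | so =>
    unfold gzFun invariant
    by_cases h : Even ((i : ℕ) + 1) ∧ (j : ℕ) + 1 = ((i : ℕ) + 1) / 2
    · simp only [h, and_self, if_true]
      exact .mul (.const _) (.sum _ fun σ => .mul (.const _) (.prod _ fun k => hcut _ _))
    · simp only [h, if_false]
      exact htr _

/-- The chain rule for polynomial functions. -/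
theorem IsPolyFun.exists_pderiv (hf : IsPolyFun f) :
    ∃ D : Fin n × Fin n → Matrix (Fin n) (Fin n) ℂ → ℂ, (∀ k, IsPolyFun (D k)) ∧
      ∀ (c : ℂ → Matrix (Fin n) (Fin n) ℂ) (c' x : Matrix (Fin n) (Fin n) ℂ) (t : ℂ), c t = x →
        (∀ i j, HasDerivAt (fun s => c s i j) (c' i j) t) →
        HasDerivAt (fun s => f (c s)) (∑ k, D k x * c' k.1 k.2) t := by
  obtain ⟨p, hp⟩ := hf
  obtain rfl : f = fun y => MvPolynomial.eval (fun k => y k.1 k.2) p := funext hp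
  clear hp
  induction p using MvPolynomial.induction_on with
  | C a =>
    refine ⟨fun _ _ => 0, fun _ => .const 0, fun c c' x t _ _ => ?_⟩
    simpa using hasDerivAt_const t a
  | add p q hp hq =>
    obtain ⟨D, hD, hD'⟩ := hp
    obtain ⟨E, hE, hE'⟩ := hq
    refine ⟨fun k y => D k y + E k y, fun k => .add (hD k) (hE k), fun c c' x t hx hc => ?_⟩
    simp only [map_add, add_mul, Finset.sum_add_distrib]
    exact (hD' c c' x t hx hc).add (hE' c c' x t hx hc)
  | mul_X p l hp =>
    obtain ⟨D, hD, hD'⟩ := hp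
    refine ⟨fun k y => D k y * y l.1 l.2 +
        MvPolynomial.eval (fun k => y k.1 k.2) p * if k = l then 1 else 0,
      fun k => .add (.mul (hD k) (.entry _ _)) (.mul ⟨p, fun _ => rfl⟩ (.const _)),
      fun c c' x t hx hc => ?_⟩
    have h := (hD' c c' x t hx hc).mul (hc l.1 l.2)
    simp only [map_mul, MvPolynomial.eval_X]
    refine h.congr_deriv ?_
    simp only [hx, add_mul, Finset.sum_add_distrib, Finset.sum_mul]
    congr 1
    · exact Finset.sum_congr rfl fun k _ => by ring
    · rw [Finset.sum_eq_single l]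
      · simp
      · intro k _ hk; simp [hk]
      · simp

theorem IsPolyFun.hasDerivAt_comp (hf : IsPolyFun f) {c : ℂ → Matrix (Fin n) (Fin n) ℂ}
    {c' x : Matrix (Fin n) (Fin n) ℂ} {t : ℂ} (hx : c t = x)
    (hc : ∀ i j, HasDerivAt (fun s => c s i j) (c' i j) t) :
    HasDerivAt (fun s => f (c s)) (lineDeriv ℂ f x c') t := by
  obtain ⟨D, -, hD⟩ := hf.exists_pderiv
  have h : lineDeriv ℂ f x c' = ∑ k, D k x * c' k.1 k.2 := by
    refine (hD (fun s => x + s • c') c' x 0 (by simp) fun i j => ?_).deriv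
    simpa using ((hasDerivAt_id (0 : ℂ)).mul_const (c' i j)).const_add (x i j)
  rw [h]
  exact hD c c' x t hx hc

theorem IsPolyFun.lineDeriv (hf : IsPolyFun f) (z : Matrix (Fin n) (Fin n) ℂ) :
    IsPolyFun fun y => _root_.lineDeriv ℂ f y z := by
  obtain ⟨D, hD, hD'⟩ := hf.exists_pderiv
  have h : (fun y => _root_.lineDeriv ℂ f y z) = fun y => ∑ k, D k y * z k.1 k.2 := by
    funext x
    refine (hD' (fun s => x + s • z) z x 0 (by simp) fun i j => ?_).deriv
    simpa using ((hasDerivAt_id (0 : ℂ)).mul_const (z i j)).const_add (x i j)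
  rw [h]
  exact .sum _ fun k => .mul (hD k) (.const _)

theorem IsPolyFun.analyticAt (hf : IsPolyFun f) (x : Matrix (Fin n) (Fin n) ℂ) :
    AnalyticAt ℂ f x := by
  obtain ⟨p, hp⟩ := hf
  obtain rfl : f = fun y => MvPolynomial.eval (fun k => y k.1 k.2) p := funext hp
  have h : ∀ k : Fin n × Fin n,
      AnalyticAt ℂ (fun y : Matrix (Fin n) (Fin n) ℂ => y k.1 k.2) x := fun k =>
    (LinearMap.toContinuousLinearMap (Matrix.entryLinearMap ℂ ℂ k.1 k.2)).analyticAt x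
  exact AnalyticAt.aeval_mvPolynomial h p

theorem IsPolyFun.differentiableAt (hf : IsPolyFun f) (x : Matrix (Fin n) (Fin n) ℂ) :
    DifferentiableAt ℂ f x := (hf.analyticAt x).differentiableAt

theorem analyticAt_of_entries {E : Type*} [NormedAddCommGroup E] [NormedSpace ℂ E]
    {F : E → Matrix (Fin n) (Fin n) ℂ} {x : E} (h : ∀ i j, AnalyticAt ℂ (fun y => F y i j) x) :
    AnalyticAt ℂ F x := by
  have : F = fun y => ∑ i, ∑ j, F y i j • Matrix.single i j (1 : ℂ) := by
    funext y
    conv_lhs => rw [Matrix.matrix_eq_sum_single (F y)]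
    simp
  rw [this]
  exact Finset.analyticAt_fun_sum _ fun i _ => Finset.analyticAt_fun_sum _ fun j _ =>
    (h i j).smul analyticAt_const

/-- The elementary elements of `𝔤ₙ`. -/
def elem (τ : Family) (i j : Fin n) : Matrix (Fin n) (Fin n) ℂ :=
  match τ with
  | .gl => single i j 1
  | .so => single i j 1 - single j i 1

/-- The normalization of `elem`. -/
noncomputable def elemCoeff (τ : Family) : ℂ :=
  match τ with
  | .gl => 1
  | .so => 1 / 2

theorem elem_mem (τ : Family) (i j : Fin n) : elem τ i j ∈ lieAlg τ n := by
  cases τ with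
  | gl => trivial
  | so => exact (LieAlgebra.Orthogonal.mem_so (Fin n) ℂ _).2 (by simp [elem])

theorem mem_so_iff {v : Matrix (Fin n) (Fin n) ℂ} : v ∈ lieAlg .so n ↔ vᵀ = -v :=
  LieAlgebra.Orthogonal.mem_so (Fin n) ℂ v

theorem elem_apply_eq_zero {τ : Family} {i j p q : Fin n} (h1 : ¬(p = i ∧ q = j))
    (h2 : ¬(p = j ∧ q = i)) : elem τ i j p q = 0 := by
  cases τ with
  | gl => simp only [elem, single_apply]; grind
  | so => simp only [elem, Matrix.sub_apply, single_apply]; grind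

/-- For `so`, the two terms of `elem` contribute the same entry of a skew matrix twice, which
`elemCoeff` compensates. This is how the entries of a gradient become line derivatives. -/
theorem trace_mul_elem {τ : Family} {v : Matrix (Fin n) (Fin n) ℂ} (hv : v ∈ lieAlg τ n)
    (i j : Fin n) : elemCoeff τ * trace (v * elem τ j i) = v i j := by
  have h : ∀ i j, trace (v * single j i 1) = v i j := fun i j => by
    simp [Matrix.trace_mul_single]
  cases τ with
  | gl => simp only [elem, elemCoeff, h, one_mul]
  | so =>
    have h2 : v j i = -v i j := congrFun (congrFun (mem_so_iff.1 hv) i) j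
    simp only [elem, elemCoeff, mul_sub, trace_sub, h, h2]
    ring

theorem IsPolyFun.isGradient (hf : IsPolyFun f) (τ : Family) (x : Matrix (Fin n) (Fin n) ℂ) :
    IsGradient τ f x (gradient τ f x) :=
  (isGradient_iff τ f x _ (hf.differentiableAt x)).2 rfl

theorem IsPolyFun.eq_gradient (hf : IsPolyFun f) {τ : Family} {x v : Matrix (Fin n) (Fin n) ℂ}
    (h : IsGradient τ f x v) : gradient τ f x = v :=
  ((isGradient_iff τ f x _ (hf.differentiableAt x)).1 h).symm

theorem IsPolyFun.gradient_apply (hf : IsPolyFun f) (τ : Family) (x : Matrix (Fin n) (Fin n) ℂ)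
    (i j : Fin n) :
    gradient τ f x i j = elemCoeff τ * _root_.lineDeriv ℂ f x (elem τ j i) := by
  rw [← (hf.isGradient τ x).2 _ (elem_mem τ j i), trace_mul_elem (hf.isGradient τ x).1]

theorem IsPolyFun.analyticAt_gradient (hf : IsPolyFun f) (τ : Family)
    (x : Matrix (Fin n) (Fin n) ℂ) : AnalyticAt ℂ (gradient τ f) x := by
  refine analyticAt_of_entries fun i j => ?_
  simp only [hf.gradient_apply]
  exact analyticAt_const.mul ((hf.lineDeriv _).analyticAt x)

end PolyFun

/-! ### The Pfaffian -/

section Pfaffian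

variable {m : ℕ}

/-- The index set of an even-dimensional space as a union of pairs. -/
def pairEquiv (hm : Even m) : Fin (m / 2) × Fin 2 ≃ Fin m :=
  finProdFinEquiv.trans (finCongr (Nat.div_mul_cancel hm.two_dvd))

theorem pairEquiv_zero (hm : Even m) (k : Fin (m / 2)) :
    pairEquiv hm (k, 0) = ⟨2 * k, by omega⟩ := by
  ext
  simp [pairEquiv, finProdFinEquiv]

theorem pairEquiv_one (hm : Even m) (k : Fin (m / 2)) :
    pairEquiv hm (k, 1) = ⟨2 * k + 1, by omega⟩ := by
  ext
  simp [pairEquiv, finProdFinEquiv, add_comm]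

theorem prod_pairs (hm : Even m) (h : Fin m → ℂ) :
    ∏ k : Fin (m / 2), (h ⟨2 * k, by omega⟩ * h ⟨2 * k + 1, by omega⟩) = ∏ r, h r := by
  rw [← (pairEquiv hm).prod_comp, Fintype.prod_prod_type]
  refine Finset.prod_congr rfl fun k _ => ?_
  rw [Fin.prod_univ_two, pairEquiv_zero, pairEquiv_one]

/-- `Pf(g y gᵀ) = det(g) Pf(y)`. -/
theorem pfaffian_conj (hm : Even m) (g y : Matrix (Fin m) (Fin m) ℂ) :
    pfaffian (g * y * gᵀ) = g.det * pfaffian y := by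
  -- Expanding a product over pairs chooses two summation indices per pair, that is, a map `ψ` from
  -- all of `Fin m` to itself.
  let e : (Fin m → Fin m) ≃ (Fin (m / 2) → Fin m × Fin m) :=
    (Equiv.arrowCongr (pairEquiv hm).symm (Equiv.refl _)).trans
      ((Equiv.curry _ _ _).trans (Equiv.arrowCongr (Equiv.refl _) (finTwoArrowEquiv (Fin m))))
  have he : ∀ ψ k, e ψ k = (ψ ⟨2 * k, by omega⟩, ψ ⟨2 * k + 1, by omega⟩) := fun ψ k => by
    rw [← pairEquiv_zero hm, ← pairEquiv_one hm]
    rfl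
  have h1 : ∀ σ : Equiv.Perm (Fin m),
      ∏ k : Fin (m / 2), (g * y * gᵀ) (σ ⟨2 * k, by omega⟩) (σ ⟨2 * k + 1, by omega⟩) =
      ∑ ψ : Fin m → Fin m, (∏ k : Fin (m / 2), y (ψ ⟨2 * k, by omega⟩) (ψ ⟨2 * k + 1, by omega⟩)) *
        ∏ r, g (σ r) (ψ r) := by
    intro σ
    have h2 : ∀ a b, (g * y * gᵀ) a b = ∑ q : Fin m × Fin m, g a q.1 * y q.1 q.2 * g b q.2 := by
      intro a b
      rw [Fintype.sum_prod_type, Finset.sum_comm, Matrix.mul_apply]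
      refine Finset.sum_congr rfl fun d _ => ?_
      rw [Matrix.mul_apply, Finset.sum_mul]
      rfl
    simp only [h2]
    rw [Finset.prod_univ_sum, Fintype.piFinset_univ, ← e.sum_comp]
    refine Finset.sum_congr rfl fun ψ _ => ?_
    rw [← prod_pairs hm, ← Finset.prod_mul_distrib]
    refine Finset.prod_congr rfl fun k _ => ?_
    rw [he]
    ring
  unfold pfaffian
  simp only [h1, Finset.mul_sum]
  rw [Finset.sum_comm]
  have h3 : ∀ ψ : Fin m → Fin m, ∑ σ : Equiv.Perm (Fin m), ((Equiv.Perm.sign σ : ℤ) : ℂ) *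
      ((∏ k : Fin (m / 2), y (ψ ⟨2 * k, by omega⟩) (ψ ⟨2 * k + 1, by omega⟩)) *
        ∏ r, g (σ r) (ψ r)) =
      (∏ k : Fin (m / 2), y (ψ ⟨2 * k, by omega⟩) (ψ ⟨2 * k + 1, by omega⟩)) *
        (g.submatrix id ψ).det := by
    intro ψ
    rw [det_apply', Finset.mul_sum]
    refine Finset.sum_congr rfl fun σ _ => ?_
    simp only [submatrix_apply, id]
    ring
  -- For a non-injective `ψ` the alternating sum over `σ` is a determinant with two equal columns.
  -- The bijective `ψ` contribute `det g` times their sign.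
  have h4 : ∀ F : (Fin m → Fin m) → ℂ, (∀ ψ, ¬Function.Bijective ψ → F ψ = 0) →
      ∑ ψ, F ψ = ∑ σ : Equiv.Perm (Fin m), F σ := by
    intro F hF
    symm
    refine Fintype.sum_of_injective (fun σ : Equiv.Perm (Fin m) => (σ : Fin m → Fin m))
      DFunLike.coe_injective _ _ (fun ψ hψ => hF ψ fun hb => hψ ⟨Equiv.ofBijective ψ hb, rfl⟩)
      fun _ => rfl
  simp only [← Finset.mul_sum, h3]
  rw [h4]
  · rw [mul_left_comm g.det]
    congr 1
    rw [Finset.mul_sum]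
    refine Finset.sum_congr rfl fun σ _ => ?_
    rw [det_permute']
    ring
  · intro ψ hψ
    have hψ' : ¬Function.Injective ψ := fun h => hψ (Finite.injective_iff_bijective.1 h)
    simp only [Function.Injective, not_forall] at hψ'
    obtain ⟨a, b, hab, hne⟩ := hψ'
    rw [det_zero_of_column_eq hne (fun k => by simp [hab]), mul_zero]

theorem isPolyFun_pfaffian : IsPolyFun (pfaffian (m := m)) :=
  .mul (.const _) (.sum _ fun _ => .mul (.const _) (.prod _ fun _ => .entry _ _))

theorem hasDerivAt_mul_entry {k : ℕ} {a b : ℂ → Matrix (Fin k) (Fin k) ℂ}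
    {a' b' : Matrix (Fin k) (Fin k) ℂ} {t : ℂ} (ha : ∀ i j, HasDerivAt (fun s => a s i j) (a' i j) t)
    (hb : ∀ i j, HasDerivAt (fun s => b s i j) (b' i j) t) (i j : Fin k) :
    HasDerivAt (fun s => (a s * b s) i j) ((a' * b t + a t * b') i j) t := by
  simp only [Matrix.mul_apply, Matrix.add_apply, ← Finset.sum_add_distrib]
  exact HasDerivAt.fun_sum fun l _ => (ha i l).mul (hb l j)

theorem hasDerivAt_one_add_smul_entry {k : ℕ} (b : Matrix (Fin k) (Fin k) ℂ) (i j : Fin k) :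
    HasDerivAt (fun s : ℂ => (1 + s • b : Matrix (Fin k) (Fin k) ℂ) i j) (b i j) 0 := by
  simpa using ((hasDerivAt_id (0 : ℂ)).mul_const (b i j)).const_add
    ((1 : Matrix (Fin k) (Fin k) ℂ) i j)

/-- `x ∇Pf(x) = Pf(x) / 2`. -/
theorem mul_gradient_pfaffian (hm : Even m) {x : Matrix (Fin m) (Fin m) ℂ} (hx : xᵀ = -x) :
    x * gradient .so pfaffian x = (pfaffian x / 2) • 1 := by
  set P := gradient .so pfaffian x with hP
  obtain ⟨hPmem, hPtr⟩ := isPolyFun_pfaffian.isGradient .so x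
  rw [← hP] at hPmem hPtr
  have hPt := mem_so_iff.1 hPmem
  -- Differentiate `Pf((1 + sb) x (1 + sb)ᵀ) = det(1 + sb) Pf(x)` at `s = 0`.
  have key : ∀ b : Matrix (Fin m) (Fin m) ℂ,
      trace (P * (b * x + x * bᵀ)) = trace b * pfaffian x := by
    intro b
    rw [hPtr _ (mem_so_iff.2 (by
      simp only [transpose_add, transpose_mul, transpose_transpose, hx]
      noncomm_ring))]
    have h1 : HasDerivAt (fun s : ℂ => pfaffian ((1 + s • b) * x * (1 + s • b)ᵀ))
        (lineDeriv ℂ pfaffian x (b * x + x * bᵀ)) 0 := by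
      refine isPolyFun_pfaffian.hasDerivAt_comp (by simp) fun i j => ?_
      have h2 := hasDerivAt_mul_entry (hasDerivAt_mul_entry (hasDerivAt_one_add_smul_entry b)
        (b := fun _ => x) (b' := 0) fun i j => hasDerivAt_const _ _)
        (b := fun s => (1 + s • b)ᵀ) (b' := bᵀ) (t := 0)
        (fun i j => by
          simpa only [transpose_apply] using hasDerivAt_one_add_smul_entry b j i) i j
      simpa using h2
    have h2 : HasDerivAt (fun s : ℂ => pfaffian ((1 + s • b) * x * (1 + s • b)ᵀ))
        (trace b * pfaffian x) 0 := by
      simp only [pfaffian_conj hm]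
      refine HasDerivAt.mul_const ?_ _
      have h0 : (fun s : ℂ => (1 + s • b).det) = fun s => 1 + trace b * s +
          (det (1 + (Polynomial.X : Polynomial ℂ) • b.map Polynomial.C)).divX.divX.eval s * s ^ 2 :=
        funext fun s => det_one_add_smul s b
      rw [h0]
      have h3 : HasDerivAt (fun s : ℂ => 1 + trace b * s) (trace b) 0 := by
        simpa using ((hasDerivAt_id (0 : ℂ)).const_mul (trace b)).const_add 1
      have h4 : HasDerivAt (fun s : ℂ =>
          (det (1 + (Polynomial.X : Polynomial ℂ) • b.map Polynomial.C)).divX.divX.eval s * s ^ 2)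
          0 0 := by
        have h5 := ((det (1 + (Polynomial.X : Polynomial ℂ) •
          b.map Polynomial.C)).divX.divX.hasDerivAt 0).fun_mul ((hasDerivAt_id (0 : ℂ)).fun_pow 2)
        simpa using h5
      simpa using h3.fun_add h4
    exact h1.unique h2
  -- By skewness of `x` and `P`, both terms on the left of `key` equal `tr(x P b)`; this produces
  -- the `1/2`.
  have h2 : ∀ b : Matrix (Fin m) (Fin m) ℂ, trace (x * P * b) = trace b * (pfaffian x / 2) := by
    intro b
    have h3 : trace (P * (x * bᵀ)) = trace (x * P * b) := by
      rw [← trace_transpose, transpose_mul, transpose_mul, transpose_transpose, hx, hPt,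
        mul_assoc, trace_mul_comm b]
      simp [mul_assoc]
    have h4 : trace (P * (b * x)) = trace (x * P * b) := by
      rw [← mul_assoc, trace_mul_comm, mul_assoc]
    have := key b
    rw [mul_add, trace_add, h3, h4] at this
    linear_combination this / 2
  refine Matrix.ext_iff_trace_mul_right.2 fun b => ?_
  rw [h2, smul_mul_assoc, one_mul, trace_smul, smul_eq_mul, mul_comm]

theorem gradient_pfaffian_mul (hm : Even m) {x : Matrix (Fin m) (Fin m) ℂ} (hx : xᵀ = -x) :
    gradient .so pfaffian x * x = (pfaffian x / 2) • 1 := by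
  have h := congrArg transpose (mul_gradient_pfaffian hm hx)
  rwa [transpose_mul, mem_so_iff.1 (isPolyFun_pfaffian.isGradient .so x).1, hx, neg_mul_neg,
    transpose_smul, transpose_one] at h

/-- Apply `∇Pf(x) x = Pf(x)/2` to a kernel vector. -/
theorem pfaffian_eq_zero (hm : Even m) {x : Matrix (Fin m) (Fin m) ℂ} (hx : xᵀ = -x)
    {u : Fin m → ℂ} (hu : u ≠ 0) (hxu : x *ᵥ u = 0) : pfaffian x = 0 := by
  have h := congrArg (fun z => z *ᵥ u) (gradient_pfaffian_mul hm hx)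
  simp only [← mulVec_mulVec, hxu, mulVec_zero, smul_mulVec, one_mulVec] at h
  have h1 := (smul_eq_zero.1 h.symm).resolve_right hu
  simpa using h1

/-- If the gradient of the Pfaffian does not vanish, the kernel is at most a plane. -/
theorem finrank_ker_le_two (hm : Even m) {x : Matrix (Fin m) (Fin m) ℂ} (hx : xᵀ = -x)
    (hP : gradient .so pfaffian x ≠ 0) : finrank ℂ (LinearMap.ker x.mulVecLin) ≤ 2 := by
  by_contra! h
  refine hP (Matrix.ext fun i j => ?_)
  rw [isPolyFun_pfaffian.gradient_apply, Matrix.zero_apply]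
  -- A kernel of dimension at least three contains some `u ≠ 0` with `u i = u j = 0`. It is also
  -- killed by every `x + t • elem .so j i`, so the Pfaffian vanishes along this line.
  let L : LinearMap.ker x.mulVecLin →ₗ[ℂ] (Fin 2 → ℂ) :=
    (LinearMap.pi ![LinearMap.proj i, LinearMap.proj j]) ∘ₗ (LinearMap.ker x.mulVecLin).subtype
  have hL : ∃ u, u ≠ 0 ∧ L u = 0 := by
    have h1 := L.finrank_range_add_finrank_ker
    have h2 := Submodule.finrank_le (LinearMap.range L)
    rw [finrank_fin_fun] at h2
    have h3 : 0 < finrank ℂ (LinearMap.ker L) := by omega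
    have : Nontrivial (LinearMap.ker L) := finrank_pos_iff.1 h3
    obtain ⟨u, hu⟩ := exists_ne (0 : LinearMap.ker L)
    exact ⟨u.1, fun h => hu (Subtype.ext h), u.2⟩
  obtain ⟨⟨u, hxu⟩, hu0, hu⟩ := hL
  have hu0' : u ≠ 0 := fun h => hu0 (Subtype.ext h)
  have hui : u i = 0 := congrFun hu 0
  have huj : u j = 0 := congrFun hu 1
  have hz : elem .so j i *ᵥ u = 0 := by
    simp [elem, sub_mulVec, Matrix.single_mulVec, hui, huj]
  have hzero : ∀ t : ℂ, pfaffian (x + t • elem .so j i) = 0 := fun t => by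
    refine pfaffian_eq_zero hm ?_ hu0' ?_
    · have h1 := mem_so_iff.1 (elem_mem .so j i)
      rw [transpose_add, transpose_smul, hx, h1]
      module
    · rw [add_mulVec, smul_mulVec, hz, smul_zero, add_zero]
      exact hxu
  have : lineDeriv ℂ pfaffian x (elem .so j i) = 0 := by
    unfold lineDeriv
    simp only [hzero, deriv_const]
  rw [this, mul_zero]

end Pfaffian

/-! ### Regularity from independence of the differentials of the basic invariants -/

section Regular

variable {m : ℕ}

/-- The induction follows the matrix derivative `D` of `(x + sz)^k` and needs the trace of `D * x ^
l` for every `l`; cyclicity of the trace collects the terms. -/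
theorem lineDeriv_trace_pow (k : ℕ) (x z : Matrix (Fin m) (Fin m) ℂ) :
    lineDeriv ℂ (fun y => trace (y ^ k)) x z = k * trace (x ^ (k - 1) * z) := by
  have key : ∃ D : Matrix (Fin m) (Fin m) ℂ,
      (∀ i j, HasDerivAt (fun s : ℂ => ((x + s • z) ^ k) i j) (D i j) 0) ∧
      ∀ l, trace (D * x ^ l) = k * trace (x ^ (k - 1 + l) * z) := by
    induction k with
    | zero => exact ⟨0, fun i j => by simpa using hasDerivAt_const _ _, fun l => by simp⟩
    | succ k ih =>
      obtain ⟨D, hD, htr⟩ := ih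
      refine ⟨D * x + x ^ k * z, fun i j => ?_, fun l => ?_⟩
      · have hz : ∀ i j, HasDerivAt (fun s : ℂ => (x + s • z) i j) (z i j) 0 := fun i j => by
          simpa using ((hasDerivAt_id (0 : ℂ)).mul_const (z i j)).const_add (x i j)
        have := hasDerivAt_mul_entry hD hz i j
        simpa [pow_succ] using this
      · rw [add_mul, trace_add, mul_assoc, ← pow_succ', htr, mul_assoc, trace_mul_comm (x ^ k),
          mul_assoc, ← pow_add, trace_mul_comm z, Nat.add_sub_cancel, Nat.cast_succ, add_comm l k]
        rcases k with _ | k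
        · simp
        · rw [Nat.add_sub_cancel, show k + (l + 1) = k + 1 + l by ring]
          ring
  obtain ⟨D, hD, htr⟩ := key
  have h : HasDerivAt (fun s : ℂ => trace ((x + s • z) ^ k)) (trace D) 0 := by
    simp only [trace, diag_apply]
    exact HasDerivAt.fun_sum fun i _ => hD i i
  rw [show lineDeriv ℂ (fun y => trace (y ^ k)) x z = trace D from h.deriv]
  simpa using htr 0

theorem isPolyFun_trace_pow (k : ℕ) :
    IsPolyFun fun y : Matrix (Fin m) (Fin m) ℂ => trace (y ^ k) := by
  simp only [trace, diag_apply]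
  exact .sum _ fun i => .pow_entry (F := fun y => y) (fun i j => .entry i j) k i i

theorem gradient_trace_pow (τ : Family) (k : ℕ) (x : Matrix (Fin m) (Fin m) ℂ)
    (h : x ^ (k - 1) ∈ lieAlg τ m) :
    gradient τ (fun y => trace (y ^ k)) x = (k : ℂ) • x ^ (k - 1) := by
  refine (isPolyFun_trace_pow k).eq_gradient ⟨(lieAlg τ m).smul_mem _ h, fun z _ => ?_⟩
  rw [lineDeriv_trace_pow, smul_mul_assoc, trace_smul, smul_eq_mul]

theorem linearIndependent_of_smul {ι V : Type*} [Fintype ι] [AddCommGroup V] [Module ℂ V]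
    {w : ι → ℂ} {v : ι → V} (h : LinearIndependent ℂ fun i => w i • v i) :
    LinearIndependent ℂ v := by
  have hw : ∀ i, w i ≠ 0 := fun i hi => h.ne_zero i (by simp [hi])
  rw [Fintype.linearIndependent_iff] at h ⊢
  intro c hc i
  have h1 := h (fun i => c i / w i) (by
    rw [← hc]
    exact Finset.sum_congr rfl fun i _ => by rw [smul_smul, div_mul_cancel₀ _ (hw i)]) i
  exact (div_eq_zero_iff.1 h1).resolve_right (hw i)

theorem mem_centralizer_iff {τ : Family} {x z : Matrix (Fin m) (Fin m) ℂ} :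
    z ∈ centralizer τ x ↔ z ∈ lieAlg τ m ∧ ⁅x, z⁆ = 0 := Iff.rfl

theorem skew_pow_odd {x : Matrix (Fin m) (Fin m) ℂ} (hx : xᵀ = -x) (j : ℕ) :
    (x ^ (2 * j + 1))ᵀ = -x ^ (2 * j + 1) := by
  rw [transpose_pow, hx, Odd.neg_pow (odd_two_mul_add_one j)]

/-- If the differentials of the basic invariants are independent at `x`, then the centralizer of
`x` has dimension at most the rank. -/
theorem finrank_centralizer_le (τ : Family) {x : Matrix (Fin m) (Fin m) ℂ} (hx : x ∈ lieAlg τ m)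
    (h : LinearIndependent ℂ fun j => gradient τ (invariant τ m j) x) :
    finrank ℂ (centralizer τ x) ≤ rank τ m := by
  cases τ with
  | gl =>
    have h1 : LinearIndependent ℂ fun j : Fin m => x ^ (j : ℕ) := by
      refine linearIndependent_of_smul (w := fun j : Fin m => (((j : ℕ) + 1 : ℕ) : ℂ)) ?_
      have e : (fun j : Fin m => (((j : ℕ) + 1 : ℕ) : ℂ) • x ^ (j : ℕ)) =
          fun j : Fin m => gradient .gl (invariant .gl m j) x :=
        funext fun j => (gradient_trace_pow .gl ((j : ℕ) + 1) x trivial).symm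
      rw [e]
      exact h
    refine finrank_commutant_le (A := x) (by simp) h1 _ fun z hz => ?_
    exact (sub_eq_zero.1 (mem_centralizer_iff.1 hz).2).symm
  | so =>
    have hxs := mem_so_iff.1 hx
    have hS : ∀ z ∈ centralizer .so x, zᵀ = -z ∧ z * x = x * z := fun z hz =>
      ⟨mem_so_iff.1 hz.1, (sub_eq_zero.1 (mem_centralizer_iff.1 hz).2).symm⟩
    have hgrad : ∀ j : Fin (rank .so m), ¬(Even m ∧ (j : ℕ) + 1 = m / 2) →
        gradient .so (invariant .so m j) x =
          ((2 * ((j : ℕ) + 1) : ℕ) : ℂ) • x ^ (2 * (j : ℕ) + 1) := by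
      intro j hj
      have h1 : invariant .so m j = fun y => trace (y ^ (2 * ((j : ℕ) + 1))) := by
        funext y
        simp only [invariant, hj, if_false]
      rw [h1, gradient_trace_pow .so _ x (mem_so_iff.2 (skew_pow_odd hxs j))]
      rfl
    rcases Nat.even_or_odd m with hm | hm
    · rcases Nat.eq_zero_or_pos m with rfl | hpos
      · exact (Submodule.finrank_le _).trans (by rw [Module.finrank_matrix]; simp)
      obtain ⟨p, hp⟩ : ∃ p, m = 2 * p + 2 := ⟨m / 2 - 1, by have := hm.two_dvd; omega⟩
      have hr : rank .so m = p + 1 := by simp only [rank]; omega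
      rw [hr]
      -- Indices are shifted by one, so the Pfaffian has the last index `p = m / 2 - 1`. It plays
      -- the role of `P` in the even criterion, with `c = Pf(x)/2`.
      have hP : gradient .so (invariant .so m ⟨p, by omega⟩) x = gradient .so pfaffian x := by
        congr 1
        funext y
        exact if_pos ⟨hm, show p + 1 = m / 2 by omega⟩
      have hsub := h.comp (fun j : Fin p => (⟨j, by omega⟩ : Fin (rank .so m)))
        fun a b hab => Fin.ext (Fin.mk.inj hab)
      have hpow : ∀ j : Fin p, gradient .so (invariant .so m ⟨j, by omega⟩) x =
          ((2 * ((j : ℕ) + 1) : ℕ) : ℂ) • x ^ (2 * (j : ℕ) + 1) := fun j =>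
        hgrad ⟨j, by omega⟩ (by rintro ⟨-, h2 : (j : ℕ) + 1 = m / 2⟩; omega)
      have hli : LinearIndependent ℂ fun j : Fin p => x ^ (2 * (j : ℕ) + 1) := by
        refine linearIndependent_of_smul
          (w := fun j : Fin p => ((2 * ((j : ℕ) + 1) : ℕ) : ℂ)) ?_
        rw [show (fun j : Fin p => ((2 * ((j : ℕ) + 1) : ℕ) : ℂ) • x ^ (2 * (j : ℕ) + 1)) =
          _ from funext fun j => (hpow j).symm]
        exact hsub
      have hPs : gradient .so pfaffian x ∉
          Submodule.span ℂ (range fun j : Fin p => x ^ (2 * (j : ℕ) + 1)) := by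
        rw [← hP]
        have h2 := h.notMem_span_image (s := {j : Fin (rank .so m) | (j : ℕ) < p})
          (x := ⟨p, hr ▸ Nat.lt_succ_self p⟩) (by simp)
        refine fun h3 => h2 (Submodule.span_le.2 ?_ h3)
        rintro _ ⟨j, rfl⟩
        have h4 : x ^ (2 * (j : ℕ) + 1) = (((2 * ((j : ℕ) + 1) : ℕ) : ℂ))⁻¹ •
            gradient .so (invariant .so m ⟨j, hr ▸ j.2.trans (Nat.lt_succ_self p)⟩) x := by
          rw [hpow j, smul_smul, inv_mul_cancel₀ (Nat.cast_ne_zero.2 (by omega)), one_smul]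
        simp only [SetLike.mem_coe]
        rw [h4]
        exact Submodule.smul_mem _ _ (Submodule.subset_span (mem_image_of_mem _ j.2))
      refine finrank_skew_commutant_le_of_even hxs
        (mem_so_iff.1 (isPolyFun_pfaffian.isGradient .so x).1) (mul_gradient_pfaffian hm hxs)
        (gradient_pfaffian_mul hm hxs) (by simpa using hp) hli hPs (fun _ => ?_) _ hS
      exact finrank_ker_le_two hm hxs fun h0 => hPs (h0 ▸ Submodule.zero_mem _)
    · have hli : LinearIndependent ℂ fun j : Fin (m / 2) => x ^ (2 * (j : ℕ) + 1) := by
        refine linearIndependent_of_smul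
          (w := fun j : Fin (m / 2) => ((2 * ((j : ℕ) + 1) : ℕ) : ℂ)) ?_
        have e : (fun j : Fin (m / 2) =>
            ((2 * ((j : ℕ) + 1) : ℕ) : ℂ) • x ^ (2 * (j : ℕ) + 1)) =
            fun j : Fin (m / 2) => gradient .so (invariant .so m j) x :=
          funext fun j => (hgrad j fun h1 => Nat.not_even_iff_odd.2 hm h1.1).symm
        rw [e]
        exact h
      refine finrank_skew_commutant_le_of_odd hxs ?_ hli _ hS
      obtain ⟨l, rfl⟩ := hm
      simp
      omega

end Regular

/-! ### Conjugation by block diagonal matrices -/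

section Blocks

variable {n : ℕ}

/-- `g` is an element of the group of `𝔤ₘ` with inverse `g'`. -/
def ConjPair (τ : Family) {m : ℕ} (g g' : Matrix (Fin m) (Fin m) ℂ) : Prop :=
  g * g' = 1 ∧ match τ with
    | .gl => True
    | .so => g' = gᵀ ∧ g.det = 1

theorem ConjPair.symm {τ : Family} {m : ℕ} {g g' : Matrix (Fin m) (Fin m) ℂ}
    (h : ConjPair τ g g') : ConjPair τ g' g := by
  refine ⟨mul_eq_one_comm.1 h.1, ?_⟩
  cases τ with
  | gl => trivial
  | so => exact ⟨by rw [h.2.1, transpose_transpose], by rw [h.2.1, det_transpose, h.2.2]⟩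

theorem ConjPair.mul {τ : Family} {m : ℕ} {g g' h h' : Matrix (Fin m) (Fin m) ℂ}
    (hg : ConjPair τ g g') (hh : ConjPair τ h h') : ConjPair τ (g * h) (h' * g') := by
  refine ⟨by rw [mul_assoc, ← mul_assoc h, hh.1, one_mul, hg.1], ?_⟩
  cases τ with
  | gl => trivial
  | so => exact ⟨by rw [transpose_mul, hg.2.1, hh.2.1], by rw [det_mul, hg.2.2, hh.2.2, one_mul]⟩

theorem conjPair_of_mem_group {τ : Family} {m : ℕ} {g : Matrix (Fin m) (Fin m) ℂ}
    (hg : g ∈ group τ m) : ConjPair τ g g⁻¹ := by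
  cases τ with
  | gl => exact ⟨Matrix.mul_nonsing_inv _ ((Matrix.isUnit_iff_isUnit_det _).1 hg), trivial⟩
  | so =>
    have h1 : g⁻¹ = gᵀ := Matrix.inv_eq_right_inv hg.1
    exact ⟨by rw [h1]; exact hg.1, h1, hg.2⟩

theorem ConjPair.mem_group {τ : Family} {m : ℕ} {g g' : Matrix (Fin m) (Fin m) ℂ}
    (h : ConjPair τ g g') : g ∈ group τ m := by
  cases τ with
  | gl => exact ⟨⟨g, g', h.1, mul_eq_one_comm.1 h.1⟩, rfl⟩
  | so => exact ⟨by rw [← h.2.1]; exact h.1, h.2.2⟩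

theorem ConjPair.inv_eq {τ : Family} {m : ℕ} {g g' : Matrix (Fin m) (Fin m) ℂ}
    (h : ConjPair τ g g') : g⁻¹ = g' := Matrix.inv_eq_right_inv h.1

theorem ConjPair.conj_mem {τ : Family} {m : ℕ} {g g' x : Matrix (Fin m) (Fin m) ℂ}
    (h : ConjPair τ g g') (hx : x ∈ lieAlg τ m) : g * x * g' ∈ lieAlg τ m := by
  cases τ with
  | gl => trivial
  | so =>
    refine mem_so_iff.2 ?_
    rw [h.2.1, transpose_mul, transpose_mul, transpose_transpose, mem_so_iff.1 hx]
    noncomm_ring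

/-- Traces of powers only need conjugation; the Pfaffian needs `g' = gᵀ` and `det g = 1`, so it is
invariant under `SO` but not under `O`. -/
theorem invariant_conj {τ : Family} {m : ℕ} {g g' : Matrix (Fin m) (Fin m) ℂ}
    (h : ConjPair τ g g') (j : Fin (rank τ m)) (y : Matrix (Fin m) (Fin m) ℂ) :
    invariant τ m j (g * y * g') = invariant τ m j y := by
  have hpow : ∀ k : ℕ, trace ((g * y * g') ^ k) = trace (y ^ k) := by
    intro k
    have h1 : (g * y * g') ^ k = g * y ^ k * g' := by
      induction k with
      | zero => simp [h.1]
      | succ k ih =>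
        rw [pow_succ, ih, pow_succ]
        calc g * y ^ k * g' * (g * y * g') = g * y ^ k * (g' * g) * y * g' := by noncomm_ring
          _ = g * (y ^ k * y) * g' := by rw [h.symm.1]; noncomm_ring
    rw [h1, trace_mul_comm, ← mul_assoc, h.symm.1, one_mul]
  cases τ with
  | gl => exact hpow _
  | so =>
    unfold invariant
    by_cases hj : Even m ∧ (j : ℕ) + 1 = m / 2
    · simp only [hj, and_self, if_true]
      rw [h.2.1, pfaffian_conj hj.1, h.2.2, one_mul]
    · simp only [hj, if_false]
      exact hpow _

theorem exp_mul_exp_neg (a : Matrix (Fin n) (Fin n) ℂ) :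
    NormedSpace.exp a * NormedSpace.exp (-a) = 1 := by
  rw [← Matrix.exp_add_of_commute _ _ (Commute.neg_right (Commute.refl a)), add_neg_cancel,
    NormedSpace.exp_zero]

/-- This square root gives `det (exp a) = 1` for skew `a`: with `h = exp(a/2)`, `det(h h) = det(h
hᵀ) = det(h h⁻¹) = 1`. The same works after a cutoff. -/
theorem exp_half_mul_self (a : Matrix (Fin n) (Fin n) ℂ) :
    NormedSpace.exp ((1 / 2 : ℂ) • a) * NormedSpace.exp ((1 / 2 : ℂ) • a) = NormedSpace.exp a := by
  rw [← Matrix.exp_add_of_commute _ _ (Commute.refl _), ← add_smul]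
  norm_num

theorem exp_neg_of_skew {a : Matrix (Fin n) (Fin n) ℂ} (ha : a ∈ lieAlg .so n) :
    NormedSpace.exp (-a) = (NormedSpace.exp a)ᵀ := by
  rw [← Matrix.exp_transpose, mem_so_iff.1 ha]

/-- `g` is block diagonal with first block of size `i + 1`. -/
def Blk (i : Fin n) (g : Matrix (Fin n) (Fin n) ℂ) : Prop :=
  ∀ p q, p ≤ i → i < q → g p q = 0 ∧ g q p = 0

/-- `a` is supported in the first block of size `i + 1`. -/
def Supp (i : Fin n) (a : Matrix (Fin n) (Fin n) ℂ) : Prop :=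
  ∀ p q, i < p ∨ i < q → a p q = 0

theorem sum_castLE (i : Fin n) (h : Fin n → ℂ) (h0 : ∀ r, i < r → h r = 0) :
    ∑ r, h r = ∑ r : Fin ((i : ℕ) + 1), h (Fin.castLE i.isLt r) := by
  symm
  refine Fintype.sum_of_injective (Fin.castLE i.isLt) (Fin.castLE_injective _) _ _
    (fun r hr => h0 r ?_) fun _ => rfl
  by_contra hle
  exact hr ⟨⟨r, by have := Fin.not_lt.1 hle; rw [Fin.le_def] at this; omega⟩, rfl⟩

theorem castLE_le (i : Fin n) (p : Fin ((i : ℕ) + 1)) : Fin.castLE i.isLt p ≤ i := by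
  rw [Fin.le_def]
  exact Nat.lt_succ_iff.1 p.2

theorem cutoff_mul_left {i : Fin n} {g : Matrix (Fin n) (Fin n) ℂ} (hg : Blk i g)
    (x : Matrix (Fin n) (Fin n) ℂ) : cutoff (g * x) i = cutoff g i * cutoff x i := by
  ext p q
  simp only [cutoff, submatrix_apply, Matrix.mul_apply]
  exact sum_castLE i _ fun r hr => by rw [(hg _ r (castLE_le i p) hr).1, zero_mul]

theorem cutoff_mul_right {i : Fin n} {g : Matrix (Fin n) (Fin n) ℂ} (hg : Blk i g)
    (x : Matrix (Fin n) (Fin n) ℂ) : cutoff (x * g) i = cutoff x i * cutoff g i := by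
  ext p q
  simp only [cutoff, submatrix_apply, Matrix.mul_apply]
  exact sum_castLE i _ fun r hr => by rw [(hg _ r (castLE_le i q) hr).2, mul_zero]

theorem cutoff_one (i : Fin n) : cutoff (1 : Matrix (Fin n) (Fin n) ℂ) i = 1 :=
  submatrix_one _ (Fin.castLE_injective _)

theorem cutoff_transpose (x : Matrix (Fin n) (Fin n) ℂ) (i : Fin n) :
    cutoff xᵀ i = (cutoff x i)ᵀ := rfl

theorem cutoff_eq_iff {i : Fin n} {x y : Matrix (Fin n) (Fin n) ℂ} :
    cutoff x i = cutoff y i ↔ ∀ p q, p ≤ i → q ≤ i → x p q = y p q := by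
  constructor
  · intro h p q hp hq
    rw [Fin.le_def] at hp hq
    exact congrFun (congrFun h ⟨p, by omega⟩) ⟨q, by omega⟩
  · intro h
    ext p q
    exact h _ _ (castLE_le i p) (castLE_le i q)

theorem cutoff_eq_of_le {i i' : Fin n} (hi : i' ≤ i) {x y : Matrix (Fin n) (Fin n) ℂ}
    (h : cutoff x i = cutoff y i) : cutoff x i' = cutoff y i' := by
  rw [cutoff_eq_iff] at h ⊢
  exact fun p q hp hq => h p q (hp.trans hi) (hq.trans hi)

theorem Supp.smul {i : Fin n} {a : Matrix (Fin n) (Fin n) ℂ} (ha : Supp i a) (c : ℂ) :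
    Supp i (c • a) := fun p q h => by rw [Matrix.smul_apply, ha p q h, smul_zero]

theorem Supp.neg {i : Fin n} {a : Matrix (Fin n) (Fin n) ℂ} (ha : Supp i a) :
    Supp i (-a) := fun p q h => by rw [Matrix.neg_apply, ha p q h, neg_zero]

theorem Supp.mono {i i' : Fin n} (hi : i ≤ i') {a : Matrix (Fin n) (Fin n) ℂ} (ha : Supp i a) :
    Supp i' a := fun p q h => ha p q (h.imp hi.trans_lt hi.trans_lt)

/-- `a` is block triangular for both orders of the two blocks, and the exponential preserves each
triangularity. -/
theorem Supp.blk_exp {i : Fin n} {a : Matrix (Fin n) (Fin n) ℂ} (ha : Supp i a) :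
    Blk i (NormedSpace.exp a) := by
  have h1 : BlockTriangular a fun p => if p ≤ i then 0 else 1 := fun p q hpq => by
    refine ha p q (Or.inl ?_)
    by_contra h
    simp [not_lt.1 h] at hpq
  have h2 : BlockTriangular a fun p => if p ≤ i then 1 else 0 := fun p q hpq => by
    refine ha p q (Or.inr ?_)
    by_contra h
    simp only [not_lt.1 h, if_true] at hpq
    split_ifs at hpq <;> omega
  intro p q hp hq
  refine ⟨h2.exp ?_, h1.exp ?_⟩ <;> simp [hp, hq.not_ge]

theorem conjPair_exp {τ : Family} {a : Matrix (Fin n) (Fin n) ℂ} (ha : a ∈ lieAlg τ n) :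
    ConjPair τ (NormedSpace.exp a) (NormedSpace.exp (-a)) := by
  refine ⟨exp_mul_exp_neg a, ?_⟩
  cases τ with
  | gl => trivial
  | so =>
    refine ⟨exp_neg_of_skew ha, ?_⟩
    have h2 := congrArg det (exp_mul_exp_neg ((1 / 2 : ℂ) • a))
    rw [exp_neg_of_skew ((lieAlg .so n).smul_mem _ ha), det_mul, det_transpose, ← det_mul,
      exp_half_mul_self, det_one] at h2
    exact h2

theorem conjPair_cutoff_exp {τ : Family} {i : Fin n} {a : Matrix (Fin n) (Fin n) ℂ}
    (ha : a ∈ lieAlg τ n) (hs : Supp i a) :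
    ConjPair τ (cutoff (NormedSpace.exp a) i) (cutoff (NormedSpace.exp (-a)) i) := by
  refine ⟨by rw [← cutoff_mul_left hs.blk_exp, exp_mul_exp_neg, cutoff_one], ?_⟩
  cases τ with
  | gl => trivial
  | so =>
    refine ⟨by rw [exp_neg_of_skew ha, cutoff_transpose], ?_⟩
    have h1 := (hs.smul (1 / 2)).blk_exp
    have h2 := congrArg (fun y => det (cutoff y i)) (exp_mul_exp_neg ((1 / 2 : ℂ) • a))
    simp only [cutoff_mul_left h1] at h2
    rw [exp_neg_of_skew ((lieAlg .so n).smul_mem _ ha), cutoff_transpose, det_mul, det_transpose,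
      ← det_mul, ← cutoff_mul_left h1, exp_half_mul_self, cutoff_one, det_one] at h2
    exact h2

/-- Conjugation by `g` is compatible with the cutoff at level `i`. -/
def LevelPair (τ : Family) (i : Fin n) (g g' : Matrix (Fin n) (Fin n) ℂ) : Prop :=
  ConjPair τ g g' ∧ Blk i g ∧ Blk i g' ∧ ConjPair τ (cutoff g i) (cutoff g' i)

theorem levelPair_exp {τ : Family} {i i' : Fin n} (hi : i ≤ i') {a : Matrix (Fin n) (Fin n) ℂ}
    (ha : a ∈ lieAlg τ n) (hs : Supp i a) :
    LevelPair τ i' (NormedSpace.exp a) (NormedSpace.exp (-a)) :=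
  ⟨conjPair_exp ha, (hs.mono hi).blk_exp, (hs.mono hi).neg.blk_exp,
    conjPair_cutoff_exp ha (hs.mono hi)⟩

theorem levelPair_last {N : ℕ} {τ : Family} {g g' : Matrix (Fin (N + 1)) (Fin (N + 1)) ℂ}
    (h : ConjPair τ g g') : LevelPair τ (Fin.last N) g g' :=
  ⟨h, fun _ q _ hq => absurd hq (Fin.le_last q).not_gt,
    fun _ q _ hq => absurd hq (Fin.le_last q).not_gt, h⟩

theorem gzFun_conj {τ : Family} {s : Index τ n} {g g' : Matrix (Fin n) (Fin n) ℂ}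
    (h : LevelPair τ s.1 g g') (y : Matrix (Fin n) (Fin n) ℂ) :
    gzFun τ s (g * y * g') = gzFun τ s y := by
  unfold gzFun
  rw [cutoff_mul_right h.2.2.1, cutoff_mul_left h.2.1]
  exact invariant_conj h.2.2.2 _ _

theorem gzFun_congr {τ : Family} {s : Index τ n} {x y : Matrix (Fin n) (Fin n) ℂ}
    (h : cutoff x s.1 = cutoff y s.1) : gzFun τ s x = gzFun τ s y := by
  unfold gzFun
  rw [h]

/-! ### The gradients of the Gelfand-Zeitlin functions -/

/-- The gradient of `f_{i,j}`. -/
noncomputable abbrev grad (τ : Family) (s : Index τ n) (x : Matrix (Fin n) (Fin n) ℂ) :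
    Matrix (Fin n) (Fin n) ℂ := gradient τ (gzFun τ s) x

theorem grad_mem (τ : Family) (s : Index τ n) (x : Matrix (Fin n) (Fin n) ℂ) :
    grad τ s x ∈ lieAlg τ n := ((isPolyFun_gzFun τ s).isGradient τ x).1

theorem trace_grad_mul (τ : Family) (s : Index τ n) (x : Matrix (Fin n) (Fin n) ℂ)
    {z : Matrix (Fin n) (Fin n) ℂ} (hz : z ∈ lieAlg τ n) :
    trace (grad τ s x * z) = lineDeriv ℂ (gzFun τ s) x z :=
  ((isPolyFun_gzFun τ s).isGradient τ x).2 z hz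

theorem cutoff_add_smul (x z : Matrix (Fin n) (Fin n) ℂ) (t : ℂ) (i : Fin n) :
    cutoff (x + t • z) i = cutoff x i + t • cutoff z i := rfl

/-- The function depends only on the corner, so its derivative vanishes in the elementary directions
outside it. -/
theorem supp_grad (τ : Family) (s : Index τ n) (x : Matrix (Fin n) (Fin n) ℂ) :
    Supp s.1 (grad τ s x) := by
  intro p q hpq
  rw [grad, (isPolyFun_gzFun τ s).gradient_apply]
  have h : ∀ t : ℂ, gzFun τ s (x + t • elem τ q p) = gzFun τ s x := fun t => by
    refine gzFun_congr (cutoff_eq_iff.2 fun a b ha hb => ?_)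
    rw [Matrix.add_apply, Matrix.smul_apply, elem_apply_eq_zero, smul_zero, add_zero]
    · rintro ⟨rfl, rfl⟩
      rcases hpq with h | h
      · exact hb.not_gt h
      · exact ha.not_gt h
    · rintro ⟨rfl, rfl⟩
      rcases hpq with h | h
      · exact ha.not_gt h
      · exact hb.not_gt h
  have h2 : lineDeriv ℂ (gzFun τ s) x (elem τ q p) = 0 := by
    unfold lineDeriv
    simp only [h, deriv_const]
  rw [h2, mul_zero]

theorem grad_congr {τ : Family} {s : Index τ n} {x y : Matrix (Fin n) (Fin n) ℂ}
    (h : cutoff x s.1 = cutoff y s.1) : grad τ s x = grad τ s y := by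
  ext p q
  rw [grad, grad, (isPolyFun_gzFun τ s).gradient_apply, (isPolyFun_gzFun τ s).gradient_apply]
  congr 1
  unfold lineDeriv
  congr 1
  funext t
  exact gzFun_congr (by rw [cutoff_add_smul, cutoff_add_smul, h])

theorem grad_conj {τ : Family} {s : Index τ n} {g g' : Matrix (Fin n) (Fin n) ℂ}
    (h : LevelPair τ s.1 g g') (x : Matrix (Fin n) (Fin n) ℂ) :
    grad τ s (g * x * g') = g * grad τ s x * g' := by
  refine (isPolyFun_gzFun τ s).eq_gradient ⟨h.1.conj_mem (grad_mem τ s x), fun z hz => ?_⟩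
  have h1 : g' * z * g ∈ lieAlg τ n := h.1.symm.conj_mem hz
  have h2 : trace (g * grad τ s x * g' * z) = trace (grad τ s x * (g' * z * g)) := by
    rw [← mul_assoc (grad τ s x), ← mul_assoc (grad τ s x), trace_mul_comm _ g]
    simp only [mul_assoc]
  rw [h2, trace_grad_mul τ s x h1]
  unfold lineDeriv
  congr 1
  funext t
  rw [← gzFun_conj h]
  congr 1
  have h3 : g * (g' * z * g) * g' = z := by
    rw [← mul_assoc, ← mul_assoc, h.1.1, one_mul, mul_assoc, h.1.1, mul_one]
  rw [mul_add, add_mul, mul_smul_comm, smul_mul_assoc, h3]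

theorem hasDerivAt_exp_entry (b : Matrix (Fin n) (Fin n) ℂ) (i j : Fin n) :
    HasDerivAt (fun s : ℂ => NormedSpace.exp (s • b) i j) (b i j) 0 := by
  have h := hasDerivAt_exp_smul_const (𝕂 := ℂ) b (0 : ℂ)
  rw [zero_smul, NormedSpace.exp_zero, one_mul] at h
  exact (LinearMap.toContinuousLinearMap (Matrix.entryLinearMap ℂ ℂ i j)).hasFDerivAt.comp_hasDerivAt
    (0 : ℂ) h

theorem hasDerivAt_conj_entry (b x : Matrix (Fin n) (Fin n) ℂ) (i j : Fin n) :
    HasDerivAt (fun s : ℂ => (NormedSpace.exp (s • b) * x * NormedSpace.exp (-(s • b))) i j)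
      (⁅b, x⁆ i j) 0 := by
  have h1 : ∀ i j, HasDerivAt (fun s : ℂ => NormedSpace.exp (-(s • b)) i j) ((-b) i j) 0 :=
    fun i j => by simpa only [smul_neg] using hasDerivAt_exp_entry (-b) i j
  have h := hasDerivAt_mul_entry (hasDerivAt_mul_entry (hasDerivAt_exp_entry b)
    (b := fun _ => x) (b' := 0) fun i j => hasDerivAt_const _ _) h1 i j
  refine h.congr_deriv ?_
  simp [Ring.lie_def, NormedSpace.exp_zero, sub_eq_add_neg]

/-- The function is constant along the conjugates of `x` by `exp(t b)`, whose velocity at `t = 0` is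
`⁅b, x⁆`. -/
theorem lineDeriv_lie_eq_zero {τ : Family} {s : Index τ n} {b : Matrix (Fin n) (Fin n) ℂ}
    (hb : b ∈ lieAlg τ n) (hs : Supp s.1 b) (x : Matrix (Fin n) (Fin n) ℂ) :
    lineDeriv ℂ (gzFun τ s) x ⁅b, x⁆ = 0 := by
  have h1 := (isPolyFun_gzFun τ s).hasDerivAt_comp
    (c := fun t : ℂ => NormedSpace.exp (t • b) * x * NormedSpace.exp (-(t • b)))
    (x := x) (by simp [NormedSpace.exp_zero]) (hasDerivAt_conj_entry b x)
  have h2 : (fun t : ℂ => gzFun τ s (NormedSpace.exp (t • b) * x * NormedSpace.exp (-(t • b)))) =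
      fun _ => gzFun τ s x := funext fun t =>
    gzFun_conj (levelPair_exp le_rfl ((lieAlg τ n).smul_mem t hb) (hs.smul t)) x
  rw [h2] at h1
  exact h1.unique (hasDerivAt_const _ _)

/-- The entry is a multiple of `tr([x, ∇f] e) = df([e, x])` with `e` elementary in the corner, and
`f` is invariant under conjugation by `exp(t e)`. -/
theorem lie_grad_apply {τ : Family} {s : Index τ n} {x : Matrix (Fin n) (Fin n) ℂ}
    (hx : x ∈ lieAlg τ n) {p q : Fin n} (hp : p ≤ s.1) (hq : q ≤ s.1) :
    ⁅x, grad τ s x⁆ p q = 0 := by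
  have hmem : ⁅x, grad τ s x⁆ ∈ lieAlg τ n := (lieAlg τ n).lie_mem hx (grad_mem τ s x)
  have hsupp : Supp s.1 (elem τ q p) := fun a b hab => elem_apply_eq_zero
    (by rintro ⟨rfl, rfl⟩; rcases hab with h | h; exacts [hq.not_gt h, hp.not_gt h])
    (by rintro ⟨rfl, rfl⟩; rcases hab with h | h; exacts [hp.not_gt h, hq.not_gt h])
  rw [← trace_mul_elem hmem, trace_mul_comm, ← trace_mul_lie',
    trace_grad_mul τ s x ((lieAlg τ n).lie_mem (elem_mem τ q p) hx),
    lineDeriv_lie_eq_zero (elem_mem τ q p) hsupp, mul_zero]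

/-- The part of `x` in the first block of size `i + 1`. -/
def blkPart (i : Fin n) (x : Matrix (Fin n) (Fin n) ℂ) : Matrix (Fin n) (Fin n) ℂ :=
  Matrix.of fun p q => if p ≤ i ∧ q ≤ i then x p q else 0

theorem cutoff_blkPart (i : Fin n) (x : Matrix (Fin n) (Fin n) ℂ) :
    cutoff (blkPart i x) i = cutoff x i :=
  cutoff_eq_iff.2 fun p q hp hq => by simp [blkPart, hp, hq]

/-- Inside the corner this is `lie_grad_apply`; outside it both products vanish by the support of
the gradient. It makes the flow fix its own corner. -/
theorem commute_grad_blkPart {τ : Family} {s : Index τ n} {x : Matrix (Fin n) (Fin n) ℂ}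
    (hx : x ∈ lieAlg τ n) : Commute (grad τ s x) (blkPart s.1 x) := by
  have hs := supp_grad τ s x
  have h1 : ∀ p q, p ≤ s.1 → q ≤ s.1 → (blkPart s.1 x * grad τ s x) p q = (x * grad τ s x) p q := by
    intro p q hp _
    rw [Matrix.mul_apply, Matrix.mul_apply]
    refine Finset.sum_congr rfl fun r _ => ?_
    by_cases hr : r ≤ s.1
    · simp [blkPart, hp, hr]
    · rw [hs r q (Or.inl (not_le.1 hr)), mul_zero, mul_zero]
  have h2 : ∀ p q, p ≤ s.1 → q ≤ s.1 → (grad τ s x * blkPart s.1 x) p q = (grad τ s x * x) p q := by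
    intro p q _ hq
    rw [Matrix.mul_apply, Matrix.mul_apply]
    refine Finset.sum_congr rfl fun r _ => ?_
    by_cases hr : r ≤ s.1
    · simp [blkPart, hq, hr]
    · rw [hs p r (Or.inr (not_le.1 hr)), zero_mul, zero_mul]
  refine Matrix.ext fun p q => ?_
  by_cases hpq : p ≤ s.1 ∧ q ≤ s.1
  · rw [h1 p q hpq.1 hpq.2, h2 p q hpq.1 hpq.2]
    have := lie_grad_apply (s := s) hx hpq.1 hpq.2
    rw [Ring.lie_def, Matrix.sub_apply] at this
    exact (sub_eq_zero.1 this).symm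
  · rw [Matrix.mul_apply, Matrix.mul_apply, Finset.sum_eq_zero, Finset.sum_eq_zero]
    · intro r _
      by_cases hp : p ≤ s.1
      · rw [hs r q (Or.inr (not_le.1 fun hq => hpq ⟨hp, hq⟩)), mul_zero]
      · simp [blkPart, hp]
    · intro r _
      by_cases hp : p ≤ s.1
      · have hq : ¬q ≤ s.1 := fun hq => hpq ⟨hp, hq⟩
        simp [blkPart, hq]
      · rw [hs p r (Or.inl (not_le.1 hp)), zero_mul]

/-- At the top level the corner is the whole matrix: the invariants of `𝔤ₙ` are Casimirs. -/
theorem lie_grad_last {N : ℕ} {τ : Family} {j : Fin (rank τ (N + 1))}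
    {x : Matrix (Fin (N + 1)) (Fin (N + 1)) ℂ} (hx : x ∈ lieAlg τ (N + 1)) :
    ⁅x, grad τ ⟨Fin.last N, j⟩ x⁆ = 0 :=
  Matrix.ext fun p q => lie_grad_apply (s := ⟨Fin.last N, j⟩) hx (Fin.le_last p) (Fin.le_last q)

end Blocks

/-! ### The flows of the Gelfand-Zeitlin functions -/

section Flow

variable {n : ℕ} {τ : Family} {x y : Matrix (Fin n) (Fin n) ℂ}

theorem levelPair_flow {i : Fin n} (s : Index τ n) (hi : s.1 ≤ i) (t : ℂ)
    (x : Matrix (Fin n) (Fin n) ℂ) :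
    LevelPair τ i (NormedSpace.exp (-t • grad τ s x)) (NormedSpace.exp (t • grad τ s x)) := by
  have h := levelPair_exp hi ((lieAlg τ n).smul_mem (-t) (grad_mem τ s x))
    ((supp_grad τ s x).smul (-t))
  rwa [neg_smul, neg_neg, ← neg_smul] at h

theorem gzFlow_mem (s : Index τ n) (t : ℂ) (hx : x ∈ lieAlg τ n) : gzFlow τ s t x ∈ lieAlg τ n :=
  (levelPair_flow s le_rfl t x).1.conj_mem hx

theorem gzFlow_zero (s : Index τ n) (x : Matrix (Fin n) (Fin n) ℂ) : gzFlow τ s 0 x = x := by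
  simp [gzFlow, NormedSpace.exp_zero]

/-- The corner at level `s.1` is conjugated by the exponential of a matrix commuting with it, hence
does not move; smaller corners lie inside it. -/
theorem cutoff_gzFlow (s : Index τ n) (t : ℂ) (hx : x ∈ lieAlg τ n) {i : Fin n} (hi : i ≤ s.1) :
    cutoff (gzFlow τ s t x) i = cutoff x i := by
  refine cutoff_eq_of_le hi ?_
  obtain ⟨h1, h2, h3, -⟩ := levelPair_flow s le_rfl t x
  have hc : Commute (NormedSpace.exp (-t • grad τ s x)) (blkPart s.1 x) :=
    ((commute_grad_blkPart hx).smul_left (-t)).exp_left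
  rw [gzFlow, cutoff_mul_right h3, cutoff_mul_left h2, ← cutoff_blkPart s.1 x,
    ← cutoff_mul_left h2, ← cutoff_mul_right h3]
  change cutoff (NormedSpace.exp (-t • grad τ s x) * blkPart s.1 x * _) _ = _
  rw [hc.eq, mul_assoc]
  exact congrArg (fun z => cutoff (blkPart s.1 x * z) s.1) h1.1 |>.trans (by rw [mul_one])

/-- Corners up to level `s.1` are fixed by the flow, and larger ones are conjugated by a group
element. Infinitesimally, the `f_{i,j}` Poisson commute. -/
theorem gzFun_gzFlow (s s' : Index τ n) (t : ℂ) (hx : x ∈ lieAlg τ n) :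
    gzFun τ s' (gzFlow τ s t x) = gzFun τ s' x := by
  rcases le_total s'.1 s.1 with h | h
  · exact gzFun_congr (cutoff_gzFlow s t hx h)
  · exact gzFun_conj (levelPair_flow s h t x) x

/-- The gradient depends only on a corner that the flow fixes, so it is constant along the flow and
the exponents add. -/
theorem gzFlow_add (s : Index τ n) (t t' : ℂ) (hx : x ∈ lieAlg τ n) :
    gzFlow τ s (t + t') x = gzFlow τ s t (gzFlow τ s t' x) := by
  have h : grad τ s (gzFlow τ s t' x) = grad τ s x := grad_congr (cutoff_gzFlow s t' hx le_rfl)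
  have hc : ∀ a b : ℂ, NormedSpace.exp ((a + b) • grad τ s x) =
      NormedSpace.exp (a • grad τ s x) * NormedSpace.exp (b • grad τ s x) := fun a b => by
    rw [add_smul]
    exact Matrix.exp_add_of_commute _ _ (((Commute.refl _).smul_left a).smul_right b)
  change _ = NormedSpace.exp (-t • grad τ s (gzFlow τ s t' x)) * gzFlow τ s t' x *
    NormedSpace.exp (t • grad τ s (gzFlow τ s t' x))
  rw [h]
  change NormedSpace.exp (-(t + t') • grad τ s x) * x * NormedSpace.exp ((t + t') • grad τ s x) = _
  rw [neg_add, hc, add_comm t t', hc]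
  simp only [gzFlow, mul_assoc]

/-- The higher flow does not change the lower gradient, because it fixes the lower corner. The lower
flow is conjugation by a `g` compatible with the higher level, so it conjugates the higher gradient
by `g`, and the factors `g' * g` cancel. -/
theorem gzFlow_comm_of_le (s s' : Index τ n) (hs : s.1 ≤ s'.1) (t t' : ℂ) (hx : x ∈ lieAlg τ n) :
    gzFlow τ s t (gzFlow τ s' t' x) = gzFlow τ s' t' (gzFlow τ s t x) := by
  have h1 : grad τ s (gzFlow τ s' t' x) = grad τ s x := grad_congr (cutoff_gzFlow s' t' hx hs)
  have hp := levelPair_flow s hs t x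
  have h2 : grad τ s' (gzFlow τ s t x) = _ := grad_conj hp x
  set g := NormedSpace.exp (-t • grad τ s x) with hg
  set g' := NormedSpace.exp (t • grad τ s x) with hg'
  have hu : IsUnit g := ⟨⟨g, g', hp.1.1, hp.1.symm.1⟩, rfl⟩
  have hconj : ∀ c : ℂ, NormedSpace.exp (c • grad τ s' (gzFlow τ s t x)) =
      g * NormedSpace.exp (c • grad τ s' x) * g' := fun c => by
    rw [h2, ← hp.1.inv_eq, ← Matrix.exp_conj _ _ hu, mul_smul_comm, smul_mul_assoc]
  have e1 : gzFlow τ s t (gzFlow τ s' t' x) = g * gzFlow τ s' t' x * g' := by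
    change NormedSpace.exp (-t • grad τ s (gzFlow τ s' t' x)) * _ *
      NormedSpace.exp (t • grad τ s (gzFlow τ s' t' x)) = _
    rw [h1]
  have e2 : gzFlow τ s' t' (gzFlow τ s t x) =
      NormedSpace.exp (-t' • grad τ s' (gzFlow τ s t x)) * (g * x * g') *
      NormedSpace.exp (t' • grad τ s' (gzFlow τ s t x)) := rfl
  have hgg : ∀ z, g' * (g * z) = z := fun z => by rw [← mul_assoc, hp.1.symm.1, one_mul]
  have e0 : gzFlow τ s' t' x = NormedSpace.exp (-t' • grad τ s' x) * x *
    NormedSpace.exp (t' • grad τ s' x) := rfl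
  rw [e1, e0, e2, hconj, hconj]
  simp only [mul_assoc, hgg]

theorem gzFlow_comm (s s' : Index τ n) (t t' : ℂ) (hx : x ∈ lieAlg τ n) :
    gzFlow τ s t (gzFlow τ s' t' x) = gzFlow τ s' t' (gzFlow τ s t x) := by
  rcases le_total s.1 s'.1 with h | h
  · exact gzFlow_comm_of_le s s' h t t' hx
  · exact (gzFlow_comm_of_le s' s h t' t hx).symm

theorem adjointOrbit_conj {g g' : Matrix (Fin n) (Fin n) ℂ} (h : ConjPair τ g g')
    (hy : y ∈ adjointOrbit τ x) : g * y * g' ∈ adjointOrbit τ x := by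
  obtain ⟨k, hk, rfl⟩ := hy
  have h2 := h.mul (conjPair_of_mem_group hk)
  exact ⟨g * k, h2.mem_group, by rw [h2.inv_eq]; simp only [mul_assoc]⟩

theorem gzFlow_mem_orbit (s : Index τ n) (t : ℂ) (hy : y ∈ adjointOrbit τ x) :
    gzFlow τ s t y ∈ adjointOrbit τ x :=
  adjointOrbit_conj (levelPair_flow s le_rfl t y).1 hy

/-- The composition of the flows listed in `L`. -/
noncomputable def flowList (τ : Family) (L : List (Index τ (n - 1))) (t : Index τ (n - 1) → ℂ)
    (x : Matrix (Fin n) (Fin n) ℂ) : Matrix (Fin n) (Fin n) ℂ :=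
  L.foldr (fun s y => gzFlow τ s.incl (t s) y) x

theorem flowList_induction {p : Matrix (Fin n) (Fin n) ℂ → Prop}
    (hp : ∀ s t y, p y → p (gzFlow τ s t y)) (L : List (Index τ (n - 1)))
    (t : Index τ (n - 1) → ℂ) (hx : p x) : p (flowList τ L t x) := by
  induction L with
  | nil => exact hx
  | cons s L ih => exact hp _ _ _ ih

theorem flowList_mem (L : List (Index τ (n - 1))) (t : Index τ (n - 1) → ℂ)
    (hx : x ∈ lieAlg τ n) : flowList τ L t x ∈ lieAlg τ n :=
  flowList_induction (p := (· ∈ lieAlg τ n)) (fun s t _ hy => gzFlow_mem s t hy) L t hx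

theorem gzFlow_flowList (L : List (Index τ (n - 1))) (t : Index τ (n - 1) → ℂ) (s : Index τ n)
    (c : ℂ) (hx : x ∈ lieAlg τ n) :
    gzFlow τ s c (flowList τ L t x) = flowList τ L t (gzFlow τ s c x) := by
  induction L with
  | nil => rfl
  | cons s' L ih =>
    change gzFlow τ s c (gzFlow τ s'.incl (t s') (flowList τ L t x)) = gzFlow τ s'.incl (t s') _
    rw [gzFlow_comm _ _ _ _ (flowList_mem L t hx), ih]
    rfl

theorem flowList_add (L : List (Index τ (n - 1))) (t t' : Index τ (n - 1) → ℂ)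
    (hx : x ∈ lieAlg τ n) : flowList τ L (t + t') x = flowList τ L t (flowList τ L t' x) := by
  induction L with
  | nil => rfl
  | cons s L ih =>
    change gzFlow τ s.incl (t s + t' s) (flowList τ L (t + t') x) =
      gzFlow τ s.incl (t s) (flowList τ L t (gzFlow τ s.incl (t' s) (flowList τ L t' x)))
    rw [ih, gzFlow_add _ _ _ (flowList_mem _ _ (flowList_mem _ _ hx)),
      gzFlow_flowList _ _ _ _ (flowList_mem _ _ hx)]

theorem flowList_zero (L : List (Index τ (n - 1))) (x : Matrix (Fin n) (Fin n) ℂ) :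
    flowList τ L 0 x = x := by
  induction L with
  | nil => rfl
  | cons s L ih =>
    change gzFlow τ s.incl 0 (flowList τ L 0 x) = x
    rw [ih, gzFlow_zero]

theorem flowList_single (L : List (Index τ (n - 1))) (s : Index τ (n - 1)) (c : ℂ)
    (hx : x ∈ lieAlg τ n) :
    flowList τ L (Pi.single s c) x = gzFlow τ s.incl (L.count s * c) x := by
  induction L with
  | nil =>
    rw [List.count_nil, Nat.cast_zero, zero_mul, gzFlow_zero]
    rfl
  | cons s' L ih =>
    have h : ∀ t, flowList τ (s' :: L) t x = gzFlow τ s'.incl (t s') (flowList τ L t x) :=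
      fun _ => rfl
    rw [h, ih]
    by_cases h : s' = s
    · subst h
      rw [Pi.single_eq_same, ← gzFlow_add _ _ _ hx, List.count_cons_self]
      congr 1
      push_cast
      ring
    · rw [Pi.single_eq_of_ne h, gzFlow_zero, List.count_cons_of_ne h]

theorem mem_indexList {m : ℕ} (s : Index τ m) : s ∈ indexList τ m := by
  simp only [indexList, List.mem_flatMap, List.mem_map]
  exact ⟨s.1, List.mem_finRange _, s.2, List.mem_finRange _, rfl⟩

/-- `k` is the multiplicity of `s` in `indexList`. Only `k ≠ 0` matters: the derivative of the
action still reaches each Hamiltonian field after rescaling. -/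
theorem exists_aAct_single (s : Index τ (n - 1)) : ∃ k : ℂ, k ≠ 0 ∧
    ∀ c : ℂ, ∀ x ∈ lieAlg τ n, aAct τ (Pi.single s c) x = gzFlow τ s.incl (k * c) x := by
  obtain ⟨L, hL⟩ : ∃ L, L = indexList τ (n - 1) := ⟨_, rfl⟩
  refine ⟨L.count s, Nat.cast_ne_zero.2 (List.count_pos_iff.2 (hL ▸ mem_indexList s)).ne',
    fun c x hx => ?_⟩
  rw [← flowList_single L s c hx, hL]
  rfl

theorem aAct_mem (t : Index τ (n - 1) → ℂ) (hx : x ∈ lieAlg τ n) : aAct τ t x ∈ lieAlg τ n :=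
  flowList_mem _ t hx

theorem aAct_mem_orbit (t : Index τ (n - 1) → ℂ) (hy : y ∈ adjointOrbit τ x) :
    aAct τ t y ∈ adjointOrbit τ x :=
  flowList_induction (p := (· ∈ adjointOrbit τ x)) (fun s t _ hy => gzFlow_mem_orbit s t hy) _ t hy

theorem gzFun_aAct (s : Index τ n) (t : Index τ (n - 1) → ℂ) (hx : x ∈ lieAlg τ n) :
    gzFun τ s (aAct τ t x) = gzFun τ s x :=
  (flowList_induction (p := fun y => y ∈ lieAlg τ n ∧ gzFun τ s y = gzFun τ s x)
    (fun s' t _ hy => ⟨gzFlow_mem s' t hy.1, (gzFun_gzFlow s' s t hy.1).trans hy.2⟩) _ t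
    ⟨hx, rfl⟩).2

theorem aAct_add (t t' : Index τ (n - 1) → ℂ) (hx : x ∈ lieAlg τ n) :
    aAct τ (t + t') x = aAct τ t (aAct τ t' x) := flowList_add _ t t' hx

theorem aAct_zero (x : Matrix (Fin n) (Fin n) ℂ) : aAct τ 0 x = x := flowList_zero _ x

theorem aAct_neg_aAct (t : Index τ (n - 1) → ℂ) (hx : x ∈ lieAlg τ n) :
    aAct τ (-t) (aAct τ t x) = x := by
  rw [← aAct_add _ _ hx, neg_add_cancel, aAct_zero]

theorem self_mem_aOrbit (τ : Family) (x : Matrix (Fin n) (Fin n) ℂ) : x ∈ aOrbit τ x :=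
  ⟨0, aAct_zero x⟩

theorem aOrbit_subset_of_mem (hx : x ∈ lieAlg τ n) (hy : y ∈ aOrbit τ x) :
    aOrbit τ y ⊆ aOrbit τ x := by
  obtain ⟨t, rfl⟩ := hy
  rintro _ ⟨t', rfl⟩
  exact ⟨t' + t, aAct_add _ _ hx⟩

theorem mem_lieAlg_of_mem_aOrbit (hx : x ∈ lieAlg τ n) (hy : y ∈ aOrbit τ x) : y ∈ lieAlg τ n := by
  obtain ⟨t, rfl⟩ := hy
  exact aAct_mem t hx

theorem mem_aOrbit_symm (hx : x ∈ lieAlg τ n) (hy : y ∈ aOrbit τ x) : x ∈ aOrbit τ y := by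
  obtain ⟨t, rfl⟩ := hy
  exact ⟨-t, aAct_neg_aAct t hx⟩

theorem aOrbit_eq_of_mem (hx : x ∈ lieAlg τ n) (hy : y ∈ aOrbit τ x) : aOrbit τ y = aOrbit τ x :=
  (aOrbit_subset_of_mem hx hy).antisymm
    (aOrbit_subset_of_mem (mem_lieAlg_of_mem_aOrbit hx hy) (mem_aOrbit_symm hx hy))

/-! ### Analyticity of the action -/

theorem analyticAt_conj_exp {A E : Type*} [NormedRing A] [NormedAlgebra ℂ A] [CompleteSpace A]
    [NormedAddCommGroup E] [NormedSpace ℂ E] {F G : E → A} {l : E → ℂ} {p : E}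
    (hF : AnalyticAt ℂ F p) (hG : AnalyticAt ℂ G p) (hl : AnalyticAt ℂ l p) :
    AnalyticAt ℂ (fun q => NormedSpace.exp (-l q • G q) * F q * NormedSpace.exp (l q • G q)) p := by
  have h1 : AnalyticAt ℂ (fun q => NormedSpace.exp (l q • G q)) p :=
    (NormedSpace.exp_analytic (𝕂 := ℂ) (l p • G p)).comp_of_eq (hl.smul hG) rfl
  have h2 : AnalyticAt ℂ (fun q => NormedSpace.exp (-l q • G q)) p :=
    (NormedSpace.exp_analytic (𝕂 := ℂ) (-l p • G p)).comp_of_eq (hl.neg.smul hG) rfl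
  exact (h2.mul hF).mul h1

theorem analyticAt_gzFlow {E : Type*} [NormedAddCommGroup E] [NormedSpace ℂ E]
    {F : E → Matrix (Fin n) (Fin n) ℂ} {l : E → ℂ} {p : E} (s : Index τ n)
    (hF : AnalyticAt ℂ F p) (hl : AnalyticAt ℂ l p) :
    AnalyticAt ℂ (fun q => gzFlow τ s (l q) (F q)) p :=
  analyticAt_conj_exp (A := Matrix (Fin n) (Fin n) ℂ) hF
    (((isPolyFun_gzFun τ s).analyticAt_gradient τ (F p)).comp_of_eq hF rfl) hl

theorem analyticAt_aAct {E : Type*} [NormedAddCommGroup E] [NormedSpace ℂ E]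
    {F : E → Matrix (Fin n) (Fin n) ℂ} {l : E → Index τ (n - 1) → ℂ} {p : E}
    (hF : AnalyticAt ℂ F p) (hl : ∀ s, AnalyticAt ℂ (fun q => l q s) p) :
    AnalyticAt ℂ (fun q => aAct τ (l q) (F q)) p := by
  change AnalyticAt ℂ (fun q => flowList τ _ (l q) (F q)) p
  induction indexList τ (n - 1) with
  | nil => exact hF
  | cons s L ih => exact analyticAt_gzFlow s.incl ih (hl s)

theorem hasDerivAt_gzFlow_entry (s : Index τ n) (k : ℂ) (x : Matrix (Fin n) (Fin n) ℂ)
    (i j : Fin n) :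
    HasDerivAt (fun c => gzFlow τ s (k * c) x i j) ((k • hamiltonianField τ (gzFun τ s) x) i j)
      0 := by
  have h := hasDerivAt_conj_entry (-k • grad τ s x) x i j
  have e : ∀ c : ℂ, c • (-k • grad τ s x) = -(k * c) • grad τ s x := fun c => by
    rw [smul_smul]; congr 1; ring
  simp only [e, ← neg_smul, neg_neg] at h
  refine h.congr_deriv ?_
  rw [hamiltonianField, smul_lie, neg_smul, ← lie_skew, smul_neg, neg_neg]

end Flow

/-! ### Orbits in a linear subspace as level sets, and leaves -/

section LevelInSubspace

open Filter Topology

variable {E P W : Type*} [NormedAddCommGroup E] [NormedSpace ℂ E] [FiniteDimensional ℂ E]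
  [NormedAddCommGroup P] [NormedSpace ℂ P] [FiniteDimensional ℂ P]
  [NormedAddCommGroup W] [NormedSpace ℂ W] [FiniteDimensional ℂ W]

theorem exists_proj (g : Submodule ℂ E) :
    ∃ π : E →L[ℂ] E, (∀ y, π y ∈ g) ∧ ∀ y ∈ g, π y = y := by
  obtain ⟨r, hr⟩ := g.subtype.exists_leftInverse_of_injective (Submodule.ker_subtype g)
  refine ⟨LinearMap.toContinuousLinearMap (g.subtype ∘ₗ r), fun y => (r y).2, fun y hy => ?_⟩
  exact congrArg Subtype.val (LinearMap.congr_fun hr ⟨y, hy⟩)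

/-- The map `y ↦ (f (π y), y - π y)`. -/
noncomputable def levelMap (π : E →L[ℂ] E) (f : E → W)
    (κ : E →L[ℂ] LinearMap.ker π.toLinearMap) (y : E) : W × LinearMap.ker π.toLinearMap :=
  (f (π y), κ y)

theorem exists_coproj {g : Submodule ℂ E} {π : E →L[ℂ] E} (h1 : ∀ y, π y ∈ g)
    (h2 : ∀ y ∈ g, π y = y) :
    ∃ κ : E →L[ℂ] LinearMap.ker π.toLinearMap, ∀ y, (κ y : E) = y - π y :=
  ⟨LinearMap.toContinuousLinearMap
    ((LinearMap.id - π.toLinearMap).codRestrict _ fun y => by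
      change π (y - π y) = 0
      rw [map_sub, h2 _ (h1 y), sub_self]), fun _ => rfl⟩

theorem hasFDerivAt_levelMap {π : E →L[ℂ] E} {f : E → W}
    (κ : E →L[ℂ] LinearMap.ker π.toLinearMap) (hf : AnalyticOnNhd ℂ f univ) {p : E}
    (hp : π p = p) : HasFDerivAt (levelMap π f κ) ((fderiv ℂ f p ∘L π).prod κ) p := by
  have h1 : HasFDerivAt (fun y => f (π y)) (fderiv ℂ f p ∘L π) p := by
    have h := (hf (π p) trivial).differentiableAt.hasFDerivAt.comp p π.hasFDerivAt
    rwa [hp] at h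
  exact h1.prodMk κ.hasFDerivAt

/-- If the differential of an invariant `f` of an action on `g` only kills the infinitesimal
action, then the orbits are open in the fibres of `f`. -/
theorem eventually_mem_orbit {g : Submodule ℂ E} {act : P × E → E} {f : E → W} {p : E}
    (hp : p ∈ g) (hact : ∀ q, AnalyticAt ℂ act q) (hact0 : ∀ y, act (0, y) = y)
    (hg : ∀ t, ∀ y ∈ g, act (t, y) ∈ g) (hf : AnalyticOnNhd ℂ f univ)
    (hinv : ∀ t, ∀ y ∈ g, f (act (t, y)) = f y)
    (hker : ∀ v ∈ g, fderiv ℂ f p v = 0 → ∃ t, fderiv ℂ (fun t => act (t, p)) 0 t = v) :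
    ∀ᶠ q in 𝓝 p, q ∈ g → f q = f p → ∃ t, act (t, p) = q := by
  obtain ⟨π, h1, h2⟩ := exists_proj g
  obtain ⟨κ, hκ⟩ := exists_coproj h1 h2
  have hκ0 : ∀ y ∈ g, κ y = 0 := fun y hy => Subtype.ext (by rw [hκ, h2 y hy, sub_self]; rfl)
  have hpp := h2 p hp
  -- The action is extended from `g` to all of `E` by letting the component `y - π y` ride along.
  -- Then `levelMap` is invariant everywhere, and its level set through `p` lies in `g`.
  set act₁ : P × E → E := fun q => act (q.1, π q.2) + (q.2 - π q.2) with hact₁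
  have han : AnalyticAt ℂ act₁ (0, p) := by
    have h3 : AnalyticAt ℂ (fun q : P × E => π q.2) (0, p) :=
      (π ∘L ContinuousLinearMap.snd ℂ P E).analyticAt _
    exact ((hact (0, π p)).comp_of_eq (analyticAt_fst.prod h3) rfl).add (analyticAt_snd.sub h3)
  have hder : ∀ t, fderiv ℂ act₁ (0, p) (t, 0) = fderiv ℂ (fun t => act (t, p)) 0 t := by
    intro t
    have h3 : HasFDerivAt (fun t => act₁ (t, p))
        (fderiv ℂ act₁ (0, p) ∘L ContinuousLinearMap.inl ℂ P E) 0 :=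
      HasFDerivAt.comp (f := fun t : P => (t, p)) (0 : P) han.differentiableAt.hasFDerivAt
        (hasFDerivAt_prodMk_left (0 : P) p)
    have h4 : (fun t => act₁ (t, p)) = fun t => act (t, p) := by
      funext t
      simp only [hact₁, hpp, sub_self, add_zero]
    rw [h4] at h3
    rw [h3.fderiv]
    rfl
  have key := eventually_mem_orbit_of_level_eq (act := act₁) (Φ := levelMap π f κ) (p := p)
    han.hasStrictFDerivAt (fun y => by simp [hact₁, hact0]) ?_
    (hasFDerivAt_levelMap κ hf hpp) ?_
  · filter_upwards [key] with q hq hqg hfq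
    obtain ⟨t, ht⟩ := hq (by simp only [levelMap, h2 q hqg, hpp, hfq, hκ0 q hqg, hκ0 p hp])
    exact ⟨t, by rw [← ht]; simp only [hact₁, hpp, sub_self, add_zero]⟩
  · intro t y
    have h3 : π (act₁ (t, y)) = act (t, π y) := by
      simp only [hact₁, map_add, map_sub, h2 _ (h1 y), sub_self, add_zero]
      exact h2 _ (hg t _ (h1 y))
    refine Prod.ext ?_ (Subtype.ext ?_)
    · change f (π (act₁ (t, y))) = f (π y)
      rw [h3, hinv _ _ (h1 y)]
    · change (κ (act₁ (t, y)) : E) = κ y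
      rw [hκ, hκ, h3]
      simp only [hact₁]
      abel
  · intro v hv
    have h3 : fderiv ℂ f p (π v) = 0 := congrArg Prod.fst hv
    have h4 : κ v = 0 := congrArg Prod.snd hv
    have h5 : v = π v := by
      have := congrArg Subtype.val h4
      rw [hκ] at this
      exact sub_eq_zero.1 this
    obtain ⟨t, ht⟩ := hker v (by rw [h5]; exact h1 v) (by rw [h5]; exact h3)
    exact ⟨t, (hder t).trans ht⟩

/-- An orbit on which a submersive invariant `f` is constant, and whose tangent spaces are the
kernels of the differentials of `f`, is a complex submanifold. -/
theorem isComplexSubmanifold_orbit {g : Submodule ℂ E} {act : P × E → E} {f : E → W}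
    {S : Set E} {T : E → Submodule ℂ E} {k : ℕ}
    (hact : ∀ q, AnalyticAt ℂ act q) (hact0 : ∀ y, act (0, y) = y)
    (hg : ∀ t, ∀ y ∈ g, act (t, y) ∈ g) (hf : AnalyticOnNhd ℂ f univ)
    (hinv : ∀ t, ∀ y ∈ g, f (act (t, y)) = f y) (hSg : S ⊆ g)
    (hSact : ∀ p ∈ S, ∀ t, act (t, p) ∈ S) (hSf : ∀ p ∈ S, ∀ q ∈ S, f q = f p)
    (hdim : ∀ p ∈ S, finrank ℂ (T p) = k)
    (hT : ∀ p ∈ S, ∀ v, v ∈ T p ↔ v ∈ g ∧ fderiv ℂ f p v = 0)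
    (hsurj : ∀ p ∈ S, ∀ w, ∃ z ∈ g, fderiv ℂ f p z = w)
    (hker : ∀ p ∈ S, ∀ v ∈ T p, ∃ t, fderiv ℂ (fun t => act (t, p)) 0 t = v) :
    IsComplexSubmanifold S T k := by
  obtain ⟨π, h1, h2⟩ := exists_proj g
  obtain ⟨κ, hκ⟩ := exists_coproj h1 h2
  have hκ0 : ∀ y, κ y = 0 ↔ y ∈ g := fun y => by
    rw [← Submodule.coe_eq_zero, hκ, sub_eq_zero]
    exact ⟨fun h => h ▸ h1 y, fun h => (h2 y h).symm⟩
  have hder : ∀ p ∈ S, fderiv ℂ (levelMap π f κ) p = (fderiv ℂ f p ∘L π).prod κ := fun p hp =>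
    (hasFDerivAt_levelMap κ hf (h2 p (hSg hp))).fderiv
  refine isComplexSubmanifold_of_level (levelMap π f κ) ?_ hdim ?_ ?_ ?_
  · intro p _
    exact ((hf (π p) trivial).comp_of_eq (π.analyticAt p) rfl).prod (κ.analyticAt p)
  · intro p hp
    rw [hder p hp]
    -- The two components are hit independently: `z ∈ g` adjusts the value of the differential of
    -- `f`, and `b ∈ ker π` is seen only by `κ`.
    rintro ⟨w, b⟩
    obtain ⟨z, hz, rfl⟩ := hsurj p hp w
    have hb : π b = 0 := b.2
    refine ⟨z + b, Prod.ext ?_ (Subtype.ext ?_)⟩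
    · change fderiv ℂ f p (π (z + b)) = _
      rw [map_add, hb, add_zero, h2 z hz]
    · change (κ (z + b) : E) = b
      rw [hκ, map_add, hb, h2 z hz, add_zero, add_sub_cancel_left]
  · intro p hp
    filter_upwards [eventually_mem_orbit (hSg hp) hact hact0 hg hf hinv fun v hv hv0 =>
      hker p hp v ((hT p hp v).2 ⟨hv, hv0⟩)] with q hq
    constructor
    · intro hqS
      simp only [levelMap, h2 q (hSg hqS), h2 p (hSg hp), hSf p hp q hqS,
        (hκ0 q).2 (hSg hqS), (hκ0 p).2 (hSg hp)]
    · intro h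
      have hqg : q ∈ g := (hκ0 q).1 ((congrArg Prod.snd h).trans ((hκ0 p).2 (hSg hp)))
      have h3 : f (π q) = f (π p) := congrArg Prod.fst h
      rw [h2 q hqg, h2 p (hSg hp)] at h3
      obtain ⟨t, rfl⟩ := hq hqg h3
      exact hSact p hp t
  · intro p hp
    ext v
    rw [hT p hp, hder p hp]
    constructor
    · rintro ⟨hv, hv0⟩
      refine Prod.ext ?_ ((hκ0 v).2 hv)
      change fderiv ℂ f p (π v) = 0
      rw [h2 v hv, hv0]
    · intro h
      have hv : v ∈ g := (hκ0 v).1 (congrArg Prod.snd h)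
      have h3 : fderiv ℂ f p (π v) = 0 := congrArg Prod.fst h
      rw [h2 v hv] at h3
      exact ⟨hv, h3⟩

/-- If the orbits in `M` are open in the fibres of a function `f` whose differentials vanish on the
distribution, then the leaves are contained in the orbits. -/
theorem leaf_subset {M : Set E} {V : E → Submodule ℂ E} {f : E → W} {orb : E → Set E}
    (hself : ∀ p ∈ M, p ∈ orb p) (horb : ∀ p ∈ M, ∀ q ∈ orb p, orb q = orb p)
    (hf : ∀ p ∈ M, DifferentiableAt ℂ f p) (hV : ∀ p ∈ M, ∀ v ∈ V p, fderiv ℂ f p v = 0)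
    (hopen : ∀ p ∈ M, ∀ᶠ q in 𝓝 p, q ∈ M → f q = f p → q ∈ orb p) (p : E) :
    leaf M V p ⊆ orb p := by
  rintro q ⟨γ, γ', h0, h1, -, hγ⟩
  have hcont : ContinuousOn γ (Icc 0 1) := fun t ht => (hγ t ht).2.1.continuousWithinAt
  have hder : ∀ t ∈ Icc (0 : ℝ) 1, HasDerivWithinAt (fun t => f (γ t)) 0 (Icc 0 1) t := by
    intro t ht
    obtain ⟨hM, hd, hv⟩ := hγ t ht
    have h := ((hf _ hM).hasFDerivAt.restrictScalars ℝ).comp_hasDerivWithinAt t hd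
    exact h.congr_deriv (hV _ hM _ hv)
  have hconst : ∀ t ∈ Icc (0 : ℝ) 1, ∀ t' ∈ Icc (0 : ℝ) 1, f (γ t) = f (γ t') := by
    have h : ∀ t ∈ Icc (0 : ℝ) 1, f (γ t) = f (γ 0) := by
      refine constant_of_has_deriv_right_zero (fun t ht => (hder t ht).continuousWithinAt)
        fun t ht => ?_
      exact (hder t ⟨ht.1, ht.2.le⟩).mono_of_mem_nhdsWithin (Icc_mem_nhdsGE_of_mem ht)
    exact fun t ht t' ht' => (h t ht).trans (h t' ht').symm
  -- Along the path `f` is constant, so nearby points of the path lie in the same orbit;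
  -- connectedness of the interval finishes.
  have hloc : IsLocallyConstant fun t : Icc (0 : ℝ) 1 => orb (γ t) := by
    refine (IsLocallyConstant.iff_eventually_eq _).2 fun t => ?_
    have hM := (hγ t t.2).1
    have hc : Tendsto (fun t' : Icc (0 : ℝ) 1 => γ t') (𝓝 t) (𝓝 (γ t)) :=
      (continuousOn_iff_continuous_domRestrict.1 hcont).continuousAt
    filter_upwards [hc.eventually (hopen _ hM)] with t' ht'
    exact horb _ hM _ (ht' (hγ t' t'.2).1 (hconst _ t'.2 _ t.2))
  have h := hloc.apply_eq_of_preconnectedSpace ⟨1, right_mem_Icc.2 zero_le_one⟩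
    ⟨0, left_mem_Icc.2 zero_le_one⟩
  simp only [h0, h1] at h
  rw [← h, ← h1]
  exact hself _ (hγ 1 (right_mem_Icc.2 zero_le_one)).1

/-- A holomorphically parametrized integral manifold is contained in a leaf. -/
theorem mem_leaf {M S : Set E} {V : E → Submodule ℂ E} {k : ℕ} (hS : IsComplexSubmanifold S V k)
    (hSM : S ⊆ M) {ψ : P → E} (hψ : AnalyticOnNhd ℂ ψ univ) (hψS : ∀ z, ψ z ∈ S) (w : P) :
    ψ w ∈ leaf M V (ψ 0) := by
  have := FiniteDimensional.complete ℂ E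
  have hd : ∀ t : ℝ, HasDerivAt (fun t : ℝ => ψ (t • w)) (fderiv ℂ ψ (t • w) w) t := fun t => by
    have h1 : HasDerivAt (fun t : ℝ => t • w) w t := by
      simpa using (hasDerivAt_id t).smul_const w
    exact ((hψ (t • w) trivial).differentiableAt.hasFDerivAt.restrictScalars ℝ).comp_hasDerivAt t h1
  refine ⟨fun t => ψ (t • w), fun t => fderiv ℂ ψ (t • w) w, by simp, by simp, ?_, fun t _ =>
    ⟨hSM (hψS _), (hd t).hasDerivWithinAt, ?_⟩⟩
  · have h2 : Continuous (fderiv ℂ ψ) := continuous_iff_continuousAt.2 fun z =>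
      (hψ z trivial).fderiv.continuousAt
    exact ((h2.comp (by fun_prop : Continuous fun t : ℝ => t • w)).clm_apply
      continuous_const).continuousOn
  · exact hS.hasFDerivAt_mem (hψ (t • w) trivial).differentiableAt.hasFDerivAt
      (Filter.Eventually.of_forall hψS) w

end LevelInSubspace

/-! ### Linear algebra at strongly regular elements -/

section Pairing

variable {n : ℕ} {ι : Type*} [Fintype ι]

/-- The elements of `𝔤ₙ` that are orthogonal to all `G s`. -/
noncomputable def annih (τ : Family) (G : ι → Matrix (Fin n) (Fin n) ℂ) :
    Submodule ℂ (Matrix (Fin n) (Fin n) ℂ) :=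
  (lieAlg τ n).toSubmodule ⊓
    LinearMap.ker (LinearMap.pi fun s => traceLinearMap (Fin n) ℂ ℂ ∘ₗ LinearMap.mulLeft ℂ (G s))

variable {τ : Family} {G : ι → Matrix (Fin n) (Fin n) ℂ}

theorem mem_annih {z : Matrix (Fin n) (Fin n) ℂ} :
    z ∈ annih τ G ↔ z ∈ lieAlg τ n ∧ ∀ s, trace (G s * z) = 0 := by
  refine and_congr Iff.rfl ?_
  exact LinearMap.mem_ker.trans funext_iff

/-- The pairing of `𝔤ₙ` with independent elements of `𝔤ₙ` is onto. -/
theorem exists_trace_eq (hG : ∀ s, G s ∈ lieAlg τ n) (h : LinearIndependent ℂ G) (w : ι → ℂ) :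
    ∃ z ∈ lieAlg τ n, ∀ s, trace (G s * z) = w s := by
  let L : (lieAlg τ n).toSubmodule →ₗ[ℂ] ι → ℂ :=
    (LinearMap.pi fun s => traceLinearMap (Fin n) ℂ ℂ ∘ₗ LinearMap.mulLeft ℂ (G s)) ∘ₗ
      (lieAlg τ n).toSubmodule.subtype
  suffices hL : LinearMap.range L = ⊤ by
    obtain ⟨z, hz⟩ := LinearMap.range_eq_top.1 hL w
    exact ⟨z, z.2, congrFun hz⟩
  by_contra hne
  -- A functional vanishing on the range gives a combination of the `G s` orthogonal to all of `𝔤ₙ`.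
  -- Nondegeneracy of the trace form makes it zero, and independence makes the functional zero.
  obtain ⟨φ, hφ, hle⟩ := Submodule.exists_le_ker_of_lt_top _ (lt_top_iff_ne_top.2 hne)
  classical
  refine hφ (LinearMap.pi_ext' fun s => LinearMap.ext_ring ?_)
  have hsum : ∑ s, φ (Pi.single s 1) • G s = 0 := by
    refine eq_zero_of_trace τ _ (sum_mem fun s _ => (lieAlg τ n).smul_mem _ (hG s)) fun z hz => ?_
    have h1 : φ (L ⟨z, hz⟩) = 0 := hle ⟨_, rfl⟩
    rw [LinearMap.pi_apply_eq_sum_univ φ] at h1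
    rw [Finset.sum_mul, trace_sum, ← h1]
    refine Finset.sum_congr rfl fun s _ => ?_
    rw [smul_mul_assoc, trace_smul, smul_eq_mul, smul_eq_mul, mul_comm]
    have e : (fun j => if s = j then (1 : ℂ) else 0) = Pi.single s 1 := by
      funext j
      simp [Pi.single_apply, eq_comm]
    rw [e]
    rfl
  simpa using Fintype.linearIndependent_iff.1 h _ hsum s

theorem finrank_annih (hG : ∀ s, G s ∈ lieAlg τ n) (h : LinearIndependent ℂ G) :
    finrank ℂ (annih τ G) + Fintype.card ι = finrank ℂ (lieAlg τ n).toSubmodule := by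
  let L : (lieAlg τ n).toSubmodule →ₗ[ℂ] ι → ℂ :=
    (LinearMap.pi fun s => traceLinearMap (Fin n) ℂ ℂ ∘ₗ LinearMap.mulLeft ℂ (G s)) ∘ₗ
      (lieAlg τ n).toSubmodule.subtype
  have h1 := L.finrank_range_add_finrank_ker
  have h2 : LinearMap.range L = ⊤ := LinearMap.range_eq_top.2 fun w => by
    obtain ⟨z, hz, hzw⟩ := exists_trace_eq hG h w
    exact ⟨⟨z, hz⟩, funext hzw⟩
  have h3 : annih τ G = (LinearMap.ker L).map (lieAlg τ n).toSubmodule.subtype := by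
    rw [annih, LinearMap.ker_comp, Submodule.map_comap_subtype]
  rw [h2, finrank_top, finrank_fintype_fun_eq_card] at h1
  rw [h3, Submodule.finrank_map_subtype_eq]
  omega

end Pairing

/-! ### Tangent spaces of the adjoint orbits and the form on them -/

section Tangent

variable {n : ℕ} {τ : Family} {y u v a : Matrix (Fin n) (Fin n) ℂ}

theorem orbitTangent_le (hy : y ∈ lieAlg τ n) (hv : v ∈ orbitTangent τ y) : v ∈ lieAlg τ n := by
  obtain ⟨a, ha, rfl⟩ := hv
  exact (lieAlg τ n).lie_mem hy ha

theorem finrank_orbitTangent (τ : Family) (y : Matrix (Fin n) (Fin n) ℂ) :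
    finrank ℂ (orbitTangent τ y) + finrank ℂ (centralizer τ y) =
      finrank ℂ (lieAlg τ n).toSubmodule := by
  let L : (lieAlg τ n).toSubmodule →ₗ[ℂ] Matrix (Fin n) (Fin n) ℂ :=
    (LieAlgebra.ad ℂ (Matrix (Fin n) (Fin n) ℂ) y : End ℂ (Matrix (Fin n) (Fin n) ℂ)) ∘ₗ
      (lieAlg τ n).toSubmodule.subtype
  have h1 := L.finrank_range_add_finrank_ker
  have h2 : LinearMap.range L = orbitTangent τ y := by
    rw [LinearMap.range_comp, Submodule.range_subtype, orbitTangent]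
  have h3 : centralizer τ y = (LinearMap.ker L).map (lieAlg τ n).toSubmodule.subtype := by
    rw [centralizer, LinearMap.ker_comp, Submodule.map_comap_subtype]
  rw [h3, Submodule.finrank_map_subtype_eq, ← h2]
  exact h1

/-- `ω_y([a, y], v) = tr(a v)` for tangent vectors `v`. -/
theorem kks_left (ha : a ∈ lieAlg τ n) (hv : v ∈ orbitTangent τ y) :
    kks τ y ⁅a, y⁆ v = trace (a * v) := by
  obtain ⟨b, hb, rfl⟩ := hv
  have hb' : -b ∈ lieAlg τ n := (lieAlg τ n).neg_mem hb
  have e : ⁅y, b⁆ = ⁅-b, y⁆ := by rw [neg_lie, lie_skew]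
  change kks τ y ⁅a, y⁆ ⁅y, b⁆ = trace (a * ⁅y, b⁆)
  rw [e, kks_apply τ y a (-b) ha hb', trace_mul_lie']

theorem kks_right (hu : u ∈ orbitTangent τ y) {b : Matrix (Fin n) (Fin n) ℂ}
    (hb : b ∈ lieAlg τ n) : kks τ y u ⁅b, y⁆ = -trace (u * b) := by
  obtain ⟨a, ha, rfl⟩ := hu
  have ha' : -a ∈ lieAlg τ n := (lieAlg τ n).neg_mem ha
  have e : ⁅y, a⁆ = ⁅-a, y⁆ := by rw [neg_lie, lie_skew]
  change kks τ y ⁅y, a⁆ ⁅b, y⁆ = -trace (⁅y, a⁆ * b)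
  rw [e, kks_apply τ y (-a) b ha' hb, trace_mul_lie]

/-- Pairing `u` with `⁅b, y⁆` gives `-tr(u b)`, and the trace form is nondegenerate on `𝔤ₙ`. -/
theorem kks_nondegenerate (hy : y ∈ lieAlg τ n) (hu : u ∈ orbitTangent τ y)
    (h : ∀ v ∈ orbitTangent τ y, kks τ y u v = 0) : u = 0 := by
  refine eq_zero_of_trace τ u (orbitTangent_le hy hu) fun b hb => ?_
  have h1 := h ⁅b, y⁆ ⟨-b, (lieAlg τ n).neg_mem hb, by
    change ⁅y, -b⁆ = ⁅b, y⁆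
    rw [lie_neg, lie_skew]⟩
  rw [kks_right hu hb] at h1
  exact neg_eq_zero.1 h1

end Tangent

/-! ### Dimension counts at regular and strongly regular elements -/

section Sreg

variable {N : ℕ} {τ : Family} {x y : Matrix (Fin (N + 1)) (Fin (N + 1)) ℂ}

/-- The gradients of the basic invariants of `𝔤ₙ` itself. -/
noncomputable abbrev topGrad (τ : Family) (y : Matrix (Fin (N + 1)) (Fin (N + 1)) ℂ)
    (j : Fin (rank τ (N + 1))) : Matrix (Fin (N + 1)) (Fin (N + 1)) ℂ :=
  grad τ (⟨Fin.last N, j⟩ : Index τ (N + 1)) y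

theorem index_cases {p : Index τ (N + 1) → Prop} (s : Index τ (N + 1))
    (h1 : ∀ s : Index τ (N + 1 - 1), p s.incl)
    (h2 : ∀ j : Fin (rank τ (N + 1)), p ⟨Fin.last N, j⟩) : p s := by
  obtain ⟨i, j⟩ := s
  induction i using Fin.lastCases with
  | last => exact h2 j
  | cast i => exact h1 ⟨i, j⟩

theorem incl_injective : Function.Injective (Index.incl : Index τ (N + 1 - 1) → Index τ (N + 1)) := by
  rintro ⟨i, j⟩ ⟨i', j'⟩ h
  simp only [Index.incl, Sigma.mk.injEq] at h
  obtain ⟨h1, h2⟩ := h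
  obtain rfl : i = i' := Fin.castLE_injective _ h1
  exact Sigma.ext rfl h2

theorem top_injective : Function.Injective
    (fun j => ⟨Fin.last N, j⟩ : Fin (rank τ (N + 1)) → Index τ (N + 1)) := fun j j' h => by
  simpa using h

theorem incl_ne_top (s : Index τ (N + 1 - 1)) (j : Fin (rank τ (N + 1))) :
    s.incl ≠ ⟨Fin.last N, j⟩ := fun h => by
  have h1 : (s.1 : ℕ) = N := congrArg (fun s : Index τ (N + 1) => (s.1 : ℕ)) h
  have := s.1.2
  omega

theorem card_index (τ : Family) (n : ℕ) : Fintype.card (Index τ (n - 1)) = gzDim τ n := by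
  simp [Index, gzDim]

theorem card_index_succ (τ : Family) (N : ℕ) :
    Fintype.card (Index τ (N + 1)) = gzDim τ (N + 1) + rank τ (N + 1) := by
  simp [Index, gzDim, Fin.sum_univ_castSucc]

theorem mem_sreg_iff {n : ℕ} {y : Matrix (Fin n) (Fin n) ℂ} :
    y ∈ sreg τ n ↔ y ∈ lieAlg τ n ∧ LinearIndependent ℂ fun s => grad τ s y := by
  refine and_congr_right fun hy => ?_
  have h : ∀ c : Index τ n → ℂ, ∑ s, c s • gzDifferential τ y s = 0 ↔ ∑ s, c s • grad τ s y = 0 := by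
    intro c
    have h1 : ∀ z : lieAlg τ n, (∑ s, c s • gzDifferential τ y s) z =
        trace ((∑ s, c s • grad τ s y) * (z : Matrix (Fin n) (Fin n) ℂ)) := fun z => by
      rw [Finset.sum_apply, Finset.sum_mul, trace_sum]
      refine Finset.sum_congr rfl fun s _ => ?_
      rw [smul_mul_assoc, trace_smul, trace_grad_mul τ s y z.2]
      rfl
    constructor
    · intro h0
      refine eq_zero_of_trace τ _ (sum_mem fun s _ => (lieAlg τ n).smul_mem _ (grad_mem τ s y))
        fun z hz => ?_
      rw [← h1 ⟨z, hz⟩, h0]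
      rfl
    · intro h0
      funext z
      rw [h1, h0, zero_mul, trace_zero]
      rfl
  rw [Fintype.linearIndependent_iff, Fintype.linearIndependent_iff]
  exact forall_congr' fun c => imp_congr_left (h c)

theorem lie_topGrad (hy : y ∈ lieAlg τ (N + 1)) (j : Fin (rank τ (N + 1))) :
    ⁅y, topGrad τ y j⁆ = 0 := lie_grad_last hy

theorem orbitTangent_le_annih (hy : y ∈ lieAlg τ (N + 1)) :
    orbitTangent τ y ≤ annih τ (topGrad τ y) := by
  rintro v ⟨a, ha, rfl⟩
  refine mem_annih.2 ⟨(lieAlg τ (N + 1)).lie_mem hy ha, fun j => ?_⟩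
  change trace (topGrad τ y j * ⁅y, a⁆) = 0
  rw [trace_mul_lie, lie_topGrad hy, zero_mul, trace_zero, neg_zero]

/-- `≤` is the regularity criterion. For `≥`, the tangent space `[y, 𝔤ₙ]` is annihilated by `rank`
independent gradients, which bounds its dimension from above and that of the centralizer from below.
-/
theorem finrank_centralizer (hy : y ∈ lieAlg τ (N + 1)) (h : LinearIndependent ℂ (topGrad τ y)) :
    finrank ℂ (centralizer τ y) = rank τ (N + 1) := by
  have h1 : finrank ℂ (centralizer τ y) ≤ rank τ (N + 1) := finrank_centralizer_le τ hy h
  have h2 := Submodule.finrank_mono (orbitTangent_le_annih hy)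
  have h3 := finrank_annih (G := topGrad τ y) (fun j => grad_mem τ _ y) h
  have h4 := finrank_orbitTangent τ y
  rw [Fintype.card_fin] at h3
  omega

theorem orbitTangent_eq_annih (hy : y ∈ lieAlg τ (N + 1))
    (h : LinearIndependent ℂ (topGrad τ y)) : orbitTangent τ y = annih τ (topGrad τ y) := by
  refine Submodule.eq_of_le_of_finrank_eq (orbitTangent_le_annih hy) ?_
  have h1 := finrank_centralizer hy h
  have h3 := finrank_annih (G := topGrad τ y) (fun j => grad_mem τ _ y) h
  have h4 := finrank_orbitTangent τ y
  rw [Fintype.card_fin] at h3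
  omega

theorem span_topGrad (hy : y ∈ lieAlg τ (N + 1)) (h : LinearIndependent ℂ (topGrad τ y)) :
    Submodule.span ℂ (range (topGrad τ y)) = centralizer τ y := by
  refine Submodule.eq_of_le_of_finrank_eq (Submodule.span_le.2 ?_) ?_
  · rintro _ ⟨j, rfl⟩
    exact ⟨grad_mem τ _ y, lie_topGrad hy j⟩
  · rw [finrank_span_eq_card h, Fintype.card_fin, finrank_centralizer hy h]

theorem linearIndependent_topGrad (hy : y ∈ sreg τ (N + 1)) :
    LinearIndependent ℂ (topGrad τ y) :=
  (mem_sreg_iff.1 hy).2.comp _ top_injective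

/-- The Hamiltonian fields of the `f_{i,j}`, `i < n`, are independent at strongly regular
elements. -/
theorem linearIndependent_hamiltonianField (hy : y ∈ sreg τ (N + 1)) :
    LinearIndependent ℂ fun s : Index τ (N + 1 - 1) => hamiltonianField τ (gzFun τ s.incl) y := by
  obtain ⟨hyg, hli⟩ := mem_sreg_iff.1 hy
  refine Fintype.linearIndependent_iff.2 fun c hc => ?_
  set w := ∑ s : Index τ (N + 1 - 1), c s • grad τ s.incl y with hw
  have h1 : ⁅y, w⁆ = 0 := by
    rw [← hc, hw, lie_sum]
    exact Finset.sum_congr rfl fun s _ => lie_smul _ _ _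
  have h2 : w ∈ centralizer τ y :=
    ⟨sum_mem fun s _ => (lieAlg τ (N + 1)).smul_mem _ (grad_mem τ _ y), h1⟩
  -- The combination `w` of lower gradients now lies in the span of the top ones. Independence of
  -- all the gradients makes the two spans disjoint.
  rw [← span_topGrad hyg (linearIndependent_topGrad hy)] at h2
  have h3 : w ∈ Submodule.span ℂ (range fun s : Index τ (N + 1 - 1) => grad τ s.incl y) :=
    sum_mem fun s _ => Submodule.smul_mem _ _ (Submodule.subset_span ⟨s, rfl⟩)
  have h4 : Disjoint (range (Index.incl : Index τ (N + 1 - 1) → Index τ (N + 1)))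
      (range fun j => (⟨Fin.last N, j⟩ : Index τ (N + 1))) := by
    rw [Set.disjoint_left]
    rintro _ ⟨s, rfl⟩ ⟨j, hj⟩
    exact incl_ne_top s j hj.symm
  have h5 := hli.disjoint_span_image h4
  rw [← range_comp, ← range_comp] at h5
  have h6 : w = 0 := Submodule.disjoint_def.1 h5 w h3 h2
  exact Fintype.linearIndependent_iff.1 (hli.comp _ incl_injective) c h6

/-- Every `f_{k,l}` is constant along every flow, so its differential kills the Hamiltonian fields.
-/
theorem gzDistribution_le_annih (hy : y ∈ lieAlg τ (N + 1)) :
    gzDistribution τ y ≤ annih τ fun s : Index τ (N + 1) => grad τ s y := by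
  refine Submodule.span_le.2 ?_
  rintro _ ⟨s, rfl⟩
  refine mem_annih.2 ⟨(lieAlg τ (N + 1)).lie_mem hy (grad_mem τ _ y), fun s' => ?_⟩
  have hmem : ⁅y, grad τ s.incl y⁆ ∈ lieAlg τ (N + 1) := (lieAlg τ _).lie_mem hy (grad_mem τ _ y)
  change trace (grad τ s' y * ⁅y, grad τ s.incl y⁆) = 0
  rw [trace_grad_mul τ s' y hmem]
  have h1 := (isPolyFun_gzFun τ s').hasDerivAt_comp (c := fun c => gzFlow τ s.incl (1 * c) y)
    (by rw [mul_zero, gzFlow_zero]) (hasDerivAt_gzFlow_entry s.incl 1 y)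
  simp only [gzFun_gzFlow _ _ _ hy, one_smul] at h1
  exact h1.unique (hasDerivAt_const _ _)

/-- For `so`, a skew matrix is determined by its entries below the diagonal; both sums are then
compared by induction on `N`. The reverse inequality, given a strongly regular element, follows from
`V` in `finrank_lieAlg`. -/
theorem finrank_lieAlg_le (τ : Family) (N : ℕ) :
    finrank ℂ (lieAlg τ (N + 1)).toSubmodule ≤ 2 * gzDim τ (N + 1) + rank τ (N + 1) := by
  cases τ with
  | gl =>
    refine (Submodule.finrank_le _).trans ?_
    rw [Module.finrank_matrix, finrank_self, Fintype.card_fin, mul_one]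
    simp only [gzDim, rank]
    rw [Fin.sum_univ_eq_sum_range (fun i => i + 1), Nat.add_sub_cancel]
    induction N with
    | zero => simp
    | succ N ih =>
      rw [Finset.sum_range_succ]
      linarith
  | so =>
    let L : (lieAlg .so (N + 1)).toSubmodule →ₗ[ℂ] (Σ i : Fin (N + 1), Fin i) → ℂ :=
      { toFun := fun v p => (v : Matrix (Fin (N + 1)) (Fin (N + 1)) ℂ) p.1
          (Fin.castLE p.1.2.le p.2)
        map_add' := fun _ _ => rfl
        map_smul' := fun _ _ => rfl }
    have hL : Function.Injective L := by
      refine (injective_iff_map_eq_zero L).2 fun v hv => Subtype.ext (Matrix.ext fun i j => ?_)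
      have h1 : ∀ i j : Fin (N + 1), j < i → (v : Matrix (Fin (N + 1)) (Fin (N + 1)) ℂ) i j = 0 :=
        fun i j hij => congrFun hv ⟨i, ⟨j, hij⟩⟩
      have h2 : ∀ i j : Fin (N + 1), (v : Matrix (Fin (N + 1)) (Fin (N + 1)) ℂ) j i =
          - (v : Matrix (Fin (N + 1)) (Fin (N + 1)) ℂ) i j :=
        fun i j => congrFun (congrFun (mem_so_iff.1 v.2) i) j
      rcases lt_trichotomy i j with h | h | h
      · rw [h2, h1 _ _ h, neg_zero]
        rfl
      · subst h
        exact self_eq_neg.1 (h2 i i)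
      · exact h1 _ _ h
    refine (LinearMap.finrank_le_finrank_of_injective hL).trans ?_
    rw [finrank_fintype_fun_eq_card, Fintype.card_sigma]
    simp only [Fintype.card_fin, gzDim, rank]
    rw [Fin.sum_univ_eq_sum_range (fun i => i), Fin.sum_univ_eq_sum_range (fun i => (i + 1) / 2),
      Nat.add_sub_cancel]
    clear hL L
    induction N with
    | zero => simp
    | succ N ih =>
      rw [Finset.sum_range_succ (fun i => i), Finset.sum_range_succ (fun i => (i + 1) / 2)]
      omega

theorem finrank_lieAlg (hy : y ∈ sreg τ (N + 1)) :
    finrank ℂ (lieAlg τ (N + 1)).toSubmodule = 2 * gzDim τ (N + 1) + rank τ (N + 1) := by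
  have h1 := Submodule.finrank_mono (gzDistribution_le_annih (mem_sreg_iff.1 hy).1)
  have h2 := finrank_annih (G := fun s : Index τ (N + 1) => grad τ s y)
    (fun s => grad_mem τ _ y) (mem_sreg_iff.1 hy).2
  have h3 : finrank ℂ (gzDistribution τ y) = gzDim τ (N + 1) := by
    rw [gzDistribution, finrank_span_eq_card (linearIndependent_hamiltonianField hy), card_index]
  have h4 := finrank_lieAlg_le τ N
  rw [card_index_succ] at h2
  omega

theorem finrank_gzDistribution (hy : y ∈ sreg τ (N + 1)) :
    finrank ℂ (gzDistribution τ y) = gzDim τ (N + 1) := by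
  rw [gzDistribution, finrank_span_eq_card (linearIndependent_hamiltonianField hy), card_index]

/-- Both sides have dimension `d`. It yields the Lagrangian property, the tangent spaces of the
`A`-orbits and the description of the leaves. -/
theorem gzDistribution_eq_annih (hy : y ∈ sreg τ (N + 1)) :
    gzDistribution τ y = annih τ fun s : Index τ (N + 1) => grad τ s y := by
  refine Submodule.eq_of_le_of_finrank_eq (gzDistribution_le_annih (mem_sreg_iff.1 hy).1) ?_
  have h2 := finrank_annih (G := fun s : Index τ (N + 1) => grad τ s y)
    (fun s => grad_mem τ _ y) (mem_sreg_iff.1 hy).2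
  have h4 := finrank_lieAlg hy
  rw [card_index_succ] at h2
  rw [finrank_gzDistribution hy]
  omega

end Sreg

/-! ### The orbits as complex submanifolds -/

section GzMap

variable {n : ℕ} {τ : Family} {ι : Type*} [Fintype ι]

/-- The map whose components are some of the functions `f_{i,j}`. -/
noncomputable def gzMap (σ : ι → Index τ n) (y : Matrix (Fin n) (Fin n) ℂ) (i : ι) : ℂ :=
  gzFun τ (σ i) y

theorem analyticOnNhd_gzMap (σ : ι → Index τ n) : AnalyticOnNhd ℂ (gzMap σ) univ := fun y _ =>
  analyticAt_pi_iff.2 fun i => (isPolyFun_gzFun τ (σ i)).analyticAt y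

theorem fderiv_gzMap (σ : ι → Index τ n) (p : Matrix (Fin n) (Fin n) ℂ)
    {z : Matrix (Fin n) (Fin n) ℂ} (hz : z ∈ lieAlg τ n) (i : ι) :
    fderiv ℂ (gzMap σ) p z i = trace (grad τ (σ i) p * z) := by
  rw [trace_grad_mul _ _ _ hz]
  have h := hasFDerivAt_pi'.1 (analyticOnNhd_gzMap σ p trivial).differentiableAt.hasFDerivAt i
  exact (h.hasLineDerivAt z).lineDeriv.symm

theorem fderiv_gzMap_eq_zero_iff (σ : ι → Index τ n) {p z : Matrix (Fin n) (Fin n) ℂ} :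
    z ∈ lieAlg τ n ∧ fderiv ℂ (gzMap σ) p z = 0 ↔ z ∈ annih τ fun i => grad τ (σ i) p := by
  rw [mem_annih]
  refine and_congr_right fun hz => ?_
  rw [funext_iff]
  exact forall_congr' fun i => by rw [fderiv_gzMap σ p hz]; rfl

theorem exists_fderiv_gzMap_eq (σ : ι → Index τ n) {p : Matrix (Fin n) (Fin n) ℂ}
    (h : LinearIndependent ℂ fun i => grad τ (σ i) p) (w : ι → ℂ) :
    ∃ z ∈ lieAlg τ n, fderiv ℂ (gzMap σ) p z = w := by
  obtain ⟨z, hz, hzw⟩ := exists_trace_eq (fun i => grad_mem τ (σ i) p) h w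
  exact ⟨z, hz, funext fun i => (fderiv_gzMap σ p hz i).trans (hzw i)⟩

theorem fderiv_eq_of_entry {P : Type*} [NormedAddCommGroup P] [NormedSpace ℂ P]
    {ψ : P → Matrix (Fin n) (Fin n) ℂ} (hψ : DifferentiableAt ℂ ψ 0) {w : P}
    {v : Matrix (Fin n) (Fin n) ℂ} (h : ∀ i j, HasDerivAt (fun c : ℂ => ψ (c • w) i j) (v i j) 0) :
    fderiv ℂ ψ 0 w = v := by
  ext i j
  have h1 : HasDerivAt (fun c : ℂ => c • w) w 0 := by
    simpa using (hasDerivAt_id (0 : ℂ)).smul_const w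
  have h2 : HasFDerivAt ψ (fderiv ℂ ψ 0) ((fun c : ℂ => c • w) 0) := by
    simpa using hψ.hasFDerivAt
  have h3 := (LinearMap.toContinuousLinearMap
    (Matrix.entryLinearMap ℂ ℂ i j)).hasFDerivAt.comp_hasDerivAt (0 : ℂ) (h2.comp_hasDerivAt 0 h1)
  exact h3.unique (h i j)

end GzMap

/-! ### Adjoint orbits and `A`-orbits as local level sets -/

section Orbits

variable {N : ℕ} {τ : Family} {x y : Matrix (Fin (N + 1)) (Fin (N + 1)) ℂ}

theorem linearIndependent_topGrad_conj {g g' : Matrix (Fin (N + 1)) (Fin (N + 1)) ℂ}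
    (h : ConjPair τ g g') (hx : LinearIndependent ℂ (topGrad τ x)) :
    LinearIndependent ℂ (topGrad τ (g * x * g')) := by
  have h1 : topGrad τ (g * x * g') =
      (LinearMap.mulLeft ℂ g ∘ₗ LinearMap.mulRight ℂ g') ∘ topGrad τ x := funext fun j =>
    (grad_conj (s := ⟨Fin.last N, j⟩) (levelPair_last h) x).trans (mul_assoc _ _ _)
  rw [h1]
  refine hx.map' _ (LinearMap.ker_eq_bot.2 fun a b hab => ?_)
  have h2 : g * (a * g') = g * (b * g') := hab
  have h3 : g' * (g * (a * g')) * g = g' * (g * (b * g')) * g := by rw [h2]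
  simpa only [← mul_assoc, h.symm.1, one_mul, mul_assoc _ g' g, mul_one] using h3

theorem linearIndependent_topGrad_of_mem (hx : LinearIndependent ℂ (topGrad τ x))
    (hy : y ∈ adjointOrbit τ x) : LinearIndependent ℂ (topGrad τ y) := by
  obtain ⟨g, hg, rfl⟩ := hy
  exact linearIndependent_topGrad_conj (conjPair_of_mem_group hg) hx

theorem mem_adjointOrbit_symm {n : ℕ} {x y : Matrix (Fin n) (Fin n) ℂ}
    (hy : y ∈ adjointOrbit τ x) : x ∈ adjointOrbit τ y := by
  obtain ⟨g, hg, rfl⟩ := hy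
  have h := (conjPair_of_mem_group hg).symm
  refine ⟨g⁻¹, h.mem_group, ?_⟩
  rw [h.inv_eq]
  simp only [← mul_assoc, h.1, one_mul]
  rw [mul_assoc, h.1, mul_one]

theorem mem_lieAlg_of_mem_orbit {n : ℕ} {x y : Matrix (Fin n) (Fin n) ℂ} (hx : x ∈ lieAlg τ n)
    (hy : y ∈ adjointOrbit τ x) : y ∈ lieAlg τ n := by
  obtain ⟨g, hg, rfl⟩ := hy
  exact (conjPair_of_mem_group hg).conj_mem hx

/-- The adjoint action of the exponentials of elements of `𝔤ₙ`. -/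
noncomputable def expAct {n : ℕ} (τ : Family)
    (q : (lieAlg τ n).toSubmodule × Matrix (Fin n) (Fin n) ℂ) : Matrix (Fin n) (Fin n) ℂ :=
  NormedSpace.exp (q.1 : Matrix (Fin n) (Fin n) ℂ) * q.2 *
    NormedSpace.exp (-(q.1 : Matrix (Fin n) (Fin n) ℂ))

theorem analyticAt_expAct {n : ℕ} (q : (lieAlg τ n).toSubmodule × Matrix (Fin n) (Fin n) ℂ) :
    AnalyticAt ℂ (expAct τ) q := by
  have h := analyticAt_conj_exp (A := Matrix (Fin n) (Fin n) ℂ)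
    (F := fun q : (lieAlg τ n).toSubmodule × Matrix (Fin n) (Fin n) ℂ => q.2)
    (G := fun q => (q.1 : Matrix (Fin n) (Fin n) ℂ)) (l := fun _ => -1) (p := q) analyticAt_snd
    (((lieAlg τ n).toSubmodule.subtypeL ∘L ContinuousLinearMap.fst ℂ _ _).analyticAt q)
    analyticAt_const
  simp only [neg_neg, one_smul, neg_smul] at h
  exact h

theorem expAct_zero {n : ℕ} (y : Matrix (Fin n) (Fin n) ℂ) : expAct τ (0, y) = y := by
  simp [expAct, NormedSpace.exp_zero]

theorem fderiv_expAct {n : ℕ} (p : Matrix (Fin n) (Fin n) ℂ) (a : (lieAlg τ n).toSubmodule) :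
    fderiv ℂ (fun t => expAct τ (t, p)) 0 a = ⁅(a : Matrix (Fin n) (Fin n) ℂ), p⁆ :=
  fderiv_eq_of_entry (((analyticAt_expAct (0, p)).comp_of_eq
    (analyticAt_id.prod analyticAt_const) rfl).differentiableAt)
    fun i j => hasDerivAt_conj_entry (a : Matrix (Fin n) (Fin n) ℂ) p i j

/-- The adjoint orbit of an element of `𝔤ₙ`, some conjugate of which is strongly regular, is a
complex submanifold. -/
theorem isComplexSubmanifold_adjointOrbit (hx : x ∈ lieAlg τ (N + 1))
    (hy : y ∈ sregOrbit τ x) :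
    IsComplexSubmanifold (adjointOrbit τ x) (orbitTangent τ) (2 * gzDim τ (N + 1)) := by
  have hxli : LinearIndependent ℂ (topGrad τ x) := linearIndependent_topGrad_of_mem
    (linearIndependent_topGrad hy.2) (mem_adjointOrbit_symm hy.1)
  have hli : ∀ p ∈ adjointOrbit τ x, LinearIndependent ℂ (topGrad τ p) := fun p hp =>
    linearIndependent_topGrad_of_mem hxli hp
  have hmem : ∀ p ∈ adjointOrbit τ x, p ∈ lieAlg τ (N + 1) := fun p hp =>
    mem_lieAlg_of_mem_orbit hx hp
  have hconj : ∀ (s : Fin (rank τ (N + 1))) {g g' : Matrix (Fin (N + 1)) (Fin (N + 1)) ℂ}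
      (_ : ConjPair τ g g') (z : Matrix (Fin (N + 1)) (Fin (N + 1)) ℂ),
      gzFun τ (⟨Fin.last N, s⟩ : Index τ (N + 1)) (g * z * g') =
        gzFun τ (⟨Fin.last N, s⟩ : Index τ (N + 1)) z := fun s g g' h z =>
    gzFun_conj (s := ⟨Fin.last N, s⟩) (levelPair_last h) z
  have hfx : ∀ p ∈ adjointOrbit τ x,
      gzMap (fun j => (⟨Fin.last N, j⟩ : Index τ (N + 1))) p =
        gzMap (fun j => (⟨Fin.last N, j⟩ : Index τ (N + 1))) x := by
    rintro _ ⟨g, hg, rfl⟩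
    exact funext fun j => hconj j (conjPair_of_mem_group hg) x
  -- The invariants are those of `𝔤ₙ` alone. Acting by exponentials, rather than by the whole group,
  -- already produces all tangent directions.
  refine isComplexSubmanifold_orbit (g := (lieAlg τ (N + 1)).toSubmodule) (act := expAct τ)
    (f := gzMap fun j => (⟨Fin.last N, j⟩ : Index τ (N + 1))) analyticAt_expAct expAct_zero
    (fun t y hy => (conjPair_exp t.2).conj_mem hy) (analyticOnNhd_gzMap _)
    (fun t y _ => funext fun j => hconj j (conjPair_exp t.2) y) hmem
    (fun p hp t => adjointOrbit_conj (conjPair_exp t.2) hp)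
    (fun p hp q hq => (hfx q hq).trans (hfx p hp).symm) ?_ ?_
    (fun p hp w => exists_fderiv_gzMap_eq _ (hli p hp) w) ?_
  · intro p hp
    have h1 := finrank_orbitTangent τ p
    have h2 := finrank_centralizer (hmem p hp) (hli p hp)
    have h3 := finrank_lieAlg hy.2
    omega
  · intro p hp v
    rw [orbitTangent_eq_annih (hmem p hp) (hli p hp)]
    exact (fderiv_gzMap_eq_zero_iff fun j => (⟨Fin.last N, j⟩ : Index τ (N + 1))).symm
  · rintro p - v ⟨a, ha, rfl⟩
    refine ⟨⟨-a, (lieAlg τ (N + 1)).neg_mem ha⟩, ?_⟩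
    refine (fderiv_expAct p _).trans ?_
    change ⁅-a, p⁆ = ⁅p, a⁆
    rw [neg_lie, lie_skew]

theorem analyticAt_aAct_right {n : ℕ} (t : Index τ (n - 1) → ℂ) (y : Matrix (Fin n) (Fin n) ℂ) :
    AnalyticAt ℂ (fun p => aAct τ t p) y :=
  analyticAt_aAct (F := fun p => p) (l := fun _ => t) analyticAt_id fun _ => analyticAt_const

theorem analyticAt_aAct_left {n : ℕ} (t : Index τ (n - 1) → ℂ) (y : Matrix (Fin n) (Fin n) ℂ) :
    AnalyticAt ℂ (fun t => aAct τ t y) t :=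
  analyticAt_aAct (F := fun _ => y) (l := fun t => t) analyticAt_const fun s =>
    (ContinuousLinearMap.proj (R := ℂ) s).analyticAt t

theorem hasDerivAt_add_smul {E : Type*} [NormedAddCommGroup E] [NormedSpace ℂ E] (y z : E) :
    HasDerivAt (fun c : ℂ => y + c • z) z 0 := by
  simpa using ((hasDerivAt_id (0 : ℂ)).smul_const z).const_add y

theorem exists_hasDerivAt_line {n : ℕ} {ψ : Matrix (Fin n) (Fin n) ℂ → Matrix (Fin n) (Fin n) ℂ}
    {y : Matrix (Fin n) (Fin n) ℂ} (hψ : DifferentiableAt ℂ ψ y) (z : Matrix (Fin n) (Fin n) ℂ) :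
    ∃ w : Matrix (Fin n) (Fin n) ℂ,
      ∀ i j, HasDerivAt (fun c : ℂ => ψ (y + c • z) i j) (w i j) 0 := by
  refine ⟨fderiv ℂ ψ y z, fun i j => ?_⟩
  have h1 : HasDerivAt (fun c : ℂ => y + c • z) z 0 := hasDerivAt_add_smul y z
  have h2 : HasFDerivAt ψ (fderiv ℂ ψ y) ((fun c : ℂ => y + c • z) 0) := by
    simpa using hψ.hasFDerivAt
  exact (LinearMap.toContinuousLinearMap
    (Matrix.entryLinearMap ℂ ℂ i j)).hasFDerivAt.comp_hasDerivAt (0 : ℂ) (h2.comp_hasDerivAt 0 h1)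

theorem exists_hasDerivAt_aAct {n : ℕ} {y z : Matrix (Fin n) (Fin n) ℂ} (hy : y ∈ lieAlg τ n)
    (hz : z ∈ lieAlg τ n) (t : Index τ (n - 1) → ℂ) :
    ∃ w ∈ lieAlg τ n, ∀ i j, HasDerivAt (fun c : ℂ => aAct τ t (y + c • z) i j) (w i j) 0 := by
  have hd : DifferentiableAt ℂ (fun p => aAct τ t p) y :=
    (analyticAt_aAct_right t y).differentiableAt
  obtain ⟨w, hw⟩ := exists_hasDerivAt_line hd z
  refine ⟨w, ?_, hw⟩
  cases τ with
  | gl => trivial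
  | so =>
    refine mem_so_iff.2 (Matrix.ext fun i j => ?_)
    have h1 : (fun c : ℂ => aAct .so t (y + c • z) j i) = fun c => -aAct .so t (y + c • z) i j :=
      funext fun c => congrFun (congrFun (mem_so_iff.1 (aAct_mem t
        ((lieAlg .so n).add_mem hy ((lieAlg .so n).smul_mem c hz)))) i) j
    have h2 := hw j i
    rw [h1] at h2
    exact h2.unique (hw i j).fun_neg

/-- The `f_{i,j}` are `A`-invariant, so by the chain rule the gradients at `y`, paired with `z`,
equal the gradients at the image point paired with the transported vector `w`. A relation at the
image point is therefore a relation at `y`. -/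
theorem aAct_mem_sreg {n : ℕ} {y : Matrix (Fin n) (Fin n) ℂ} (hy : y ∈ sreg τ n)
    (t : Index τ (n - 1) → ℂ) : aAct τ t y ∈ sreg τ n := by
  obtain ⟨hyg, hli⟩ := mem_sreg_iff.1 hy
  refine mem_sreg_iff.2 ⟨aAct_mem t hyg, Fintype.linearIndependent_iff.2 fun c hc => ?_⟩
  refine Fintype.linearIndependent_iff.1 hli c (eq_zero_of_trace τ _
    (sum_mem fun s _ => (lieAlg τ n).smul_mem _ (grad_mem τ s y)) fun z hz => ?_)
  obtain ⟨w, hwmem, hline⟩ := exists_hasDerivAt_aAct hyg hz t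
  have hs : ∀ s, trace (grad τ s y * z) = trace (grad τ s (aAct τ t y) * w) := by
    intro s
    rw [trace_grad_mul τ s _ hz, trace_grad_mul τ s _ hwmem]
    have h1 := (isPolyFun_gzFun τ s).hasDerivAt_comp (c := fun c : ℂ => aAct τ t (y + c • z))
      (x := aAct τ t y) (by rw [zero_smul, add_zero]) hline
    have h2 := (isPolyFun_gzFun τ s).hasDerivAt_comp (c := fun c : ℂ => y + c • z) (c' := z)
      (x := y) (t := 0) (by simp)
      fun i j => by simpa using ((hasDerivAt_id (0 : ℂ)).mul_const (z i j)).const_add (y i j)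
    have h3 : (fun c : ℂ => gzFun τ s (aAct τ t (y + c • z))) = fun c => gzFun τ s (y + c • z) :=
      funext fun c => gzFun_aAct s t ((lieAlg τ n).add_mem hyg ((lieAlg τ n).smul_mem c hz))
    rw [h3] at h1
    exact h2.unique h1
  rw [Finset.sum_mul, trace_sum]
  simp only [smul_mul_assoc, trace_smul, hs]
  rw [← trace_zero (n := Fin n) (R := ℂ), ← zero_mul w, ← hc, Finset.sum_mul, trace_sum]
  simp only [smul_mul_assoc, trace_smul]

theorem aOrbit_subset_sregOrbit {n : ℕ} {x y : Matrix (Fin n) (Fin n) ℂ}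
    (hy : y ∈ sregOrbit τ x) : aOrbit τ y ⊆ sregOrbit τ x := by
  rintro _ ⟨t, rfl⟩
  exact ⟨aAct_mem_orbit t hy.1, aAct_mem_sreg hy.2 t⟩

theorem exists_fderiv_aAct_eq {n : ℕ} {p v : Matrix (Fin n) (Fin n) ℂ} (hp : p ∈ lieAlg τ n)
    (hv : v ∈ gzDistribution τ p) : ∃ t, fderiv ℂ (fun t => aAct τ t p) 0 t = v := by
  suffices h : gzDistribution τ p ≤ LinearMap.range (fderiv ℂ (fun t => aAct τ t p) 0).toLinearMap
    from h hv
  refine Submodule.span_le.2 ?_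
  rintro _ ⟨s, rfl⟩
  obtain ⟨k, hk, hact⟩ := exists_aAct_single (τ := τ) s
  have h1 : fderiv ℂ (fun t => aAct τ t p) 0 (Pi.single s 1) =
      k • hamiltonianField τ (gzFun τ s.incl) p := by
    refine fderiv_eq_of_entry (analyticAt_aAct_left 0 p).differentiableAt fun i j => ?_
    have h2 : ∀ c : ℂ, aAct τ (c • Pi.single s 1) p = gzFlow τ s.incl (k * c) p := fun c => by
      rw [← Pi.single_smul, smul_eq_mul, mul_one, hact c p hp]
    simp only [h2]
    exact hasDerivAt_gzFlow_entry s.incl k p i j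
  refine ⟨k⁻¹ • Pi.single s 1, ?_⟩
  change fderiv ℂ (fun t => aAct τ t p) 0 _ = _
  rw [map_smul, h1, smul_smul, inv_mul_cancel₀ hk, one_smul]

theorem analyticAt_aAct_prod {n : ℕ} (q : (Index τ (n - 1) → ℂ) × Matrix (Fin n) (Fin n) ℂ) :
    AnalyticAt ℂ (fun q : (Index τ (n - 1) → ℂ) × Matrix (Fin n) (Fin n) ℂ => aAct τ q.1 q.2) q :=
  analyticAt_aAct analyticAt_snd fun s =>
    (ContinuousLinearMap.proj (R := ℂ) s ∘L ContinuousLinearMap.fst ℂ _ _).analyticAt q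

theorem mem_gzDistribution_iff (hy : y ∈ sreg τ (N + 1))
    {v : Matrix (Fin (N + 1)) (Fin (N + 1)) ℂ} :
    v ∈ gzDistribution τ y ↔ v ∈ lieAlg τ (N + 1) ∧
      fderiv ℂ (gzMap fun s : Index τ (N + 1) => s) y v = 0 := by
  rw [gzDistribution_eq_annih hy]
  exact (fderiv_gzMap_eq_zero_iff fun s : Index τ (N + 1) => s).symm

/-- The `A`-orbit is a local level set of all the `f_{i,j}` inside `𝔤ₙ`: their common kernel is `V`,
and the derivative of the action fills `V`. -/
theorem isComplexSubmanifold_aOrbit (hy : y ∈ sreg τ (N + 1)) :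
    IsComplexSubmanifold (aOrbit τ y) (gzDistribution τ) (gzDim τ (N + 1)) := by
  have hyg := (mem_sreg_iff.1 hy).1
  have hsreg : ∀ p ∈ aOrbit τ y, p ∈ sreg τ (N + 1) := by
    rintro _ ⟨t, rfl⟩
    exact aAct_mem_sreg hy t
  have hmem : ∀ p ∈ aOrbit τ y, p ∈ lieAlg τ (N + 1) := fun p hp => (hsreg p hp).1
  have hfy : ∀ p ∈ aOrbit τ y, gzMap (fun s : Index τ (N + 1) => s) p = gzMap (fun s => s) y := by
    rintro _ ⟨t, rfl⟩
    exact funext fun s => gzFun_aAct s t hyg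
  exact isComplexSubmanifold_orbit (g := (lieAlg τ (N + 1)).toSubmodule)
    (act := fun q : (Index τ (N + 1 - 1) → ℂ) × _ => aAct τ q.1 q.2)
    (f := gzMap fun s : Index τ (N + 1) => s) analyticAt_aAct_prod aAct_zero
    (fun t y hy => aAct_mem t hy) (analyticOnNhd_gzMap _)
    (fun t y hy => funext fun s => gzFun_aAct s t hy) hmem
    (fun p hp t => aOrbit_subset_of_mem hyg hp ⟨t, rfl⟩)
    (fun p hp q hq => (hfy q hq).trans (hfy p hp).symm)
    (fun p hp => finrank_gzDistribution (hsreg p hp))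
    (fun p hp v => mem_gzDistribution_iff (hsreg p hp))
    (fun p hp w => exists_fderiv_gzMap_eq _ (mem_sreg_iff.1 (hsreg p hp)).2 w)
    fun p hp v hv => exists_fderiv_aAct_eq (hmem p hp) hv

end Orbits

/-! ### Symplectic structure, Lagrangian submanifolds and leaves -/

section Zariski

variable {n : ℕ} {τ : Family} {x : Matrix (Fin n) (Fin n) ℂ}

theorem IsZariskiOpenIn.exists_isOpen {S X : Set (Matrix (Fin n) (Fin n) ℂ)}
    (h : IsZariskiOpenIn S X) : ∃ O, IsOpen O ∧ S = X ∩ O := by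
  obtain ⟨I, rfl⟩ := h
  refine ⟨⋃ p ∈ I, {y | MvPolynomial.eval (fun k => y k.1 k.2) p ≠ 0},
    isOpen_biUnion fun p _ => isOpen_ne_fun ?_ continuous_const, ?_⟩
  · have h : IsPolyFun fun y : Matrix (Fin n) (Fin n) ℂ =>
      MvPolynomial.eval (fun k => y k.1 k.2) p := ⟨p, fun _ => rfl⟩
    exact continuous_iff_continuousAt.2 fun y => (h.analyticAt y).continuousAt
  · ext y
    simp

theorem isZariskiOpenIn_sregOrbit (hx : x ∈ lieAlg τ n) :
    IsZariskiOpenIn (sregOrbit τ x) (adjointOrbit τ x) := by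
  -- Gradients are independent exactly when, for some vectors `z t` of `𝔤ₙ`, the matrix of their
  -- pairings has nonzero determinant. For fixed `z` this determinant is a polynomial in `y`; dual
  -- vectors make the matrix the identity.
  refine ⟨{p | ∃ z : Index τ n → Matrix (Fin n) (Fin n) ℂ, (∀ t, z t ∈ lieAlg τ n) ∧
    ∀ y, MvPolynomial.eval (fun k => y k.1 k.2) p =
      (Matrix.of fun s t => lineDeriv ℂ (gzFun τ s) y (z t)).det}, ?_⟩
  ext y
  refine and_congr_right fun hy => ?_
  have hyg := mem_lieAlg_of_mem_orbit hx hy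
  rw [mem_sreg_iff]
  constructor
  · rintro ⟨-, hli⟩
    choose z hz hzw using fun t : Index τ n =>
      exists_trace_eq (fun s => grad_mem τ s y) hli (Pi.single t 1)
    obtain ⟨p, hp⟩ : IsPolyFun fun y =>
        (Matrix.of fun s t => lineDeriv ℂ (gzFun τ s) y (z t)).det :=
      .det fun s t => (isPolyFun_gzFun τ s).lineDeriv (z t)
    refine ⟨p, ⟨z, hz, fun y => (hp y).symm⟩, ?_⟩
    have h1 : (Matrix.of fun s t => lineDeriv ℂ (gzFun τ s) y (z t)) = 1 := by
      ext s t
      rw [of_apply, ← trace_grad_mul τ s y (hz t), hzw, Matrix.one_apply, Pi.single_apply]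
    change MvPolynomial.eval (fun k => y k.1 k.2) p ≠ 0
    rw [← hp y]
    change (Matrix.of fun s t => lineDeriv ℂ (gzFun τ s) y (z t)).det ≠ 0
    rw [h1, det_one]
    exact one_ne_zero
  · rintro ⟨p, ⟨z, hz, hp⟩, hne⟩
    rw [hp] at hne
    refine ⟨hyg, Fintype.linearIndependent_iff.2 fun c hc => congrFun
      (Matrix.eq_zero_of_vecMul_eq_zero hne (v := c) (funext fun t => ?_))⟩
    have h1 : trace ((∑ s, c s • grad τ s y) * z t) = 0 := by rw [hc, zero_mul, trace_zero]
    rw [Finset.sum_mul, trace_sum] at h1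
    rw [Pi.zero_apply, ← h1]
    refine Finset.sum_congr rfl fun s _ => ?_
    rw [smul_mul_assoc, trace_smul, smul_eq_mul, trace_grad_mul τ s y (hz t)]
    rfl

end Zariski

/-! ### The Lagrangian property, the polarization and its leaves -/

section Symplectic

variable {N : ℕ} {τ : Family} {x y : Matrix (Fin (N + 1)) (Fin (N + 1)) ℂ}

theorem isRegular_of_sregOrbit (hx : x ∈ lieAlg τ (N + 1)) (hy : y ∈ sregOrbit τ x) :
    IsRegular τ x :=
  finrank_centralizer hx (linearIndependent_topGrad_of_mem (linearIndependent_topGrad hy.2)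
    (mem_adjointOrbit_symm hy.1))

theorem isSymplecticManifold_sregOrbit (hx : x ∈ lieAlg τ (N + 1)) (hy : y ∈ sregOrbit τ x) :
    IsSymplecticManifold (sregOrbit τ x) (orbitTangent τ) (2 * gzDim τ (N + 1)) (kks τ) := by
  have h : IsComplexSubmanifold (sregOrbit τ x) (orbitTangent τ) (2 * gzDim τ (N + 1)) := by
    obtain ⟨O, hO, hO'⟩ := (isZariskiOpenIn_sregOrbit hx).exists_isOpen
    rw [hO']
    exact (isComplexSubmanifold_adjointOrbit hx hy).inter_open hO
  exact ⟨h, isClosedHolomorphicTwoForm_kks τ h, fun p hp u hu hv =>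
    kks_nondegenerate hp.2.1 hu hv⟩

theorem gzDistribution_le_orbitTangent (τ : Family) (y : Matrix (Fin (N + 1)) (Fin (N + 1)) ℂ) :
    gzDistribution τ y ≤ orbitTangent τ y := by
  refine Submodule.span_le.2 ?_
  rintro _ ⟨s, rfl⟩
  exact ⟨_, grad_mem τ s.incl y, rfl⟩

/-- On tangent vectors, `ω(ξ_f, v) = -df(v)`. So `v ⊥ V` says that the lower differentials kill `v`;
the top ones kill every tangent vector, and the common kernel of all of them is `V`. -/
theorem isLagrangianSubspace_gzDistribution (hy : y ∈ sreg τ (N + 1)) :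
    IsLagrangianSubspace (orbitTangent τ y) (kks τ y) (gzDistribution τ y) := by
  refine ⟨gzDistribution_le_orbitTangent τ y, fun v hv => ⟨fun hvV u hu => ?_, fun h => ?_⟩⟩
  · rw [gzDistribution_eq_annih hy, mem_annih] at hvV
    suffices hu' : ∃ a ∈ lieAlg τ (N + 1), ⁅a, y⁆ = u ∧ trace (a * v) = 0 by
      obtain ⟨a, ha, rfl, h0⟩ := hu'
      rw [kks_left ha hv, h0]
    refine Submodule.span_induction ?_ ?_ ?_ ?_ hu
    · rintro _ ⟨s, rfl⟩
      refine ⟨-grad τ s.incl y, (lieAlg τ _).neg_mem (grad_mem τ _ y), ?_, ?_⟩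
      · change _ = ⁅y, grad τ s.incl y⁆
        rw [neg_lie, lie_skew]
      · rw [neg_mul, trace_neg, hvV.2, neg_zero]
    · exact ⟨0, (lieAlg τ _).zero_mem, zero_lie _, by rw [zero_mul, trace_zero]⟩
    · rintro _ _ _ _ ⟨a, ha, rfl, h1⟩ ⟨b, hb, rfl, h2⟩
      exact ⟨a + b, (lieAlg τ _).add_mem ha hb, add_lie _ _ _, by
        rw [add_mul, trace_add, h1, h2, add_zero]⟩
    · rintro c _ _ ⟨a, ha, rfl, h1⟩
      exact ⟨c • a, (lieAlg τ _).smul_mem c ha, smul_lie _ _ _, by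
        rw [smul_mul_assoc, trace_smul, h1, smul_zero]⟩
  · rw [gzDistribution_eq_annih hy]
    have hv' := mem_annih.1 (orbitTangent_le_annih hy.1 hv)
    refine mem_annih.2 ⟨hv'.1, fun s => index_cases (p := fun s => trace (grad τ s y * v) = 0) s
      (fun s => ?_) hv'.2⟩
    have hneg : -grad τ s.incl y ∈ lieAlg τ (N + 1) := (lieAlg τ _).neg_mem (grad_mem τ _ y)
    have h1 := h ⁅-grad τ s.incl y, y⁆ (Submodule.subset_span ⟨s, by
      change ⁅y, grad τ s.incl y⁆ = _
      rw [neg_lie, lie_skew]⟩)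
    rw [kks_left hneg hv, neg_mul, trace_neg] at h1
    exact neg_eq_zero.1 h1

theorem isLagrangianSubmanifold_aOrbit (hy : y ∈ sregOrbit τ x) :
    IsLagrangianSubmanifold (sregOrbit τ x) (orbitTangent τ) (kks τ) (aOrbit τ y)
      (gzDistribution τ) (gzDim τ (N + 1)) :=
  ⟨aOrbit_subset_sregOrbit hy, isComplexSubmanifold_aOrbit hy.2, fun _ hp =>
    isLagrangianSubspace_gzDistribution (aOrbit_subset_sregOrbit hy hp).2⟩

theorem analyticAt_hamiltonianField {n : ℕ} (s : Index τ n) (y : Matrix (Fin n) (Fin n) ℂ) :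
    AnalyticAt ℂ (hamiltonianField τ (gzFun τ s)) y := by
  have h : ∀ {A : Type} [NormedRing A] [NormedAlgebra ℂ A] {G : A → A} {p : A},
      AnalyticAt ℂ G p → AnalyticAt ℂ (fun q => q * G q - G q * q) p := fun hG =>
    (analyticAt_id.mul hG).sub (hG.mul analyticAt_id)
  exact h (A := Matrix (Fin n) (Fin n) ℂ) ((isPolyFun_gzFun τ s).analyticAt_gradient τ y)

theorem isPolarization_gzDistribution (x : Matrix (Fin (N + 1)) (Fin (N + 1)) ℂ) :
    IsPolarization (sregOrbit τ x) (orbitTangent τ) (kks τ) (gzDistribution τ) where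
  isLagrangian _ hp := isLagrangianSubspace_gzDistribution hp.2
  isSubbundle p _ := by
    let e := Fintype.equivFin (Index τ (N + 1 - 1))
    refine ⟨univ, _, fun i => hamiltonianField τ (gzFun τ (e.symm i).incl), isOpen_univ, trivial,
      fun i y _ => analyticAt_hamiltonianField _ y, fun q hq => ⟨?_, ?_⟩⟩
    · exact (linearIndependent_hamiltonianField hq.1.2).comp _ e.symm.injective
    · rw [gzDistribution]
      congr 1
      exact e.symm.surjective.range_comp fun s : Index τ (N + 1 - 1) =>
        hamiltonianField τ (gzFun τ s.incl) q
  isIntegrable p hp := ⟨aOrbit τ p, gzDim τ (N + 1), self_mem_aOrbit τ p,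
    aOrbit_subset_sregOrbit hp, isComplexSubmanifold_aOrbit hp.2⟩

/-- The `A`-orbits in the set of strongly regular elements are open in the fibres of the map with
components `f_{i,j}`. -/
theorem eventually_mem_aOrbit (hy : y ∈ sreg τ (N + 1)) :
    ∀ᶠ q in nhds y, q ∈ (lieAlg τ (N + 1)).toSubmodule →
      gzMap (fun s : Index τ (N + 1) => s) q = gzMap (fun s : Index τ (N + 1) => s) y →
        ∃ t, aAct τ t y = q :=
  eventually_mem_orbit (g := (lieAlg τ (N + 1)).toSubmodule)
    (act := fun q : (Index τ (N + 1 - 1) → ℂ) × _ => aAct τ q.1 q.2)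
    (f := gzMap fun s : Index τ (N + 1) => s) hy.1 analyticAt_aAct_prod aAct_zero
    (fun t _ hp => aAct_mem t hp) (analyticOnNhd_gzMap _)
    (fun t _ hp => funext fun s => gzFun_aAct s t hp)
    fun _ hv hv0 => exists_fderiv_aAct_eq hy.1 ((mem_gzDistribution_iff hy).2 ⟨hv, hv0⟩)

/-- Vectors of `V` are killed by all `df_{i,j}`, and `A`-orbits are open in the common fibres, so
`leaf_subset` applies. Conversely, the images of segments from `0` in `A` are paths tangent to `V`.
-/
theorem leaf_gzDistribution (hy : y ∈ sregOrbit τ x) :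
    leaf (sregOrbit τ x) (gzDistribution τ) y = aOrbit τ y := by
  refine Subset.antisymm ?_ ?_
  · refine leaf_subset (f := gzMap fun s : Index τ (N + 1) => s) (fun p _ => self_mem_aOrbit τ p)
      (fun p hp q hq => aOrbit_eq_of_mem hp.2.1 hq)
      (fun p _ => (analyticOnNhd_gzMap _ p trivial).differentiableAt)
      (fun p hp v hv => ((mem_gzDistribution_iff hp.2).1 hv).2) (fun p hp => ?_) y
    filter_upwards [eventually_mem_aOrbit hp.2] with q hq hqM hqf
    exact hq hqM.2.1 hqf
  · rintro _ ⟨w, rfl⟩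
    have h := mem_leaf (isComplexSubmanifold_aOrbit hy.2) (aOrbit_subset_sregOrbit hy)
      (ψ := fun t => aAct τ t y) (fun t _ => analyticAt_aAct_left t y) (fun t => ⟨t, rfl⟩) w
    rwa [aAct_zero] at h

theorem sregOrbit_eq_iUnion {n : ℕ} (τ : Family) (x : Matrix (Fin n) (Fin n) ℂ) :
    sregOrbit τ x = ⋃ y ∈ sregOrbit τ x, aOrbit τ y :=
  Subset.antisymm (fun y hy => mem_biUnion hy (self_mem_aOrbit τ y))
    (iUnion₂_subset fun _ hy => aOrbit_subset_sregOrbit hy)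

end Symplectic

end GZ

theorem proposition2p5 (τ : GZ.Family) (n : ℕ) (hn : 1 ≤ n) (x : Matrix (Fin n) (Fin n) ℂ)
    (hx : x ∈ GZ.lieAlg τ n) (hne : (GZ.sregOrbit τ x).Nonempty) :
    -- `x` is regular
    GZ.IsRegular τ x ∧
    -- `𝒪ₓ^{sreg}` is Zariski open in `𝒪ₓ`
    GZ.IsZariskiOpenIn (GZ.sregOrbit τ x) (GZ.adjointOrbit τ x) ∧
    -- `dim 𝒪ₓ = 2d`
    GZ.IsComplexSubmanifold (GZ.adjointOrbit τ x) (GZ.orbitTangent τ) (2 * GZ.gzDim τ n) ∧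
    -- `𝒪ₓ^{sreg}` is a symplectic manifold
    GZ.IsSymplecticManifold (GZ.sregOrbit τ x) (GZ.orbitTangent τ) (2 * GZ.gzDim τ n)
      (GZ.kks τ) ∧
    -- `𝒪ₓ^{sreg}` is a union of `A`-orbits, which are Lagrangian submanifolds of dimension `d`
    GZ.sregOrbit τ x = ⋃ y ∈ GZ.sregOrbit τ x, GZ.aOrbit τ y ∧
    (∀ y ∈ GZ.sregOrbit τ x,
      GZ.IsLagrangianSubmanifold (GZ.sregOrbit τ x) (GZ.orbitTangent τ) (GZ.kks τ)
        (GZ.aOrbit τ y) (GZ.gzDistribution τ) (GZ.gzDim τ n)) ∧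
    -- the `A`-orbits are the leaves of a polarization of `𝒪ₓ^{sreg}`
    GZ.IsPolarization (GZ.sregOrbit τ x) (GZ.orbitTangent τ) (GZ.kks τ)
      (GZ.gzDistribution τ) ∧
    ∀ y ∈ GZ.sregOrbit τ x,
      GZ.leaf (GZ.sregOrbit τ x) (GZ.gzDistribution τ) y = GZ.aOrbit τ y := by
  obtain ⟨N, rfl⟩ : ∃ N, n = N + 1 := ⟨n - 1, by omega⟩
  obtain ⟨y, hy⟩ := hne
  exact ⟨GZ.isRegular_of_sregOrbit hx hy, GZ.isZariskiOpenIn_sregOrbit hx,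
    GZ.isComplexSubmanifold_adjointOrbit hx hy, GZ.isSymplecticManifold_sregOrbit hx hy,
    GZ.sregOrbit_eq_iUnion τ x, fun _ hz => GZ.isLagrangianSubmanifold_aOrbit hz,
    GZ.isPolarization_gzDistribution x, fun _ hz => GZ.leaf_gzDistribution hz⟩
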